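/- Let $J\ge 1$ and let $\mathbb{Y}$ be a Polish space with its Borel $\sigma$-field and a dominating measure $\mathcal{L}$. Let $\theta=(\nu,Q,(f_x)_{x\in\{1,\dots,J\}})$ consist of an initial distribution $\nu$ on $\{1,\dots,J\}$, a $J\times J$ transition matrix $Q$ and probability densities $f_x$ with respect to $\mathcal{L}$. Under $\mathbb{P}_\theta$, $(X_i)_{i\ge1}$ is a Markov chain with initial distribution $\nu$ and transition matrix $Q$, and conditionally on $(X_i)_{i\ge 1}$ the observations $Y_i$ are independent with $Y_i\sim f_{X_i}\,d\mathcal{L}$. For $n\ge1$ let $\Pi_n$ be the partition of $[n]=\{1,\dots,n\}$ into the classes of $i\sim j\iff X_i=X_j$. For partitions $A,B$ of $[n]$ put $$\ell(A,B)=1-\frac1n\max_{M}\sum_{(C,C')\in M}\mathrm{Card}(C\cap C'),$$ the maximum being over all matchings $M\subseteq A\times B$ (sets of pairs in which each block of $A$ and each block of $B$ appears at most once). Let $$\mathcal{R}^{\mathrm{clust}}_n(\theta,g)=\mathbb{E}_\theta\big[\ell(g(Y_{1:n}),\Pi_n)\big],\qquad \mathcal{R}^{\mathrm{class}}_n(\theta,h)=\mathbb{E}_\theta\Big[\frac1n\sum_{i=1}^n\mathbf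 1_{h_i(Y_{1:n})\ne X_i}\Big]$$ for $g$ in the set $\mathcal{G}_n$ of measurable maps from $\mathbb{Y}^n$ to the partitions of $[n]$ and $h$ in the set $\mathcal{H}_n$ of measurable maps $\mathbb{Y}^n\to\{1,\dots,J\}^n$. Assume that the rows of $Q$ are not all equal, that $\delta:=\min_{x,x'}Q_{x,x'}>0$ and that $\min_x\nu_x\ge\delta$. Then for all $n\ge1$ \begin{align*} \inf_{g\in\mathcal{G}_n}\mathcal{R}^{\mathrm{clust}}_n(\theta,g)&\ge\inf_{h\in\mathcal{H}_n}\mathcal{R}^{\mathrm{class}}_n(\theta,h)-\frac1{1-\rho_0}\sqrt{\frac{\log(J!)}{2n}},\\ \inf_{g\in\mathcal{G}_n}\mathcal{R}^{\mathrm{clust}}_n(\theta,g)&\ge(1-\tilde\xi_n)\inf_{h\in\mathcal{H}_n}\mathcal{R}^{\mathrm{class}}_n(\theta,h)-(J^2+1)\,e^{-2n(1-\rho_0)^2\beta^2/25}, \end{align*} where $\rho_0=\frac{1-J\delta}{1-(J-1)\delta}$, $\beta=\min_{i\in[n],\,j\ne k}\mathbb{P}_\theta(X_i\in\{j,k\})$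 and $\tilde\xi_n=\frac{5}{\beta(1-\rho_0)}\sqrt{\frac{\log(J!)}{2n}}$. -/

import Mathlib

open MeasureTheory
open scoped NNReal ENNReal Nat

noncomputable section

namespace HMMClust

/-- Parameters `θ = (ν, Q, (f_x))` of a hidden Markov model with hidden states `Fin J`, where the
emission distributions have densities `f_x` with respect to the dominating measure `L`. -/
structure Param (J : ℕ) {𝕐 : Type*} [MeasurableSpace 𝕐] (L : Measure 𝕐) where
  /-- the initial distribution -/
  ν : Fin J → ℝ
  /-- the transition matrix -/
  Q : Matrix (Fin J) (Fin J) ℝ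
  /-- the emission densities -/
  f : Fin J → 𝕐 → ℝ≥0
  ν_nonneg : ∀ x, 0 ≤ ν x
  ν_sum : ∑ x, ν x = 1
  Q_nonneg : ∀ x x', 0 ≤ Q x x'
  Q_sum : ∀ x, ∑ x', Q x x' = 1
  f_measurable : ∀ x, Measurable (f x)
  f_lintegral : ∀ x, ∫⁻ y, (f x y : ℝ≥0∞) ∂L = 1

section Model

variable {J : ℕ} {𝕐 : Type*} [MeasurableSpace 𝕐] {L : Measure 𝕐}

/-- The emission distribution `f_x dL` of the state `x`. -/
def Param.emission (θ : Param J L) (x : Fin J) : Measure 𝕐 :=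
  L.withDensity (fun y => (θ.f x y : ℝ≥0∞))

/-- The probability `ν(x₁) Q(x₁, x₂) ⋯ Q(xₙ₋₁, xₙ)` that the chain starts with the path `x`
(the indices `0, …, n - 1` of `Fin n` stand for the times `1, …, n`). -/
def Param.pathProb (θ : Param J L) {n : ℕ} (x : Fin n → Fin J) : ℝ :=
  ∏ i : Fin n, if (i : ℕ) = 0 then θ.ν (x i)
    else θ.Q (x ⟨(i : ℕ) - 1, lt_of_le_of_lt (Nat.sub_le _ _) i.isLt⟩) (x i)

/-- The joint law of `(X_{1:n}, Y_{1:n})` under `θ`: the states form a Markov chain with initial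
distribution `ν` and transition matrix `Q` and, given the states, the observations are
independent, `Y_i` having law `f_{X_i} dL`. -/
def Param.law (θ : Param J L) (n : ℕ) : Measure ((Fin n → Fin J) × (Fin n → 𝕐)) :=
  ∑ x : Fin n → Fin J,
    ENNReal.ofReal (θ.pathProb x) •
      (Measure.dirac x).prod (Measure.pi fun i => θ.emission (x i))

/-- The dependent case: the rows of the transition matrix are not all equal. -/
def Param.IsDependent (θ : Param J L) : Prop :=
  ∃ x x', θ.Q x ≠ θ.Q x'

/-- `δ = min_{x, x'} Q_{x, x'}`. -/
def Param.delta (θ : Param J L) : ℝ :=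
  ⨅ p : Fin J × Fin J, θ.Q p.1 p.2

/-- The mixing assumption: `δ > 0` and `min_x ν_x ≥ δ`. -/
def Param.IsMixing (θ : Param J L) : Prop :=
  0 < θ.delta ∧ ∀ x, θ.delta ≤ θ.ν x

/-- `ρ₀ = (1 - J δ) / (1 - (J - 1) δ)`. -/
def Param.rho0 (θ : Param J L) : ℝ :=
  (1 - J * θ.delta) / (1 - ((J : ℝ) - 1) * θ.delta)

/-- `β = min_{i ∈ [n], j ≠ k} P_θ (X_i ∈ {j, k})`. -/
def Param.beta (θ : Param J L) (n : ℕ) : ℝ :=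
  ⨅ t : {t : Fin n × Fin J × Fin J // t.2.1 ≠ t.2.2},
    (θ.law n).real {ω | ω.1 t.1.1 = t.1.2.1 ∨ ω.1 t.1.1 = t.1.2.2}

/-- `ξ̃_n = (5 / (β (1 - ρ₀))) √(log (J!) / (2 n))`. -/
def Param.xi (θ : Param J L) (n : ℕ) : ℝ :=
  5 / (θ.beta n * (1 - θ.rho0)) * Real.sqrt (Real.log (J ! : ℝ) / (2 * n))

end Model

section Partitions

/-- `𝒫[n]`, the set of partitions of `{1, …, n}`. -/
abbrev Partitions (n : ℕ) : Type := Finpartition (Finset.univ : Finset (Fin n))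

/-- The finite set of partitions carries the discrete σ-field. -/
instance (n : ℕ) : MeasurableSpace (Partitions n) := ⊤

/-- A set of edges of the complete bipartite graph between the blocks of two partitions is a
matching if no two distinct edges share a vertex. -/
def IsMatching {n : ℕ} (M : Finset (Finset (Fin n) × Finset (Fin n))) : Prop :=
  ∀ e ∈ M, ∀ e' ∈ M, e.1 = e'.1 ∨ e.2 = e'.2 → e = e'

open Classical in
/-- The largest total overlap `∑ Card (C ∩ C')` of a matching between the blocks of `A`, `B`. -/
def overlap {n : ℕ} (A B : Partitions n) : ℕ :=
  ((A.parts ×ˢ B.parts).powerset.filter fun M => IsMatching M).sup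
    fun M => ∑ e ∈ M, (e.1 ∩ e.2).card

/-- The misclassification error distance between two partitions of `{1, …, n}`. -/
def loss {n : ℕ} (A B : Partitions n) : ℝ :=
  1 - (1 / (n : ℝ)) * (overlap A B : ℝ)

open Classical in
/-- The partition of `{1, …, n}` whose blocks are the classes of `i ∼ j ↔ x_i = x_j`. -/
def partitionOf {n J : ℕ} (x : Fin n → Fin J) : Partitions n :=
  Finpartition.ofSetoid (Setoid.ker x)

end Partitions

section Risks

variable {J : ℕ} {𝕐 : Type*} [MeasurableSpace 𝕐] {L : Measure 𝕐}

/-- An `n`-clusterer is a measurable map `𝕐ⁿ → 𝒫[n]`. -/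
abbrev Clusterer (𝕐 : Type*) [MeasurableSpace 𝕐] (n : ℕ) : Type _ :=
  {g : (Fin n → 𝕐) → Partitions n // Measurable g}

/-- An `n`-classifier is a measurable map `𝕐ⁿ → {1, …, J}ⁿ`. -/
abbrev Classifier (J : ℕ) (𝕐 : Type*) [MeasurableSpace 𝕐] (n : ℕ) : Type _ :=
  {h : (Fin n → 𝕐) → (Fin n → Fin J) // Measurable h}

/-- The risk of clustering `E_θ [ℓ (g (Y_{1:n}), Π_n)]`. -/
def Param.clustRisk (θ : Param J L) {n : ℕ} (g : Clusterer 𝕐 n) : ℝ :=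
  ∫ ω, loss (g.1 ω.2) (partitionOf ω.1) ∂(θ.law n)

/-- The risk of classification `E_θ [(1 / n) ∑ᵢ 1_{h_i (Y_{1:n}) ≠ X_i}]`. -/
def Param.classRisk (θ : Param J L) {n : ℕ} (h : Classifier J 𝕐 n) : ℝ :=
  ∫ ω, (1 / (n : ℝ)) * ∑ i : Fin n, (if h.1 ω.2 i ≠ ω.1 i then (1 : ℝ) else 0) ∂(θ.law n)

/-- The Bayes risk of clustering. -/
def Param.bayesClustRisk (θ : Param J L) (n : ℕ) : ℝ :=
  ⨅ g : Clusterer 𝕐 n, θ.clustRisk g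

/-- The Bayes risk of classification. -/
def Param.bayesClassRisk (θ : Param J L) (n : ℕ) : ℝ :=
  ⨅ h : Classifier J 𝕐 n, θ.classRisk h

end Risks

end HMMClust

end

/-!
A clusterer is compared with the classifier `h` that picks the posterior mode of each hidden state,
conditionally on the observations. Given the observations the path `X` of the hidden states is
still an inhomogeneous Markov chain, and the mixing assumption makes all its one-step kernels
satisfy a cross-ratio bound with the constant `r = 1 - ρ₀` (`isChain_posterior`). A partition `A`
is fixed as well, and its overlap with the partition of the labels is at most the number of hits
`#{i : bᵢ = σ Xᵢ}`, where `bᵢ` numbers the block of `i` and `σ` is a random injective assignment of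
blocks to labels (`exists_hits_ge_overlap`). So everything reduces to an upper bound on
`E max_σ hits` by `∑ᵢ max_s P(Xᵢ = s)`, the expected number of correct labels of `h`, up to an
error `T = r⁻¹ √(n log J! / 2)`; integrating over the observations (`risk_comparison`) then gives
the additive inequality. A bound for each fixed `σ` is trivial, but `A` may have more than `J`
blocks, so a union bound over the `σ` would lose more than `log J!`. Two bounds are combined in
`IsChain.sum_hits_le`. Let `M` be the sum of the `max_s P(Xᵢ = s)` over the times outside the best
`J` blocks.
* If `M` is large, the mean for each fixed `σ` falls short by `M`, and maximizing over `σ` costs at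
  most a standard deviation of the vector of all counts, of order `(J - 1) / √J` rather than
  `√(log J!)` (`IsChain.sum_hits_le_variance`).
* If `M` is small, the exponential of the best assignment is bounded by a permanent. A greedy
  matching process inserts the remaining blocks one at a time. Each insertion multiplies the
  permanent at most by a mixture of exponentials with predictable weights
  (`exp_assignment_le`, which rests on `sum_minor_le_permanent`), hence by the performance of an
  exponential weights forecaster that never sees the coordinate it predicts. Such a forecaster can
  beat `max_s P(Xᵢ = s)` only by a factor, since the conditional law of one coordinate given the
  others cannot vary much (`prediction_le`). The permanent over the fixed blocks has `J!` terms,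
  which produces the `log J!` (`IsChain.sum_hits_le_potential`).

The multiplicative inequality improves on this when the classifier errs with a proportion below
`β / 5` given the observations; otherwise it follows from the additive one. Then the variance
bound applies with small Gini indices, and compares the clusterer with one fixed assignment `σ₀`.
If `σ₀` hits at most `n (1 - β / 5)` times on average, nothing remains to be shown. Otherwise,
provided that no two labels are visited rarely under the posterior law, `σ₀` beats all other
assignments by a margin outside events of exponentially small probability, and the hits of `σ₀`
are correct labels of a classifier (`IsChain.sum_hits_le_of_visits`). Observations for which two
labels are visited rarely are controlled by an exponential penalty that is integrated under the
prior law of the chain (`one_le_sum_mul_rarityPenalty`, `sum_pathProb_mul_rarityPenalty`).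
-/

noncomputable section

set_option linter.unusedSectionVars false

namespace HMMClust

/-! ### Inhomogeneous chains with bounded cross-ratios -/

section Chain

variable {S : Type*} [Fintype S]

/-- `p a` is the law of a path of length `n` of an inhomogeneous Markov chain started from the
(unrecorded) state `a`, each of whose kernels `K` satisfies the cross-ratio bound
`r² K(a,b) K(a',b') ≤ K(a',b) K(a,b')`. -/
def IsChain (r : ℝ) : (n : ℕ) → (S → (Fin n → S) → ℝ) → Prop
  | 0, p => ∀ a x, p a x = 1
  | n + 1, p => ∃ (K : S → S → ℝ) (p' : S → (Fin n → S) → ℝ), IsChain r n p' ∧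
      (∀ a b, 0 ≤ K a b) ∧ (∀ a, ∑ b, K a b = 1) ∧
      (∀ a a' b b', r ^ 2 * (K a b * K a' b') ≤ K a' b * K a b') ∧
      ∀ a b x, p a (Fin.cons b x) = K a b * p' b x

theorem sum_fin_succ_fun {M : Type*} [AddCommMonoid M] {n : ℕ} (f : (Fin (n + 1) → S) → M) :
    ∑ x, f x = ∑ b, ∑ x : Fin n → S, f (Fin.cons b x) := by
  rw [← (Fin.consEquiv (fun _ : Fin (n + 1) => S)).sum_comp, Fintype.sum_prod_type]
  rfl

variable {r : ℝ}

theorem IsChain.nonneg : ∀ {n : ℕ} {p : S → (Fin n → S) → ℝ}, IsChain r n p →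
    ∀ a x, 0 ≤ p a x
  | 0, p, h, a, x => by rw [h a x]; exact zero_le_one
  | n + 1, p, h, a, x => by
    obtain ⟨K, p', h', hK, -, -, hp⟩ := h
    rw [← Fin.cons_self_tail x, hp]
    exact mul_nonneg (hK _ _) (h'.nonneg _ _)

theorem IsChain.sum_eq_one : ∀ {n : ℕ} {p : S → (Fin n → S) → ℝ}, IsChain r n p →
    ∀ a, ∑ x, p a x = 1
  | 0, p, h, a => by simp [show ∀ x, p a x = 1 from h a]
  | n + 1, p, h, a => by
    obtain ⟨K, p', h', -, hK1, -, hp⟩ := h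
    simp_rw [sum_fin_succ_fun, hp, ← Finset.mul_sum, h'.sum_eq_one, mul_one, hK1]

/-- Two numbers of `[0, R]` whose odds differ by a factor at most `r⁻²` are at distance at most
`(1 - r) / (1 + r) R`. -/
theorem sub_le_of_odds {r R u v : ℝ} (hr1 : r ≤ 1) (hu0 : 0 ≤ u) (huR : u ≤ R)
    (hv0 : 0 ≤ v) (hvR : v ≤ R) (h : r ^ 2 * (u * (R - v)) ≤ v * (R - u)) :
    (1 + r) * (u - v) ≤ (1 - r) * R := by
  have hR : 0 ≤ R := hu0.trans huR
  rcases hR.eq_or_lt with h0 | hRpos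
  · subst h0
    have : u = 0 := le_antisymm huR hu0
    have : v = 0 := le_antisymm hvR hv0
    simp [*]
  set α := u * (R - v) with hα
  set β := v * (R - u) with hβ
  have hα0 : 0 ≤ α := mul_nonneg hu0 (by linarith)
  have hβ0 : 0 ≤ β := mul_nonneg hv0 (by linarith)
  have hsa := Real.sq_sqrt hα0
  have hsb := Real.sq_sqrt hβ0
  set a := √α
  set b := √β
  have ha0 : 0 ≤ a := Real.sqrt_nonneg _
  have hb0 : 0 ≤ b := Real.sqrt_nonneg _
  have hab : r * a ≤ b := by
    refine le_of_sq_le_sq ?_ hb0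
    rw [mul_pow, hsa, hsb]
    exact h
  have hsum : (a + b) ^ 2 ≤ R ^ 2 := by
    -- `α β = (u v) ((R - u) (R - v))`, so `2 a b ≤ u v + (R - u) (R - v)`
    have h1 : 2 * (a * b) ≤ u * v + (R - u) * (R - v) := by
      apply le_of_sq_le_sq
      · have : (2 * (a * b)) ^ 2 = 4 * ((u * v) * ((R - u) * (R - v))) := by
          calc (2 * (a * b)) ^ 2 = 4 * (a ^ 2 * b ^ 2) := by ring
            _ = _ := by rw [hsa, hsb]; ring
        rw [this]
        nlinarith [sq_nonneg (u * v - (R - u) * (R - v))]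
      · exact add_nonneg (mul_nonneg hu0 hv0) (mul_nonneg (by linarith) (by linarith))
    nlinarith
  have h2 : R * ((1 + r) * (u - v)) ≤ R * ((1 - r) * R) := by
    have e : R * (u - v) = (a - b) * (a + b) := by
      calc R * (u - v) = α - β := by rw [hα, hβ]; ring
        _ = _ := by rw [← hsa, ← hsb]; ring
    have h3 : (1 + r) * (a - b) ≤ (1 - r) * (a + b) := by linarith
    calc R * ((1 + r) * (u - v)) = ((1 + r) * (a - b)) * (a + b) := by
          rw [mul_left_comm, e]; ring
      _ ≤ ((1 - r) * (a + b)) * (a + b) := by gcongr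
      _ = (1 - r) * (a + b) ^ 2 := by ring
      _ ≤ (1 - r) * R ^ 2 := by
          apply mul_le_mul_of_nonneg_left hsum; linarith
      _ = _ := by ring
  exact le_of_mul_le_mul_left h2 hRpos

/-- The contraction coefficient of a kernel with cross-ratios at least `r²`. -/
theorem kernel_contraction {K : S → S → ℝ} (hr0 : 0 ≤ r) (hr1 : r ≤ 1)
    (hK0 : ∀ a b, 0 ≤ K a b) (hK1 : ∀ a, ∑ b, K a b = 1)
    (hK : ∀ a a' b b', r ^ 2 * (K a b * K a' b') ≤ K a' b * K a b')
    {f : S → ℝ} {R : ℝ} (hf : ∀ s s', f s - f s' ≤ R) (a a' : S) :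
    ∑ b, K a b * f b - ∑ b, K a' b * f b ≤ (1 - r) / (1 + r) * R := by
  obtain ⟨s₀, -, hs₀⟩ := Finset.exists_min_image Finset.univ f ⟨a, Finset.mem_univ a⟩
  set g : S → ℝ := fun b => f b - f s₀ with hg
  have hg0 : ∀ b, 0 ≤ g b := fun b => sub_nonneg.2 (hs₀ b (Finset.mem_univ b))
  have hgR : ∀ b, g b ≤ R := fun b => hf b s₀
  have hmean : ∀ a, ∑ b, K a b * f b = ∑ b, K a b * g b + f s₀ := by
    intro a
    simp only [hg, mul_sub, Finset.sum_sub_distrib, ← Finset.sum_mul, hK1]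
    ring
  have hcomp : ∀ a, R - ∑ b, K a b * g b = ∑ b, K a b * (R - g b) := by
    intro a
    simp only [mul_sub, Finset.sum_sub_distrib, ← Finset.sum_mul, hK1, one_mul]
  have h0 : ∀ a, 0 ≤ ∑ b, K a b * g b :=
    fun a => Finset.sum_nonneg fun b _ => mul_nonneg (hK0 a b) (hg0 b)
  have h1 : ∀ a, ∑ b, K a b * g b ≤ R := fun a => by
    rw [← sub_nonneg, hcomp]
    exact Finset.sum_nonneg fun b _ => mul_nonneg (hK0 a b) (sub_nonneg.2 (hgR b))
  have hodds : r ^ 2 * ((∑ b, K a b * g b) * (R - ∑ b, K a' b * g b)) ≤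
      (∑ b, K a' b * g b) * (R - ∑ b, K a b * g b) := by
    rw [hcomp, hcomp, Finset.sum_mul_sum, Finset.sum_mul_sum, Finset.mul_sum]
    refine Finset.sum_le_sum fun b _ => ?_
    rw [Finset.mul_sum]
    refine Finset.sum_le_sum fun b' _ => ?_
    calc r ^ 2 * (K a b * g b * (K a' b' * (R - g b')))
        = r ^ 2 * (K a b * K a' b') * (g b * (R - g b')) := by ring
      _ ≤ K a' b * K a b' * (g b * (R - g b')) :=
        mul_le_mul_of_nonneg_right (hK a a' b b')
          (mul_nonneg (hg0 b) (sub_nonneg.2 (hgR b')))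
      _ = _ := by ring
  have := sub_le_of_odds hr1 (h0 a) (h1 a) (h0 a') (h1 a') hodds
  rw [hmean, hmean, add_sub_add_right_eq_sub, div_mul_eq_mul_div, le_div_iff₀ (by linarith)]
  linarith

/-- The vector-valued contraction, obtained by testing against the difference of the means. -/
theorem kernel_contraction_norm {E : Type*} [NormedAddCommGroup E] [InnerProductSpace ℝ E]
    {K : S → S → ℝ} (hr0 : 0 ≤ r) (hr1 : r ≤ 1)
    (hK0 : ∀ a b, 0 ≤ K a b) (hK1 : ∀ a, ∑ b, K a b = 1)
    (hK : ∀ a a' b b', r ^ 2 * (K a b * K a' b') ≤ K a' b * K a b')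
    {f : S → E} {R : ℝ} (hf : ∀ s s', ‖f s - f s'‖ ≤ R) (a a' : S) :
    ‖∑ b, K a b • f b - ∑ b, K a' b • f b‖ ≤ (1 - r) / (1 + r) * R := by
  set w := ∑ b, K a b • f b - ∑ b, K a' b • f b with hw
  have hR : 0 ≤ R := (norm_nonneg _).trans (hf a a')
  have h := kernel_contraction hr0 hr1 hK0 hK1 hK (f := fun b => inner ℝ w (f b))
    (R := ‖w‖ * R) (fun s s' => by
      rw [← inner_sub_right]
      exact (real_inner_le_norm _ _).trans (mul_le_mul_of_nonneg_left (hf s s') (norm_nonneg _)))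
      a a'
  have e : ∑ b, K a b * inner ℝ w (f b) - ∑ b, K a' b * inner ℝ w (f b) = ‖w‖ ^ 2 := by
    rw [← real_inner_self_eq_norm_sq]
    nth_rewrite 4 [hw]
    rw [inner_sub_right, inner_sum, inner_sum]
    simp [inner_smul_right]
  rw [e] at h
  rcases (norm_nonneg w).eq_or_lt with h0 | h0
  · rw [← h0]
    exact mul_nonneg (div_nonneg (by linarith) (by linarith)) hR
  · refine le_of_mul_le_mul_left ?_ h0
    linarith

/-- **Hoeffding's lemma** for finite weights. -/
theorem sum_exp_le_hoeffding {w : S → ℝ} (hw0 : ∀ s, 0 ≤ w s) (hw1 : ∑ s, w s = 1) {g : S → ℝ}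
    {R : ℝ} (hg : ∀ s s', g s - g s' ≤ R) :
    ∑ s, w s * Real.exp (g s) ≤ Real.exp (∑ s, w s * g s + R ^ 2 / 8) := by
  classical
  have hne : Nonempty S := by
    by_contra hne
    rw [not_nonempty_iff] at hne
    simp at hw1
  obtain ⟨s₀, -, hs₀⟩ := Finset.exists_min_image Finset.univ g
    ⟨Classical.arbitrary S, Finset.mem_univ _⟩
  let _ : MeasurableSpace S := ⊤
  let μ : Measure S := ∑ s, ENNReal.ofReal (w s) • Measure.dirac s
  have hint : ∀ F : S → ℝ, ∫ s, F s ∂μ = ∑ s, w s * F s := by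
    intro F
    rw [integral_finsetSum_measure]
    · refine Finset.sum_congr rfl fun s _ => ?_
      rw [integral_smul_measure, integral_dirac, ENNReal.toReal_ofReal (hw0 s), smul_eq_mul]
    · intro s _
      exact (integrable_dirac (by simp)).smul_measure ENNReal.ofReal_ne_top
  have hμ : IsProbabilityMeasure μ := by
    constructor
    simp only [μ, Measure.coe_finsetSum, Finset.sum_apply, Measure.smul_apply,
      measure_univ, smul_eq_mul, mul_one]
    rw [← ENNReal.ofReal_sum_of_nonneg (fun s _ => hw0 s), hw1, ENNReal.ofReal_one]
  have := ProbabilityTheory.hasSubgaussianMGF_of_mem_Icc (μ := μ) (X := g) (a := g s₀)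
    (b := g s₀ + R) (measurable_from_top.aemeasurable)
    (Filter.Eventually.of_forall fun s =>
      ⟨hs₀ s (Finset.mem_univ s), by linarith [hg s s₀]⟩)
  have h := this.mgf_le 1
  rw [ProbabilityTheory.mgf, hint] at h
  simp only [hint, one_mul, one_pow, mul_one] at h
  have e : ∀ s, Real.exp (g s - ∑ s, w s * g s) = Real.exp (g s) * Real.exp (-∑ s, w s * g s) :=
    fun s => by rw [← Real.exp_add, sub_eq_add_neg]
  simp only [e, ← mul_assoc, ← Finset.sum_mul] at h
  rw [Real.exp_neg, ← div_eq_mul_inv, div_le_iff₀ (Real.exp_pos _), ← Real.exp_add] at h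
  refine h.trans (le_of_eq ?_)
  congr 1
  push_cast
  simp only [add_sub_cancel_left, Real.norm_eq_abs]
  rw [div_pow, sq_abs]
  ring

/-- Exponential moments of an additive functional of a chain: `R` controls the dependence of
the mean on the starting point and `V / 4` is the variance proxy. -/
theorem IsChain.exp_le_aux (hr0 : 0 < r) (hr1 : r ≤ 1) :
    ∀ {n : ℕ} {p : S → (Fin n → S) → ℝ}, IsChain r n p → ∀ (θ : Fin n → S → ℝ) (c : Fin n → ℝ),
      (∀ i s s', θ i s - θ i s' ≤ c i) → (∀ i, 0 ≤ c i) →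
      ∃ R V : ℝ, 0 ≤ R ∧
        (∀ a a', ∑ x, p a x * ∑ i, θ i (x i) - ∑ x, p a' x * ∑ i, θ i (x i)
          ≤ (1 - r) / (1 + r) * R) ∧
        (∀ a, ∑ x, p a x * Real.exp (∑ i, θ i (x i)) ≤
          Real.exp (∑ x, p a x * ∑ i, θ i (x i) + V / 8)) ∧
        V * (1 - (1 - r) / (1 + r)) + (1 - r) / (1 + r) * R ^ 2 ≤
          (∑ i, c i ^ 2) / (1 - (1 - r) / (1 + r))
  | 0, p, h, θ, c, hθ, hc => ⟨0, 0, le_rfl, by simp, by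
      intro a; simp [show ∀ x, p a x = 1 from h a], by simp⟩
  | n + 1, p, h, θ, c, hθ, hc => by
    obtain ⟨K, p', h', hK0, hK1, hK, hp⟩ := h
    obtain ⟨R, V, hR, hmean, hexp, hV⟩ := IsChain.exp_le_aux hr0 hr1 h' (fun i => θ i.succ)
      (fun i => c i.succ) (fun i => hθ i.succ) (fun i => hc i.succ)
    set ρ := (1 - r) / (1 + r) with hρ
    have hρ0 : 0 ≤ ρ := div_nonneg (by linarith) (by linarith)
    set g : S → ℝ := fun b => θ 0 b + ∑ x, p' b x * ∑ i : Fin n, θ i.succ (x i) with hg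
    have hgosc : ∀ s s', g s - g s' ≤ c 0 + ρ * R := fun s s' => by
      have := hθ 0 s s'; have := hmean s s'; simp only [hg]; linarith
    have hm : ∀ a, ∑ x, p a x * ∑ i, θ i (x i) = ∑ b, K a b * g b := by
      intro a
      rw [sum_fin_succ_fun]
      refine Finset.sum_congr rfl fun b _ => ?_
      simp_rw [hp, Fin.sum_univ_succ, Fin.cons_zero, Fin.cons_succ, mul_add, mul_assoc,
        Finset.sum_add_distrib, ← Finset.mul_sum, ← Finset.sum_mul, h'.sum_eq_one, hg]
      ring
    refine ⟨c 0 + ρ * R, (c 0 + ρ * R) ^ 2 + V, add_nonneg (hc 0) (mul_nonneg hρ0 hR), ?_, ?_, ?_⟩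
    · intro a a'
      rw [hm, hm]
      exact kernel_contraction hr0.le hr1 hK0 hK1 hK hgosc a a'
    · intro a
      rw [hm, sum_fin_succ_fun]
      calc ∑ b, ∑ x : Fin n → S, p a (Fin.cons b x) *
            Real.exp (∑ i, θ i ((Fin.cons b x : Fin (n + 1) → S) i))
          = ∑ b, K a b * (Real.exp (θ 0 b) * ∑ x, p' b x *
              Real.exp (∑ i : Fin n, θ i.succ (x i))) := by
            refine Finset.sum_congr rfl fun b _ => ?_
            rw [Finset.mul_sum, Finset.mul_sum]
            refine Finset.sum_congr rfl fun x _ => ?_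
            rw [hp, Fin.sum_univ_succ, Real.exp_add]
            simp only [Fin.cons_zero, Fin.cons_succ]
            ring
        _ ≤ ∑ b, K a b * (Real.exp (g b) * Real.exp (V / 8)) := by
            refine Finset.sum_le_sum fun b _ => mul_le_mul_of_nonneg_left ?_ (hK0 a b)
            refine (mul_le_mul_of_nonneg_left (hexp b) (Real.exp_nonneg _)).trans (le_of_eq ?_)
            rw [← Real.exp_add, ← Real.exp_add, hg, add_assoc]
        _ = (∑ b, K a b * Real.exp (g b)) * Real.exp (V / 8) := by
            rw [Finset.sum_mul]
            exact Finset.sum_congr rfl fun b _ => by ring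
        _ ≤ Real.exp (∑ b, K a b * g b + (c 0 + ρ * R) ^ 2 / 8) * Real.exp (V / 8) := by
            gcongr
            exact sum_exp_le_hoeffding (hK0 a) (hK1 a) hgosc
        _ = _ := by rw [← Real.exp_add]; congr 1; ring
    · rw [Fin.sum_univ_succ, add_div]
      have hpos : 0 < 1 - ρ := by
        rw [hρ, sub_pos, div_lt_one (by linarith)]
        linarith
      have : (c 0 + ρ * R) ^ 2 ≤ c 0 ^ 2 / (1 - ρ) + ρ * R ^ 2 := by
        rw [← sub_nonneg]
        have : c 0 ^ 2 / (1 - ρ) + ρ * R ^ 2 - (c 0 + ρ * R) ^ 2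
          = ρ / (1 - ρ) * (c 0 - (1 - ρ) * R) ^ 2 := by
          field_simp
          ring
        rw [this]
        positivity
      nlinarith

/-- **McDiarmid-type bound**: an additive functional of a chain is subgaussian. -/
theorem IsChain.exp_le (hr0 : 0 < r) (hr1 : r ≤ 1) {n : ℕ} {p : S → (Fin n → S) → ℝ}
    (h : IsChain r n p) (θ : Fin n → S → ℝ) (c : Fin n → ℝ)
    (hθ : ∀ i s s', θ i s - θ i s' ≤ c i) (hc : ∀ i, 0 ≤ c i) (a : S) :
    ∑ x, p a x * Real.exp (∑ i, θ i (x i)) ≤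
      Real.exp (∑ x, p a x * ∑ i, θ i (x i) + ((1 + r) / (2 * r)) ^ 2 * (∑ i, c i ^ 2) / 8) := by
  obtain ⟨R, V, hR, -, hexp, hV⟩ := h.exp_le_aux hr0 hr1 θ c hθ hc
  refine (hexp a).trans (Real.exp_le_exp.2 ?_)
  have e : 1 - (1 - r) / (1 + r) = ((1 + r) / (2 * r))⁻¹ := by
    field_simp
    ring
  have hq : 0 < (1 + r) / (2 * r) := by positivity
  rw [e] at hV
  have h1 : 0 ≤ (1 - r) / (1 + r) * R ^ 2 :=
    mul_nonneg (div_nonneg (by linarith) (by linarith)) (sq_nonneg _)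
  have h2 : V * ((1 + r) / (2 * r))⁻¹ ≤ (∑ i, c i ^ 2) / ((1 + r) / (2 * r))⁻¹ := by linarith
  rw [div_inv_eq_mul, ← div_eq_mul_inv, div_le_iff₀ hq] at h2
  nlinarith

section Variance

variable {E : Type*} [NormedAddCommGroup E] [InnerProductSpace ℝ E]

theorem variance_eq_half_sum {w : S → ℝ} (hw1 : ∑ s, w s = 1) (g : S → E) :
    ∑ s, w s * ‖g s‖ ^ 2 - ‖∑ s, w s • g s‖ ^ 2 =
      (∑ s, ∑ s', w s * w s' * ‖g s - g s'‖ ^ 2) / 2 := by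
  have h1 : ‖∑ s, w s • g s‖ ^ 2 = ∑ s, ∑ s', w s * w s' * inner ℝ (g s) (g s') := by
    rw [← real_inner_self_eq_norm_sq, sum_inner]
    refine Finset.sum_congr rfl fun s _ => ?_
    rw [inner_sum]
    refine Finset.sum_congr rfl fun s' _ => ?_
    rw [real_inner_smul_left, real_inner_smul_right, mul_assoc]
  have h2 : ∑ s, ∑ s', w s * w s' * ‖g s - g s'‖ ^ 2 =
      ∑ s, ∑ s', w s * w s' * ‖g s‖ ^ 2 + ∑ s, ∑ s', w s * w s' * ‖g s'‖ ^ 2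
        - 2 * ∑ s, ∑ s', w s * w s' * inner ℝ (g s) (g s') := by
    simp only [norm_sub_sq_real, mul_add, mul_sub, Finset.sum_add_distrib,
      Finset.sum_sub_distrib, Finset.mul_sum]
    have : ∀ s s', w s * w s' * (2 * inner ℝ (g s) (g s')) =
      2 * (w s * w s' * inner ℝ (g s) (g s')) := fun _ _ => by ring
    simp only [this]
    ring
  have h3 : ∑ s, ∑ s', w s * w s' * ‖g s‖ ^ 2 = ∑ s, w s * ‖g s‖ ^ 2 := by
    refine Finset.sum_congr rfl fun s _ => ?_
    rw [← Finset.sum_mul, ← Finset.mul_sum, hw1, mul_one]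
  have h4 : ∑ s, ∑ s', w s * w s' * ‖g s'‖ ^ 2 = ∑ s, w s * ‖g s‖ ^ 2 := by
    rw [Finset.sum_comm, ← h3]
    exact Finset.sum_congr rfl fun s _ => Finset.sum_congr rfl fun s' _ => by ring
  rw [h2, h3, h4, h1]
  ring

/-- The diagonal terms of the double sum for the variance vanish, which leaves the Gini index. -/
theorem variance_le_gini [DecidableEq S] {w : S → ℝ} (hw0 : ∀ s, 0 ≤ w s) (hw1 : ∑ s, w s = 1)
    {g : S → E} {R : ℝ} (hg : ∀ s s', ‖g s - g s'‖ ≤ R) :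
    ∑ s, w s * ‖g s‖ ^ 2 - ‖∑ s, w s • g s‖ ^ 2 ≤ R ^ 2 / 2 * (1 - ∑ s, w s ^ 2) := by
  rw [variance_eq_half_sum hw1]
  have h1 : ∑ s, ∑ s', w s * w s' * ‖g s - g s'‖ ^ 2 ≤
      ∑ s, ∑ s', (w s * w s' - if s = s' then w s ^ 2 else 0) * R ^ 2 := by
    refine Finset.sum_le_sum fun s _ => Finset.sum_le_sum fun s' _ => ?_
    split_ifs with h
    · subst h; simp [sq]
    · rw [sub_zero]
      exact mul_le_mul_of_nonneg_left (pow_le_pow_left₀ (norm_nonneg _) (hg s s') 2)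
        (mul_nonneg (hw0 s) (hw0 s'))
  have h2 : ∑ s, ∑ s', (w s * w s' - if s = s' then w s ^ 2 else 0) * R ^ 2 =
      (1 - ∑ s, w s ^ 2) * R ^ 2 := by
    simp only [← Finset.sum_mul, Finset.sum_sub_distrib, Finset.sum_ite_eq, Finset.mem_univ,
      if_true, ← Finset.mul_sum, hw1, mul_one]
  linarith

/-- The `i`-th marginal of a weight on paths. -/
def marginal [DecidableEq S] {n : ℕ} (p : (Fin n → S) → ℝ) (i : Fin n) (s : S) : ℝ :=
  ∑ x, if x i = s then p x else 0

theorem sum_marginal_mul [DecidableEq S] {n : ℕ} (p : (Fin n → S) → ℝ) (i : Fin n) (f : S → ℝ) :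
    ∑ s, marginal p i s * f s = ∑ x, p x * f (x i) := by
  simp only [marginal, Finset.sum_mul, ite_mul, zero_mul]
  rw [Finset.sum_comm]
  simp

theorem sum_marginal [DecidableEq S] {n : ℕ} (p : (Fin n → S) → ℝ) (i : Fin n) :
    ∑ s, marginal p i s = ∑ x, p x := by
  simpa using sum_marginal_mul p i fun _ => 1

theorem marginal_nonneg [DecidableEq S] {n : ℕ} {p : (Fin n → S) → ℝ} (hp : ∀ x, 0 ≤ p x)
    (i : Fin n) (s : S) : 0 ≤ marginal p i s :=
  Finset.sum_nonneg fun x _ => by split_ifs <;> simp [hp]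

/-- The variance of a vector-valued additive functional of a chain is controlled by the Gini
indices `1 - ∑ₛ P(Xᵢ = s)²` of the marginals. -/
theorem IsChain.variance_le [DecidableEq S] (hr0 : 0 < r) (hr1 : r ≤ 1) {d : ℝ} (hd : 0 ≤ d) :
    ∀ {n : ℕ} {p : S → (Fin n → S) → ℝ}, IsChain r n p → ∀ (v : Fin n → S → E),
      (∀ i s s', ‖v i s - v i s'‖ ≤ d) →
      (∀ a a', ‖∑ x, p a x • ∑ i, v i (x i) - ∑ x, p a' x • ∑ i, v i (x i)‖ ≤
        (1 - r) / (1 + r) * ((1 + r) / (2 * r) * d)) ∧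
      ∀ a, ∑ x, p a x * ‖∑ i, v i (x i)‖ ^ 2 - ‖∑ x, p a x • ∑ i, v i (x i)‖ ^ 2 ≤
        ((1 + r) / (2 * r) * d) ^ 2 / 2 * ∑ i, (1 - ∑ s, marginal (p a) i s ^ 2)
  | 0, p, h, v, hv => by
    constructor
    · intro a a'
      have : 0 ≤ (1 - r) := by linarith
      simp only [Finset.univ_eq_empty, Finset.sum_empty, smul_zero, Finset.sum_const_zero,
        sub_self, norm_zero]
      positivity
    · simp
  | n + 1, p, h, v, hv => by
    obtain ⟨K, p', h', hK0, hK1, hK, hp⟩ := h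
    obtain ⟨hmean, hvar⟩ := IsChain.variance_le hr0 hr1 hd h' (fun i => v i.succ)
      (fun i => hv i.succ)
    set R := (1 + r) / (2 * r) * d with hR
    set g : S → E := fun b => v 0 b + ∑ x, p' b x • ∑ i : Fin n, v i.succ (x i) with hg
    have hosc : ∀ s s', ‖g s - g s'‖ ≤ R := fun s s' => by
      have e : g s - g s' = (v 0 s - v 0 s') + (∑ x, p' s x • ∑ i : Fin n, v i.succ (x i) -
        ∑ x, p' s' x • ∑ i : Fin n, v i.succ (x i)) := by simp only [hg]; abel
      rw [e]
      refine (norm_add_le _ _).trans ((add_le_add (hv 0 s s') (hmean s s')).trans (le_of_eq ?_))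
      rw [hR]
      field_simp
      ring
    have hm : ∀ a, ∑ x, p a x • ∑ i, v i (x i) = ∑ b, K a b • g b := by
      intro a
      rw [sum_fin_succ_fun]
      refine Finset.sum_congr rfl fun b _ => ?_
      simp_rw [hp, Fin.sum_univ_succ, Fin.cons_zero, Fin.cons_succ, smul_add, mul_smul,
        Finset.sum_add_distrib, ← Finset.smul_sum, ← Finset.sum_smul, h'.sum_eq_one, one_smul,
        hg, smul_add]
    refine ⟨fun a a' => ?_, fun a => ?_⟩
    · rw [hm, hm]
      exact kernel_contraction_norm hr0.le hr1 hK0 hK1 hK hosc a a'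
    · have hmarg0 : ∀ s, marginal (p a) 0 s = K a s := by
        intro s
        rw [marginal, sum_fin_succ_fun]
        simp only [Fin.cons_zero, hp]
        rw [Finset.sum_eq_single s (fun b _ hb => by simp [hb]) (by simp)]
        simp [← Finset.mul_sum, h'.sum_eq_one]
      have hmarg : ∀ (i : Fin n) s, marginal (p a) i.succ s = ∑ b, K a b * marginal (p' b) i s := by
        intro i s
        rw [marginal, sum_fin_succ_fun]
        simp only [Fin.cons_succ, hp, marginal, Finset.mul_sum, mul_ite, mul_zero]
      have h2 : ∑ x, p a x * ‖∑ i, v i (x i)‖ ^ 2 = ∑ b, K a b * ((∑ x, p' b x *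
          ‖∑ i : Fin n, v i.succ (x i)‖ ^ 2 - ‖∑ x, p' b x • ∑ i : Fin n, v i.succ (x i)‖ ^ 2)
            + ‖g b‖ ^ 2) := by
        rw [sum_fin_succ_fun]
        refine Finset.sum_congr rfl fun b _ => ?_
        have e : ∑ x, p' b x * ‖v 0 b + ∑ i : Fin n, v i.succ (x i)‖ ^ 2 =
            ‖v 0 b‖ ^ 2 + 2 * inner ℝ (v 0 b) (∑ x, p' b x • ∑ i : Fin n, v i.succ (x i)) +
              ∑ x, p' b x * ‖∑ i : Fin n, v i.succ (x i)‖ ^ 2 := by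
          simp only [norm_add_sq_real, mul_add, Finset.sum_add_distrib, ← Finset.sum_mul,
            h'.sum_eq_one, one_mul]
          rw [inner_sum, Finset.mul_sum]
          congr 2
          refine Finset.sum_congr rfl fun x _ => ?_
          rw [inner_smul_right]
          ring
        simp_rw [hp, Fin.sum_univ_succ, Fin.cons_zero, Fin.cons_succ, mul_assoc,
          ← Finset.mul_sum, e, hg, norm_add_sq_real]
        ring
      rw [hm, h2]
      simp only [mul_add, Finset.sum_add_distrib]
      have h3 := variance_le_gini (hK0 a) (hK1 a) hosc
      have h4 : ∑ b, K a b * (∑ x, p' b x *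
          ‖∑ i : Fin n, v i.succ (x i)‖ ^ 2 - ‖∑ x, p' b x • ∑ i : Fin n, v i.succ (x i)‖ ^ 2) ≤
          ∑ b, K a b * (R ^ 2 / 2 * ∑ i, (1 - ∑ s, marginal (p' b) i s ^ 2)) :=
        Finset.sum_le_sum fun b _ => mul_le_mul_of_nonneg_left (hvar b) (hK0 a b)
      have h5 : ∑ b, K a b * (R ^ 2 / 2 * ∑ i, (1 - ∑ s, marginal (p' b) i s ^ 2)) ≤
          R ^ 2 / 2 * ∑ i : Fin n, (1 - ∑ s, marginal (p a) i.succ s ^ 2) := by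
        have e : ∑ b, K a b * (R ^ 2 / 2 * ∑ i, (1 - ∑ s, marginal (p' b) i s ^ 2)) =
            R ^ 2 / 2 * ∑ i : Fin n, (1 - ∑ s, ∑ b, K a b * marginal (p' b) i s ^ 2) := by
          have e1 : ∀ i : Fin n, 1 - ∑ s, ∑ b, K a b * marginal (p' b) i s ^ 2 =
              ∑ b, K a b * (1 - ∑ s, marginal (p' b) i s ^ 2) := by
            intro i
            simp only [mul_sub, mul_one, Finset.sum_sub_distrib, hK1, Finset.mul_sum]
            rw [Finset.sum_comm]
          simp only [e1]
          rw [Finset.sum_comm, Finset.mul_sum]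
          refine Finset.sum_congr rfl fun b _ => ?_
          rw [← Finset.mul_sum]
          ring
        rw [e]
        refine mul_le_mul_of_nonneg_left ?_ (by positivity)
        refine Finset.sum_le_sum fun i _ => sub_le_sub_left (Finset.sum_le_sum fun s _ => ?_) _
        rw [hmarg]
        have := (even_two.convexOn_pow (𝕜 := ℝ)).map_sum_le (t := Finset.univ) (w := K a)
          (p := fun b => marginal (p' b) i s) (fun b _ => hK0 a b) (hK1 a) (by simp)
        simpa using this
      rw [Fin.sum_univ_succ, mul_add]
      simp only [hmarg0]
      linarith

end Variance

/-- The cross-ratio bound of the first kernel passes to the laws of whole paths. -/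
theorem IsChain.start_change (hr0 : 0 < r) (hr1 : r ≤ 1) : ∀ {n : ℕ} {p : S → (Fin n → S) → ℝ},
    IsChain r n p → ∀ a a' x x', r ^ 2 * (p a x * p a' x') ≤ p a' x * p a x'
  | 0, p, h, a, a', x, x' => by
    simp only [show ∀ a x, p a x = 1 from h, mul_one]
    exact pow_le_one₀ hr0.le hr1
  | n + 1, p, h, a, a', x, x' => by
    obtain ⟨K, p', h', hK0, -, hK, hp⟩ := h
    rw [← Fin.cons_self_tail x, ← Fin.cons_self_tail x', hp, hp, hp, hp]
    have := mul_le_mul_of_nonneg_right (hK a a' (x 0) (x' 0))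
      (mul_nonneg (h'.nonneg (x 0) (Fin.tail x)) (h'.nonneg (x' 0) (Fin.tail x')))
    linarith

/-- Exchanging the values of two paths at one time changes the product of their weights by a
factor at least `r⁴`. -/
theorem IsChain.flip (hr0 : 0 < r) (hr1 : r ≤ 1) : ∀ {n : ℕ} {p : S → (Fin n → S) → ℝ},
    IsChain r n p → ∀ (a a' : S) (i : Fin n) (x x' : Fin n → S) (s s' : S),
      r ^ 4 * (p a (Function.update x i s) * p a' (Function.update x' i s')) ≤
        p a (Function.update x i s') * p a' (Function.update x' i s)
  | 0, p, h, a, a', i, x, x', s, s' => i.elim0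
  | n + 1, p, h, a, a', i, x, x', s, s' => by
    obtain ⟨K, p', h', hK0, -, hK, hp⟩ := h
    rw [← Fin.cons_self_tail x, ← Fin.cons_self_tail x']
    cases i using Fin.cases with
    | zero =>
      simp only [Fin.update_cons_zero, hp]
      have h1 := hK a a' s s'
      have h2 := h'.start_change hr0 hr1 s s' (Fin.tail x) (Fin.tail x')
      have := mul_le_mul h1 h2 (mul_nonneg (by positivity)
        (mul_nonneg (h'.nonneg _ _) (h'.nonneg _ _))) (mul_nonneg (hK0 _ _) (hK0 _ _))
      linarith
    | succ i =>
      simp only [← Fin.cons_update, hp]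
      have := mul_le_mul_of_nonneg_left
        (IsChain.flip hr0 hr1 h' (x 0) (x' 0) i (Fin.tail x) (Fin.tail x') s s')
        (mul_nonneg (hK0 a (x 0)) (hK0 a' (x' 0)))
      linarith

/-- The weight `∏ᵢ q i (xᵢ₋₁, xᵢ)` of a path `x` started from `a`. -/
def pathWeight {S : Type*} {n : ℕ} (q : Fin n → S → S → ℝ) (a : S) (x : Fin n → S) : ℝ :=
  ∏ i, q i ((Fin.cons a x : Fin (n + 1) → S) i.castSucc) (x i)

theorem pathWeight_cons {S : Type*} {n : ℕ} (q : Fin (n + 1) → S → S → ℝ) (a b : S) (x : Fin n → S) :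
    pathWeight q a (Fin.cons b x) = q 0 a b * pathWeight (fun i => q i.succ) b x := by
  simp only [pathWeight, Fin.prod_univ_succ, Fin.castSucc_zero, Fin.cons_zero, Fin.cons_succ]
  congr 1

theorem pathWeight_sum_pos : ∀ {n : ℕ} {q : Fin n → S → S → ℝ}, (∀ i a b, 0 ≤ q i a b) →
    (∀ i a, ∃ b, 0 < q i a b) → ∀ a, 0 < ∑ x, pathWeight q a x
  | 0, q, _, _, a => by simp [pathWeight]
  | n + 1, q, hq0, hq, a => by
    obtain ⟨b, hb⟩ := hq 0 a
    rw [sum_fin_succ_fun]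
    have hpos := fun b => pathWeight_sum_pos (q := fun i => q i.succ) (fun i => hq0 i.succ)
      (fun i => hq i.succ) b
    simp only [pathWeight_cons, ← Finset.mul_sum]
    exact Finset.sum_pos' (fun b _ => mul_nonneg (hq0 _ _ _) (hpos b).le)
      ⟨b, Finset.mem_univ b, mul_pos hb (hpos b)⟩

/-- Normalizing path weights gives a chain; the kernels are Doob transforms of the `q i`. -/
theorem isChain_pathWeight (hr1 : r ≤ 1) : ∀ {n : ℕ} {q : Fin n → S → S → ℝ},
    (∀ i a b, 0 ≤ q i a b) → (∀ i a, ∃ b, 0 < q i a b) →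
    (∀ i a a' b b', r ^ 2 * (q i a b * q i a' b') ≤ q i a' b * q i a b') →
    IsChain r n fun a x => pathWeight q a x / ∑ z, pathWeight q a z
  | 0, q, _, _, _ => fun a x => by simp [pathWeight]
  | n + 1, q, hq0, hq, hqr => by
    have hmass := pathWeight_sum_pos hq0 hq
    set m : S → ℝ := fun b => ∑ z, pathWeight (fun i => q i.succ) b z with hm
    have hmass' : ∀ b, 0 < m b := pathWeight_sum_pos (q := fun i => q i.succ)
      (fun i => hq0 i.succ) (fun i => hq i.succ)
    refine ⟨fun a b => q 0 a b * m b / ∑ z, pathWeight q a z, _,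
      isChain_pathWeight hr1 (q := fun i => q i.succ) (fun i => hq0 i.succ) (fun i => hq i.succ)
        (fun i => hqr i.succ), fun a b => ?_, fun a => ?_, fun a a' b b' => ?_, fun a b x => ?_⟩
    · exact div_nonneg (mul_nonneg (hq0 _ _ _) (hmass' b).le) (hmass a).le
    · rw [← Finset.sum_div, div_eq_one_iff_eq (hmass a).ne', sum_fin_succ_fun]
      simp only [pathWeight_cons, ← Finset.mul_sum, hm]
    · have h1 := hmass a
      have h2 := hmass a'
      rw [div_mul_div_comm, div_mul_div_comm, ← mul_div_assoc, mul_comm (∑ z, pathWeight q a' z)]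
      refine div_le_div_of_nonneg_right ?_ (mul_pos h1 h2).le
      have := mul_le_mul_of_nonneg_right (hqr 0 a a' b b')
        (mul_nonneg (hmass' b).le (hmass' b').le)
      linarith
    · simp only [pathWeight_cons]
      have h1 := (hmass a).ne'
      have h2 := (hmass' b).ne'
      simp only [hm] at h2 ⊢
      field_simp

end Chain

/-! ### A permanent inequality and an online matching process -/

section Permanent

variable {ι : Type*} [Fintype ι] [DecidableEq ι]

/-- Two rows outside `P` are equally likely to be matched with `x`. -/
theorem sum_perm_swap (P : Finset ι) (F : ι → ι → ℝ) {u c : ι} (hu : u ∉ P) (hc : c ∉ P) (x : ι) :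
    ∑ π : Equiv.Perm ι, (if π u = x then ∏ a ∈ P, F a (π a) else 0) =
      ∑ π : Equiv.Perm ι, (if π c = x then ∏ a ∈ P, F a (π a) else 0) := by
  rw [← Equiv.sum_comp (Equiv.mulRight (Equiv.swap u c))]
  refine Finset.sum_congr rfl fun π _ => ?_
  have : ∏ a ∈ P, F a ((Equiv.mulRight (Equiv.swap u c)) π a) = ∏ a ∈ P, F a (π a) := by
    refine Finset.prod_congr rfl fun a ha => ?_
    rw [Equiv.coe_mulRight, Equiv.Perm.mul_apply, Equiv.swap_apply_of_ne_of_ne]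
    · rintro rfl; exact hu ha
    · rintro rfl; exact hc ha
  rw [this]
  simp

/-- For a matrix with entries at least `1`, selecting for each column `x` a row `u x`, the sum of
the permanents of the minors with row `u x` and column `x` removed is at most the permanent.
Writing the entries as `1 + F` and expanding, this is checked separately for the terms indexed by
each set `P` of rows: by symmetry the rows outside `P` are all equally likely to be matched
with `x`. -/
theorem sum_minor_le_permanent {E : ι → ι → ℝ} (hE : ∀ c x, 1 ≤ E c x) (u : ι → ι) :
    ∑ x, ∑ π : Equiv.Perm ι, (if π (u x) = x then ∏ c ∈ Finset.univ.erase (u x), E c (π c) else 0)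
      ≤ ∑ π : Equiv.Perm ι, ∏ c, E c (π c) := by
  set F : ι → ι → ℝ := fun c x => E c x - 1 with hF
  have hF0 : ∀ c x, 0 ≤ F c x := fun c x => sub_nonneg.2 (hE c x)
  have hEF : ∀ c x, E c x = 1 + F c x := fun c x => by simp [hF]
  have hr : ∑ π : Equiv.Perm ι, ∏ c, E c (π c) =
      ∑ P : Finset ι, ∑ π : Equiv.Perm ι, ∏ c ∈ P, F c (π c) := by
    rw [Finset.sum_comm]
    refine Finset.sum_congr rfl fun π _ => ?_
    simp only [hEF]
    rw [Finset.prod_one_add, Finset.powerset_univ]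
  have hl : ∑ x, ∑ π : Equiv.Perm ι,
      (if π (u x) = x then ∏ c ∈ Finset.univ.erase (u x), E c (π c) else 0) =
      ∑ P : Finset ι, ∑ x, if u x ∈ P then 0 else
        ∑ π : Equiv.Perm ι, if π (u x) = x then ∏ c ∈ P, F c (π c) else 0 := by
    rw [Finset.sum_comm (γ := Finset ι)]
    refine Finset.sum_congr rfl fun x _ => ?_
    have h1 : ∀ π : Equiv.Perm ι, ∏ c ∈ Finset.univ.erase (u x), E c (π c) =
        ∑ P : Finset ι, if u x ∈ P then 0 else ∏ c ∈ P, F c (π c) := by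
      intro π
      simp only [hEF]
      simp only [← ite_not (u x ∈ _)]
      rw [Finset.prod_one_add, ← Finset.sum_filter]
      refine Finset.sum_congr ?_ fun _ _ => rfl
      ext P
      simp only [Finset.mem_powerset, Finset.mem_filter, Finset.mem_univ, true_and,
        Finset.subset_erase, Finset.subset_univ]
    simp only [h1]
    have h2 : ∀ P : Finset ι, (if u x ∈ P then (0 : ℝ) else
        ∑ π : Equiv.Perm ι, if π (u x) = x then ∏ c ∈ P, F c (π c) else 0) =
        ∑ π : Equiv.Perm ι, if π (u x) = x then (if u x ∈ P then 0 else ∏ c ∈ P, F c (π c))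
          else 0 := by
      intro P
      by_cases h : u x ∈ P <;> simp [h]
    simp only [h2]
    rw [Finset.sum_comm]
    refine Finset.sum_congr rfl fun π _ => ?_
    by_cases h : π (u x) = x <;> simp [h]
  rw [hl, hr]
  refine Finset.sum_le_sum fun P _ => ?_
  set f : Equiv.Perm ι → ℝ := fun π => ∏ c ∈ P, F c (π c) with hf
  have hf0 : ∀ π, 0 ≤ f π := fun π => Finset.prod_nonneg fun c _ => hF0 _ _
  by_cases hP : Pᶜ = ∅
  · have : ∀ x, u x ∈ P := fun x => by
      rw [Finset.compl_eq_empty_iff] at hP; simp [hP]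
    simp only [this, if_true, Finset.sum_const_zero]
    exact Finset.sum_nonneg fun π _ => hf0 π
  have hcard : (0 : ℝ) < (Pᶜ.card : ℝ) := by
    exact_mod_cast Finset.card_pos.2 (Finset.nonempty_iff_ne_empty.2 hP)
  refine le_of_mul_le_mul_left ?_ hcard
  rw [Finset.mul_sum]
  have hx : ∀ x, (Pᶜ.card : ℝ) * (if u x ∈ P then (0 : ℝ) else
        ∑ π : Equiv.Perm ι, if π (u x) = x then f π else 0) ≤
        ∑ c ∈ Pᶜ, ∑ π : Equiv.Perm ι, if π c = x then f π else 0 := by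
    intro x
    by_cases h : u x ∈ P
    · simp only [h, if_true, mul_zero]
      exact Finset.sum_nonneg fun c _ => Finset.sum_nonneg fun π _ => by
        split_ifs
        exacts [hf0 π, le_rfl]
    · simp only [h, if_false]
      rw [← nsmul_eq_mul, ← Finset.sum_const]
      exact Finset.sum_le_sum fun c hc =>
        (sum_perm_swap P F h (Finset.mem_compl.1 hc) x).le
  refine (Finset.sum_le_sum fun x _ => hx x).trans (le_of_eq ?_)
  rw [Finset.sum_comm, ← nsmul_eq_mul, ← Finset.sum_const]
  refine Finset.sum_congr rfl fun c _ => ?_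
  rw [Finset.sum_comm]
  simp

end Permanent

section Exchange

variable {ι B : Type*}

/-- Exchanging two injections along the alternating path that starts at a value `σ x₀` which
`τ` misses. -/
theorem exists_exchange {σ τ : ι → B} (hσ : Function.Injective σ) (hτ : Function.Injective τ)
    (x₀ : ι) (hs : ∀ c, τ c ≠ σ x₀) :
    ∃ σ' τ' : ι → B, Function.Injective σ' ∧ Function.Injective τ' ∧
      (∀ x, (σ' x = σ x ∧ τ' x = τ x) ∨ (σ' x = τ x ∧ τ' x = σ x)) ∧
      (∀ x, σ' x ≠ σ x₀) ∧ τ' x₀ = σ x₀ ∧ ∀ x, τ' x = σ x₀ ∨ τ' x ∈ Set.range τ := by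
  classical
  let S : Set ι := {c | Relation.ReflTransGen (fun c c' => τ c = σ c') x₀ c}
  have h0 : x₀ ∈ S := Relation.ReflTransGen.refl
  have hclosed : ∀ c c', c ∈ S → τ c = σ c' → c' ∈ S := fun c c' hc h => hc.tail h
  have hmin : ∀ c ∈ S, c = x₀ ∨ ∃ c' ∈ S, τ c' = σ c := by
    intro c hc
    rcases Relation.ReflTransGen.cases_tail hc with h | ⟨c', h1, h2⟩
    · exact Or.inl h
    · exact Or.inr ⟨c', h1, h2⟩
  have hcross : ∀ c c', c ∈ S → c' ∉ S → σ c ≠ τ c' := by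
    intro c c' hc hc' h
    rcases hmin c hc with rfl | ⟨c'', h1, h2⟩
    · exact hs c' h.symm
    · exact hc' (hτ (h2.trans h) ▸ h1)
  refine ⟨fun c => if c ∈ S then τ c else σ c, fun c => if c ∈ S then σ c else τ c,
    ?_, ?_, ?_, ?_, ?_, ?_⟩
  · intro c c' h
    by_cases hc : c ∈ S <;> by_cases hc' : c' ∈ S <;> simp only [hc, hc', if_true, if_false] at h
    · exact hτ h
    · exact absurd (hclosed c c' hc h) hc'
    · exact absurd (hclosed c' c hc' h.symm) hc
    · exact hσ h
  · intro c c' h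
    by_cases hc : c ∈ S <;> by_cases hc' : c' ∈ S <;> simp only [hc, hc', if_true, if_false] at h
    · exact hσ h
    · exact absurd h (hcross c c' hc hc')
    · exact absurd h.symm (hcross c' c hc' hc)
    · exact hτ h
  · intro x
    by_cases hx : x ∈ S <;> simp [hx]
  · intro x
    by_cases hx : x ∈ S
    · simp only [hx, if_true]; exact hs x
    · simp only [hx, if_false]
      intro h
      exact hx (hσ h ▸ h0)
  · simp [h0]
  · intro x
    by_cases hx : x ∈ S
    · simp only [hx, if_true]
      rcases hmin x hx with rfl | ⟨c', -, h2⟩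
      · exact Or.inl rfl
      · exact Or.inr ⟨c', h2⟩
    · simp only [hx, if_false]
      exact Or.inr ⟨x, rfl⟩

variable [Fintype ι]

theorem exists_perm_of_range_subset {σ ρ : ι → B} (hσ : Function.Injective σ)
    (h : ∀ x, σ x ∈ Set.range ρ) (w : B → ι → ℝ) :
    ∃ π : Equiv.Perm ι, ∑ x, w (σ x) x = ∑ c, w (ρ c) (π c) := by
  choose g hg using h
  have hginj : Function.Injective g := fun x y hxy => hσ (by rw [← hg x, ← hg y, hxy])
  let e : Equiv.Perm ι := Equiv.ofBijective g (Finite.injective_iff_bijective.1 hginj)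
  refine ⟨e.symm, ?_⟩
  rw [← Equiv.sum_comp e (fun c => w (ρ c) (e.symm c))]
  refine Finset.sum_congr rfl fun x _ => ?_
  rw [e.symm_apply_apply]
  exact congrArg (w · x) (hg x).symm

variable [DecidableEq ι] [DecidableEq B]

/-- If `ρ` enumerates the values of an optimal assignment with values in `P`, then one of the
assignments with values in `P ∪ {s}` that are optimal takes its values in the range of `ρ` with at
most one value replaced by `s`. -/
theorem exists_update_optimal {w : B → ι → ℝ} {P : Set B} {ρ : ι → B}
    (hρ : Function.Injective ρ) (hρP : ∀ c, ρ c ∈ P) {s : B} (hs : s ∉ P) {π : Equiv.Perm ι}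
    (hopt : ∀ σ : ι → B, Function.Injective σ → (∀ x, σ x ∈ P) →
      ∑ x, w (σ x) x ≤ ∑ c, w (ρ c) (π c))
    {σ : ι → B} (hσ : Function.Injective σ) (hσP : ∀ x, σ x = s ∨ σ x ∈ P) :
    ∑ x, w (σ x) x ≤ ∑ c, w (ρ c) (π c) ∨
      ∃ (u : ι) (π' : Equiv.Perm ι), ∑ x, w (σ x) x ≤ ∑ c, w (Function.update ρ u s c) (π' c) := by
  by_cases hx : ∃ x₀, σ x₀ = s
  swap
  · push Not at hx
    exact Or.inl (hopt σ hσ fun x => (hσP x).resolve_left (hx x))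
  obtain ⟨x₀, rfl⟩ := hx
  right
  set τ : ι → B := fun x => ρ (π.symm x) with hτdef
  have hτ : Function.Injective τ := hρ.comp π.symm.injective
  have hτval : ∑ x, w (τ x) x = ∑ c, w (ρ c) (π c) := by
    rw [← Equiv.sum_comp π (fun x => w (τ x) x)]
    simp [hτdef]
  obtain ⟨σ', τ', hσ', hτ', hor, hσs, hτs, hτr⟩ := exists_exchange hσ hτ x₀
    (fun c h => hs (h ▸ hρP _))
  have h1 : ∑ x, w (σ' x) x ≤ ∑ c, w (ρ c) (π c) := by
    refine hopt σ' hσ' fun x => ?_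
    rcases hor x with ⟨h, -⟩ | ⟨h, -⟩
    · exact h ▸ (hσP x).resolve_left (h ▸ hσs x)
    · exact h ▸ hρP _
  have h2 : ∑ x, w (σ' x) x + ∑ x, w (τ' x) x = ∑ x, w (σ x) x + ∑ x, w (τ x) x := by
    rw [← Finset.sum_add_distrib, ← Finset.sum_add_distrib]
    refine Finset.sum_congr rfl fun x _ => ?_
    rcases hor x with ⟨h, h'⟩ | ⟨h, h'⟩ <;> rw [h, h']
    exact add_comm _ _
  have h3 : ∃ u, ∀ x, τ' x ≠ ρ u := by
    by_contra hcon
    push Not at hcon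
    choose g hg using hcon
    -- the `|ι| + 1` values `σ x₀` and `ρ u` cannot all be values of `τ'`
    have hinj : Function.Injective (fun o : Option ι => o.elim x₀ g) := by
      intro o o' h
      cases o <;> cases o' <;> simp only [Option.elim] at h
      · rfl
      · exact absurd (by rw [← hτs, h, hg] : σ x₀ = ρ _) (fun h => hs (h ▸ hρP _))
      · exact absurd (by rw [← hτs, ← h, hg] : σ x₀ = ρ _) (fun h => hs (h ▸ hρP _))
      · exact congrArg some (hρ (by rw [← hg, ← hg, h]))
    have := Fintype.card_le_of_injective _ hinj
    simp at this
  obtain ⟨u, hu⟩ := h3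
  have hrange : ∀ x, τ' x ∈ Set.range (Function.update ρ u (σ x₀)) := by
    intro x
    rcases hτr x with h | ⟨y, h⟩
    · exact ⟨u, by simp [h]⟩
    · refine ⟨π.symm y, ?_⟩
      rw [Function.update_of_ne, ← h]
      rintro rfl
      exact hu x h.symm
  obtain ⟨π', hπ'⟩ := exists_perm_of_range_subset hτ' hrange w
  exact ⟨u, π', by linarith⟩

end Exchange

section OnlineMatching

variable {ι B : Type*} [Fintype ι] [DecidableEq ι] [DecidableEq B]

/-- The permanent of the matrix `exp (t w(ρ c, x))` with rows `c` and columns `x`. -/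
def permanent (t : ℝ) (w : B → ι → ℝ) (ρ : ι → B) : ℝ :=
  ∑ π : Equiv.Perm ι, ∏ c, Real.exp (t * w (ρ c) (π c))

/-- The permanent of the minor of `exp (t w(ρ c, x))` without the row `u` and the column `x`. -/
def minorPermanent (t : ℝ) (w : B → ι → ℝ) (ρ : ι → B) (u x : ι) : ℝ :=
  ∑ π : Equiv.Perm ι, if π u = x then ∏ c ∈ Finset.univ.erase u, Real.exp (t * w (ρ c) (π c)) else 0

/-- The largest minor permanent with the column `x` removed. -/
def columnWeight (t : ℝ) (w : B → ι → ℝ) (ρ : ι → B) (x : ι) : ℝ :=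
  ⨆ u, minorPermanent t w ρ u x

/-- The column weights, normalized to sum to one. -/
def columnProb (t : ℝ) (w : B → ι → ℝ) (ρ : ι → B) (x : ι) : ℝ :=
  columnWeight t w ρ x / ∑ z, columnWeight t w ρ z

theorem minorPermanent_pos (t : ℝ) (w : B → ι → ℝ) (ρ : ι → B) (u x : ι) :
    0 < minorPermanent t w ρ u x := by
  refine Finset.sum_pos' (fun π _ => ?_) ⟨Equiv.swap u x, Finset.mem_univ _, ?_⟩
  · split_ifs
    · exact (Finset.prod_pos fun c _ => Real.exp_pos _).le
    · exact le_rfl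
  · rw [if_pos (Equiv.swap_apply_left u x)]
    exact Finset.prod_pos fun c _ => Real.exp_pos _

theorem minorPermanent_le_columnWeight (t : ℝ) (w : B → ι → ℝ) (ρ : ι → B) (u x : ι) :
    minorPermanent t w ρ u x ≤ columnWeight t w ρ x :=
  le_ciSup (f := fun u => minorPermanent t w ρ u x) (Set.finite_range _).bddAbove u

theorem columnWeight_pos (t : ℝ) (w : B → ι → ℝ) (ρ : ι → B) (x : ι) :
    0 < columnWeight t w ρ x :=
  (minorPermanent_pos t w ρ x x).trans_le (minorPermanent_le_columnWeight t w ρ x x)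

theorem columnProb_nonneg (t : ℝ) (w : B → ι → ℝ) (ρ : ι → B) (x : ι) :
    0 ≤ columnProb t w ρ x :=
  div_nonneg (columnWeight_pos _ _ _ _).le (Finset.sum_nonneg fun _ _ => (columnWeight_pos _ _ _ _).le)

theorem sum_columnProb [Nonempty ι] (t : ℝ) (w : B → ι → ℝ) (ρ : ι → B) :
    ∑ x, columnProb t w ρ x = 1 := by
  simp only [columnProb, ← Finset.sum_div]
  exact div_self (Finset.sum_pos (fun x _ => columnWeight_pos t w ρ x) Finset.univ_nonempty).ne'

theorem sum_columnWeight_le {t : ℝ} (ht : 0 ≤ t) {w : B → ι → ℝ} (hw : ∀ k x, 0 ≤ w k x)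
    (ρ : ι → B) : ∑ x, columnWeight t w ρ x ≤ permanent t w ρ := by
  rcases isEmpty_or_nonempty ι with h | h
  · simp [permanent]
  have : ∀ x, ∃ u, minorPermanent t w ρ u x = columnWeight t w ρ x := fun x =>
    exists_eq_ciSup_of_finite (f := fun u => minorPermanent t w ρ u x)
  choose u hu using this
  simp only [← hu]
  exact sum_minor_le_permanent (E := fun c x => Real.exp (t * w (ρ c) x))
    (fun c x => Real.one_le_exp (mul_nonneg ht (hw _ _))) u

/-- Replacing any row by `s` multiplies the permanent at most by a mixture that does not depend on
the replaced row: expand along that row and bound the minors by the column weights, whose sum is at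
most the permanent. -/
theorem permanent_update_le [Nonempty ι] {t : ℝ} (ht : 0 ≤ t) {w : B → ι → ℝ}
    (hw : ∀ k x, 0 ≤ w k x) (ρ : ι → B) (u : ι) (s : B) :
    permanent t w (Function.update ρ u s) ≤
      permanent t w ρ * ∑ x, columnProb t w ρ x * Real.exp (t * w s x) := by
  have hC : 0 < ∑ z, columnWeight t w ρ z :=
    Finset.sum_pos (fun x _ => columnWeight_pos t w ρ x) Finset.univ_nonempty
  calc permanent t w (Function.update ρ u s)
      = ∑ x, minorPermanent t w ρ u x * Real.exp (t * w s x) := by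
        simp only [permanent, minorPermanent, Finset.sum_mul, ite_mul, zero_mul]
        rw [Finset.sum_comm]
        refine Finset.sum_congr rfl fun π _ => ?_
        rw [Finset.sum_ite_eq, if_pos (Finset.mem_univ _),
          ← Finset.prod_erase_mul _ _ (Finset.mem_univ u), Function.update_self]
        congr 1
        refine Finset.prod_congr rfl fun c hc => ?_
        rw [Function.update_of_ne (Finset.ne_of_mem_erase hc)]
    _ ≤ ∑ x, columnWeight t w ρ x * Real.exp (t * w s x) :=
        Finset.sum_le_sum fun x _ => mul_le_mul_of_nonneg_right
          (minorPermanent_le_columnWeight t w ρ u x) (Real.exp_nonneg _)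
    _ = (∑ z, columnWeight t w ρ z) * ∑ x, columnProb t w ρ x * Real.exp (t * w s x) := by
        rw [Finset.mul_sum]
        refine Finset.sum_congr rfl fun x _ => ?_
        rw [columnProb]
        field_simp
    _ ≤ _ := mul_le_mul_of_nonneg_right (sum_columnWeight_le ht hw ρ)
        (Finset.sum_nonneg fun x _ => mul_nonneg (columnProb_nonneg _ _ _ _) (Real.exp_nonneg _))

theorem permanent_nonneg (t : ℝ) (w : B → ι → ℝ) (ρ : ι → B) : 0 ≤ permanent t w ρ :=
  Finset.sum_nonneg fun _ _ => Finset.prod_nonneg fun _ _ => Real.exp_nonneg _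

theorem one_le_sum_columnProb [Nonempty ι] {t : ℝ} (ht : 0 ≤ t) {w : B → ι → ℝ}
    (hw : ∀ k x, 0 ≤ w k x) (ρ : ι → B) (s : B) :
    1 ≤ ∑ x, columnProb t w ρ x * Real.exp (t * w s x) := by
  rw [← sum_columnProb t w ρ]
  exact Finset.sum_le_sum fun x _ => le_mul_of_one_le_right (columnProb_nonneg _ _ _ _)
    (Real.one_le_exp (mul_nonneg ht (hw _ _)))

/-- The largest total weight of a bijection between the rows `ρ` and the columns. -/
def matchValue (w : B → ι → ℝ) (ρ : ι → B) : ℝ :=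
  ⨆ π : Equiv.Perm ι, ∑ c, w (ρ c) (π c)

theorem le_matchValue (w : B → ι → ℝ) (ρ : ι → B) (π : Equiv.Perm ι) :
    ∑ c, w (ρ c) (π c) ≤ matchValue w ρ :=
  le_ciSup (f := fun π : Equiv.Perm ι => ∑ c, w (ρ c) (π c)) (Set.finite_range _).bddAbove π

theorem exists_matchValue (w : B → ι → ℝ) (ρ : ι → B) :
    ∃ π : Equiv.Perm ι, ∑ c, w (ρ c) (π c) = matchValue w ρ :=
  exists_eq_ciSup_of_finite (f := fun π : Equiv.Perm ι => ∑ c, w (ρ c) (π c))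

/-- The rows `ρ`, with at most one of them replaced by `s`. -/
def replaceRow (ρ : ι → B) (s : B) : Option ι → ι → B
  | none => ρ
  | some u => Function.update ρ u s

/-- A maximizer of `f`. -/
def bestOption (f : Option ι → ℝ) : Option ι := (Finite.exists_max f).choose

/-- The best way to replace at most one of the rows `ρ` by `s`. -/
def matchStep (w : B → ι → ℝ) (ρ : ι → B) (s : B) : ι → B :=
  replaceRow ρ s (bestOption fun o => matchValue w (replaceRow ρ s o))

theorem le_matchValue_matchStep (w : B → ι → ℝ) (ρ : ι → B) (s : B) (o : Option ι) :
    matchValue w (replaceRow ρ s o) ≤ matchValue w (matchStep w ρ s) :=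
  (Finite.exists_max fun o => matchValue w (replaceRow ρ s o)).choose_spec o

theorem permanent_matchStep_le [Nonempty ι] {t : ℝ} (ht : 0 ≤ t) {w : B → ι → ℝ}
    (hw : ∀ k x, 0 ≤ w k x) (ρ : ι → B) (s : B) :
    permanent t w (matchStep w ρ s) ≤
      permanent t w ρ * ∑ x, columnProb t w ρ x * Real.exp (t * w s x) := by
  rw [matchStep]
  cases (bestOption fun o => matchValue w (replaceRow ρ s o)) with
  | none => exact le_mul_of_one_le_right (permanent_nonneg _ _ _) (one_le_sum_columnProb ht hw ρ s)
  | some u => exact permanent_update_le ht hw ρ u s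

theorem columnProb_congr {t : ℝ} {w w' : B → ι → ℝ} {ρ : ι → B} (h : ∀ c, w (ρ c) = w' (ρ c)) :
    columnProb t w ρ = columnProb t w' ρ := by
  have h1 : minorPermanent t w ρ = minorPermanent t w' ρ := by
    funext u x
    simp only [minorPermanent, h]
  have h2 : columnWeight t w ρ = columnWeight t w' ρ := by
    funext x
    simp only [columnWeight, h1]
  funext x
  simp only [columnProb, h2]

theorem replaceRow_mem {P : Set B} {ρ : ι → B} (hρ : ∀ c, ρ c ∈ P) (s : B) (o : Option ι) (c : ι) :
    replaceRow ρ s o c = s ∨ replaceRow ρ s o c ∈ P := by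
  cases o with
  | none => exact Or.inr (hρ c)
  | some u =>
    by_cases h : c = u
    · subst h; simp [replaceRow]
    · simp [replaceRow, Function.update_of_ne h, hρ]

theorem replaceRow_injective {ρ : ι → B} (hρ : Function.Injective ρ) {s : B} (hs : ∀ c, ρ c ≠ s)
    (o : Option ι) : Function.Injective (replaceRow ρ s o) := by
  cases o with
  | none => exact hρ
  | some u =>
    intro c c' h
    simp only [replaceRow, Function.update_apply] at h
    split_ifs at h with h1 h2 h2
    · rw [h1, h2]
    · exact absurd h.symm (hs c')
    · exact absurd h (hs c)
    · exact hρ h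

theorem matchStep_congr {w w' : B → ι → ℝ} {ρ : ι → B} {s : B} (h : ∀ c, w (ρ c) = w' (ρ c))
    (hs : w s = w' s) : matchStep w ρ s = matchStep w' ρ s := by
  have : (fun o => matchValue w (replaceRow ρ s o)) =
      fun o => matchValue w' (replaceRow ρ s o) := by
    funext o
    simp only [matchValue]
    congr 1
    funext π
    refine Finset.sum_congr rfl fun c _ => ?_
    rcases replaceRow_mem (P := Set.range ρ) (fun c => ⟨c, rfl⟩) s o c with h1 | ⟨c', h1⟩
    · rw [h1, hs]
    · rw [← h1, h]
  simp only [matchStep, this]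

variable {N : ℕ}

/-- The rows selected by the greedy process after the values `< k` have been processed. -/
def matchState (w : Fin N → ι → ℝ) (ρ₀ : ι → Fin N) : ℕ → ι → Fin N
  | 0 => ρ₀
  | k + 1 => if h : k < N then (if ∃ c, ρ₀ c = ⟨k, h⟩ then matchState w ρ₀ k else
      matchStep w (matchState w ρ₀ k) ⟨k, h⟩) else matchState w ρ₀ k

/-- The values that are available to the greedy process after `k` steps. -/
def matchSeen (ρ₀ : ι → Fin N) (k : ℕ) : Set (Fin N) := {j | (∃ c, ρ₀ c = j) ∨ (j : ℕ) < k}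

theorem matchState_mem (w : Fin N → ι → ℝ) (ρ₀ : ι → Fin N) :
    ∀ k c, matchState w ρ₀ k c ∈ matchSeen ρ₀ k
  | 0, c => Or.inl ⟨c, rfl⟩
  | k + 1, c => by
    have ih := matchState_mem w ρ₀ k
    have hmono : matchSeen ρ₀ k ⊆ matchSeen ρ₀ (k + 1) := by
      rintro j (h | h)
      exacts [Or.inl h, Or.inr (h.trans (Nat.lt_succ_self k))]
    rw [matchState]
    split_ifs with h1 h2
    · exact hmono (ih c)
    · rcases replaceRow_mem ih ⟨k, h1⟩ (bestOption fun o =>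
        matchValue w (replaceRow (matchState w ρ₀ k) ⟨k, h1⟩ o)) c with h | h
      · rw [matchStep, h]
        exact Or.inr (Nat.lt_succ_self k)
      · exact hmono h
    · exact hmono (ih c)

/-- The rows selected by the process only depend on the weights of the values available so far. -/
theorem matchState_congr {w w' : Fin N → ι → ℝ} {ρ₀ : ι → Fin N} :
    ∀ k, (∀ j ∈ matchSeen ρ₀ k, w j = w' j) → matchState w ρ₀ k = matchState w' ρ₀ k
  | 0, _ => rfl
  | k + 1, h => by
    have ih := matchState_congr (w := w) (w' := w') (ρ₀ := ρ₀) k fun j hj => h j <| by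
      rcases hj with h | h
      exacts [Or.inl h, Or.inr (h.trans (Nat.lt_succ_self k))]
    rw [matchState, matchState, ← ih]
    split_ifs with h1 h2
    · rfl
    · refine matchStep_congr (fun c => h _ ?_) (h _ (Or.inr (Nat.lt_succ_self k)))
      rcases matchState_mem w ρ₀ k c with h | h
      exacts [Or.inl h, Or.inr (h.trans (Nat.lt_succ_self k))]
    · rfl

/-- The greedy process is optimal: its rows carry an assignment of the largest total weight among
all injective assignments with values that are available. -/
theorem matchState_optimal (w : Fin N → ι → ℝ) {ρ₀ : ι → Fin N} (hρ₀ : Function.Injective ρ₀) :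
    ∀ k, Function.Injective (matchState w ρ₀ k) ∧ ∀ σ : ι → Fin N, Function.Injective σ →
      (∀ x, σ x ∈ matchSeen ρ₀ k) → ∑ x, w (σ x) x ≤ matchValue w (matchState w ρ₀ k)
  | 0 => by
    refine ⟨hρ₀, fun σ hσ h => ?_⟩
    obtain ⟨π, hπ⟩ := exists_perm_of_range_subset (ρ := ρ₀) hσ
      (fun x => (h x).resolve_right (Nat.not_lt_zero _)) w
    rw [hπ]
    exact le_matchValue w ρ₀ π
  | k + 1 => by
    obtain ⟨ihi, iho⟩ := matchState_optimal w hρ₀ k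
    have hback : ∀ j : Fin N, j ∈ matchSeen ρ₀ (k + 1) → (j : ℕ) = k ∨ j ∈ matchSeen ρ₀ k := by
      rintro j (h | h)
      · exact Or.inr (Or.inl h)
      · rcases Nat.lt_succ_iff_lt_or_eq.1 h with h | h
        exacts [Or.inr (Or.inr h), Or.inl h]
    rw [matchState]
    split_ifs with h1 h2
    · refine ⟨ihi, fun σ hσ h => iho σ hσ fun x => ?_⟩
      rcases hback _ (h x) with h3 | h3
      · rw [show σ x = ⟨k, h1⟩ from Fin.ext h3]
        exact Or.inl h2
      · exact h3
    · have hk : (⟨k, h1⟩ : Fin N) ∉ matchSeen ρ₀ k := by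
        rintro (h | h)
        exacts [h2 h, lt_irrefl _ h]
      refine ⟨replaceRow_injective ihi (fun c h => hk (by rw [← h]; exact matchState_mem w ρ₀ k c)) _,
        fun σ hσ h => ?_⟩
      obtain ⟨π, hπ⟩ := exists_matchValue w (matchState w ρ₀ k)
      rcases exists_update_optimal (w := w) ihi (matchState_mem w ρ₀ k) hk (π := π)
        (fun σ h h' => hπ ▸ iho σ h h') hσ
        (fun x => (hback _ (h x)).imp (fun h => Fin.ext h) id) with h3 | ⟨u, π', h3⟩
      · exact (h3.trans (le_matchValue _ _ _)).trans (le_matchValue_matchStep w _ _ none)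
      · exact (h3.trans (le_matchValue _ _ _)).trans (le_matchValue_matchStep w _ _ (some u))
    · refine ⟨ihi, fun σ hσ h => iho σ hσ fun x => ?_⟩
      exact (hback _ (h x)).resolve_left fun h3 => h1 (h3 ▸ (σ x).isLt)

theorem permanent_matchState_le [Nonempty ι] {t : ℝ} (ht : 0 ≤ t) {w : Fin N → ι → ℝ}
    (hw : ∀ k x, 0 ≤ w k x) (ρ₀ : ι → Fin N) :
    ∀ k, permanent t w (matchState w ρ₀ k) ≤ permanent t w ρ₀ *
      ∏ s : Fin N, if (∃ c, ρ₀ c = s) ∨ k ≤ (s : ℕ) then 1 else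
        ∑ x, columnProb t w (matchState w ρ₀ s) x * Real.exp (t * w s x)
  | 0 => by simp [matchState]
  | k + 1 => by
    have ih := permanent_matchState_le ht hw ρ₀ k
    have hsucc : ∀ s : Fin N, (s : ℕ) ≠ k → (k + 1 ≤ (s : ℕ) ↔ k ≤ (s : ℕ)) := by
      intro s h; omega
    rw [matchState]
    split_ifs with h1 h2
    · refine ih.trans (le_of_eq ?_)
      congr 1
      refine Finset.prod_congr rfl fun s _ => ?_
      by_cases hs : (s : ℕ) = k
      · rw [show s = ⟨k, h1⟩ from Fin.ext hs]
        simp [h2]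
      · simp only [hsucc s hs]
    · refine (permanent_matchStep_le ht hw _ _).trans ?_
      have e : (∏ s : Fin N, if (∃ c, ρ₀ c = s) ∨ k + 1 ≤ (s : ℕ) then (1 : ℝ) else
          ∑ x, columnProb t w (matchState w ρ₀ s) x * Real.exp (t * w s x)) =
          (∏ s : Fin N, if (∃ c, ρ₀ c = s) ∨ k ≤ (s : ℕ) then 1 else
          ∑ x, columnProb t w (matchState w ρ₀ s) x * Real.exp (t * w s x)) *
          ∑ x, columnProb t w (matchState w ρ₀ k) x * Real.exp (t * w ⟨k, h1⟩ x) := by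
        rw [← Finset.mul_prod_erase _ _ (Finset.mem_univ (⟨k, h1⟩ : Fin N)),
          ← Finset.mul_prod_erase (a := (⟨k, h1⟩ : Fin N)) _ (fun s : Fin N =>
            if (∃ c, ρ₀ c = s) ∨ k ≤ (s : ℕ) then (1 : ℝ) else
            ∑ x, columnProb t w (matchState w ρ₀ s) x * Real.exp (t * w s x)) (Finset.mem_univ _)]
        rw [if_neg (by push Not; exact ⟨fun c hc => h2 ⟨c, hc⟩, Nat.lt_succ_self k⟩),
          if_pos (Or.inr le_rfl), one_mul, mul_comm]
        congr 1
        refine Finset.prod_congr rfl fun s hs => ?_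
        simp only [hsucc s fun h => Finset.ne_of_mem_erase hs (Fin.ext h)]
      rw [e, ← mul_assoc]
      exact mul_le_mul_of_nonneg_right ih
        (zero_le_one.trans (one_le_sum_columnProb ht hw _ _))
    · refine ih.trans (le_of_eq ?_)
      congr 1
      refine Finset.prod_congr rfl fun s _ => ?_
      simp only [hsucc s fun h => h1 (h ▸ s.isLt)]

/-- The exponential of the value of the best assignment is bounded by a permanent over any fixed
set of values and, for each other value `s`, a mixture of the exponentials `exp (t w(s, x))`, where
the mixing probabilities are predictable: they only involve the fixed values and those before
`s`. -/
theorem exp_assignment_le [Nonempty ι] {t : ℝ} (ht : 0 ≤ t) {w : Fin N → ι → ℝ}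
    (hw : ∀ k x, 0 ≤ w k x) {ρ₀ : ι → Fin N} (hρ₀ : Function.Injective ρ₀) {σ : ι → Fin N}
    (hσ : Function.Injective σ) :
    Real.exp (t * ∑ x, w (σ x) x) ≤ permanent t w ρ₀ *
      ∏ s : Fin N, if (∃ c, ρ₀ c = s) then 1 else
        ∑ x, columnProb t w (matchState w ρ₀ s) x * Real.exp (t * w s x) := by
  have h1 := (matchState_optimal w hρ₀ N).2 σ hσ fun x => Or.inr (σ x).isLt
  obtain ⟨π, hπ⟩ := exists_matchValue w (matchState w ρ₀ N)
  have h2 : Real.exp (t * ∑ c, w (matchState w ρ₀ N c) (π c)) ≤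
      permanent t w (matchState w ρ₀ N) := by
    rw [Finset.mul_sum, Real.exp_sum]
    exact Finset.single_le_sum (f := fun π : Equiv.Perm ι =>
        ∏ c, Real.exp (t * w (matchState w ρ₀ N c) (π c)))
      (fun π _ => Finset.prod_nonneg fun _ _ => Real.exp_nonneg _) (Finset.mem_univ π)
  refine (Real.exp_le_exp.2 (mul_le_mul_of_nonneg_left (hπ ▸ h1) ht)).trans
    (h2.trans ((permanent_matchState_le ht hw ρ₀ N).trans (le_of_eq ?_)))
  congr 1
  refine Finset.prod_congr rfl fun s _ => ?_
  simp [s.isLt.not_ge]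

end OnlineMatching

/-! ### Predicting one coordinate of a path from the others -/

section Prediction

variable {S : Type*} [Fintype S] [DecidableEq S] {n : ℕ}

/-- Resampling one coordinate. -/
theorem sum_update (i : Fin n) (F : (Fin n → S) → ℝ) :
    ∑ z : Fin n → S, ∑ y, F (Function.update z i y) = Fintype.card S * ∑ x, F x := by
  let e : ((Fin n → S) × S) ≃ ((Fin n → S) × S) :=
    { toFun := fun q => (Function.update q.1 i q.2, q.1 i)
      invFun := fun q => (Function.update q.1 i q.2, q.1 i)
      left_inv := fun q => by simp
      right_inv := fun q => by simp }
  have h1 : ∑ z : Fin n → S, ∑ y, F (Function.update z i y) =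
      ∑ q : (Fin n → S) × S, F (e q).1 :=
    (Fintype.sum_prod_type fun q : (Fin n → S) × S => F (e q).1).symm
  rw [h1, Equiv.sum_comp e (fun q => F q.1), Fintype.sum_prod_type]
  simp [Finset.mul_sum]

/-- The largest value of the `i`-th marginal. -/
def marginalMax (P : (Fin n → S) → ℝ) (i : Fin n) : ℝ := ⨆ s, marginal P i s

theorem marginal_le_max (P : (Fin n → S) → ℝ) (i : Fin n) (s : S) :
    marginal P i s ≤ marginalMax P i :=
  le_ciSup (f := fun s => marginal P i s) (Set.finite_range _).bddAbove s

theorem card_mul_marginal (P : (Fin n → S) → ℝ) (i : Fin n) (s : S) :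
    Fintype.card S * marginal P i s = ∑ z, P (Function.update z i s) := by
  rw [marginal, ← sum_update i]
  refine Finset.sum_congr rfl fun z _ => ?_
  simp

theorem one_le_card_mul_marginalMax {P : (Fin n → S) → ℝ} (hP1 : ∑ x, P x = 1) (i : Fin n) :
    1 ≤ Fintype.card S * marginalMax P i := by
  rw [← hP1, ← sum_marginal P i, ← nsmul_eq_mul, ← Finset.card_univ, ← Finset.sum_const]
  exact Finset.sum_le_sum fun s _ => marginal_le_max P i s

/-- For fixed `y`, the conditional probabilities of `y` at time `i` given the other coordinates
vary by at most `D = (r⁻⁴ - 1) (1 - 1 / J) max_s P(x_i = s)`. -/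
theorem conditional_variation {r : ℝ} (hr0 : 0 < r) (hr1 : r ≤ 1) {P : (Fin n → S) → ℝ}
    (hP0 : ∀ x, 0 ≤ P x) (hP1 : ∑ x, P x = 1)
    (hflip : ∀ (i : Fin n) (x x' : Fin n → S) (s s' : S),
      r ^ 4 * (P (Function.update x i s) * P (Function.update x' i s')) ≤
        P (Function.update x i s') * P (Function.update x' i s))
    (hS : 2 ≤ Fintype.card S) (i : Fin n) (y : S) (z z' : Fin n → S) :
    P (Function.update z i y) * (∑ s, P (Function.update z' i s)) -
      P (Function.update z' i y) * (∑ s, P (Function.update z i s)) ≤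
    (1 / r ^ 4 - 1) * ((1 - 1 / Fintype.card S) * marginalMax P i) *
      ((∑ s, P (Function.update z i s)) * ∑ s, P (Function.update z' i s)) := by
  set A : (Fin n → S) → ℝ := fun z => ∑ s, P (Function.update z i s) with hA
  set f : (Fin n → S) → ℝ := fun z => P (Function.update z i y) with hf
  set m := marginalMax P i with hm
  set κ : ℝ := (Fintype.card S : ℝ) with hκ
  have hκ2 : 2 ≤ κ := by rw [hκ]; exact_mod_cast hS
  change f z * A z' - f z' * A z ≤ (1 / r ^ 4 - 1) * ((1 - 1 / κ) * m) * (A z * A z')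
  have hA0 : ∀ z, 0 ≤ A z := fun z => Finset.sum_nonneg fun s _ => hP0 _
  have hf0 : ∀ z, 0 ≤ f z := fun z => hP0 _
  have hfA : ∀ z, f z ≤ A z := fun z =>
    Finset.single_le_sum (f := fun s => P (Function.update z i s)) (fun s _ => hP0 _)
      (Finset.mem_univ y)
  have hsumA : ∑ z, A z = κ := by
    simp only [hA]
    rw [sum_update, hP1, mul_one]
  have hsumf : ∑ z, f z ≤ κ * m := by
    simp only [hf]
    rw [← card_mul_marginal]
    exact mul_le_mul_of_nonneg_left (marginal_le_max P i y) (by linarith)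
  have hodds : ∀ z z', r ^ 4 * (f z * (A z' - f z')) ≤ (A z - f z) * f z' := by
    intro z z'
    have e : ∀ z, A z - f z = ∑ s ∈ Finset.univ.erase y, P (Function.update z i s) := fun z => by
      rw [hA, hf, sub_eq_iff_eq_add, add_comm]
      exact (Finset.add_sum_erase _ _ (Finset.mem_univ y)).symm
    rw [e, e, Finset.mul_sum, Finset.mul_sum, Finset.sum_mul]
    exact Finset.sum_le_sum fun s _ => hflip i z z' y s
  have hm1 : 1 ≤ κ * m := one_le_card_mul_marginalMax hP1 i
  have hm0 : 0 < m := by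
    by_contra hneg
    push Not at hneg
    nlinarith
  have hr4 : 0 < r ^ 4 := by positivity
  have hr41 : r ^ 4 ≤ 1 := pow_le_one₀ hr0.le hr1
  have hD0 : 0 ≤ (1 / r ^ 4 - 1) * ((1 - 1 / κ) * m) := by
    refine mul_nonneg ?_ (mul_nonneg ?_ hm0.le)
    · rw [sub_nonneg]; exact one_le_one_div hr4 hr41
    · rw [sub_nonneg, div_le_one (by linarith)]; linarith
  -- `z₀` minimizes the conditional probability
  have hne : (Finset.univ.filter fun z => 0 < A z).Nonempty := by
    by_contra hcon
    rw [Finset.not_nonempty_iff_eq_empty, Finset.filter_eq_empty_iff] at hcon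
    have : ∑ z, A z ≤ 0 := Finset.sum_nonpos fun z hz => not_lt.1 (hcon hz)
    linarith
  obtain ⟨z₀, hz₀, hmin⟩ := Finset.exists_min_image _ (fun z => f z / A z) hne
  rw [Finset.mem_filter] at hz₀
  set l := f z₀ / A z₀ with hl
  have hl0 : 0 ≤ l := div_nonneg (hf0 _) (hA0 _)
  have hlf : ∀ z, l * A z ≤ f z := by
    intro z
    rcases (hA0 z).eq_or_lt with h | h
    · rw [← h, mul_zero]; exact hf0 z
    · rw [← le_div_iff₀ h]
      exact hmin z (by simp [h])
  have hlm : l ≤ m := by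
    have : l * κ ≤ m * κ := by
      rw [← hsumA, Finset.mul_sum, hsumA]
      refine (Finset.sum_le_sum fun z _ => hlf z).trans ?_
      linarith
    exact le_of_mul_le_mul_right this (by linarith)
  have hll : l * (1 - l) ≤ (1 - 1 / κ) * m := by
    have hκi : 1 / κ ≤ 1 / 2 := one_div_le_one_div_of_le (by norm_num) hκ2
    have hκm : 1 / κ ≤ m := by rw [div_le_iff₀ (by linarith)]; linarith
    rcases le_total (1 / κ) l with h | h
    · nlinarith
    · nlinarith [mul_nonneg (sub_nonneg.2 h) (by linarith : (0:ℝ) ≤ 1 - l - 1 / κ)]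
  rcases (hA0 z).eq_or_lt with h | h
  · have : f z = 0 := le_antisymm (h ▸ hfA z) (hf0 z)
    rw [← h, this]; simp
  set α := f z / A z with hα
  have hfz : f z = α * A z := by rw [hα]; field_simp
  have hα1 : α ≤ 1 := by rw [hα, div_le_one h]; exact hfA z
  have hαl : r ^ 4 * (α * (1 - l)) ≤ (1 - α) * l := by
    have h1 := hodds z z₀
    have h2 : f z₀ = l * A z₀ := by rw [hl]; field_simp [hz₀.2.ne']
    rw [hfz, h2] at h1
    have h3 : 0 < A z * A z₀ := mul_pos h hz₀.2
    refine le_of_mul_le_mul_right ?_ h3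
    linarith
  have hgap : α - l ≤ (1 / r ^ 4 - 1) * ((1 - 1 / κ) * m) := by
    rcases le_total α l with h1 | h1
    · linarith
    have h2 : α * (1 - l) ≤ 1 / r ^ 4 * ((1 - α) * l) := by
      rw [one_div, inv_mul_eq_div, le_div_iff₀ hr4]; linarith
    have h3 : 0 ≤ 1 / r ^ 4 - 1 := by rw [sub_nonneg]; exact one_le_one_div hr4 hr41
    calc α - l = α * (1 - l) - (1 - α) * l := by ring
      _ ≤ (1 / r ^ 4 - 1) * ((1 - α) * l) := by linarith
      _ ≤ (1 / r ^ 4 - 1) * (l * (1 - l)) :=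
        mul_le_mul_of_nonneg_left (by nlinarith) h3
      _ ≤ _ := mul_le_mul_of_nonneg_left hll h3
  calc f z * A z' - f z' * A z ≤ α * A z * A z' - l * A z' * A z := by
        rw [← hfz]
        exact sub_le_sub_left (mul_le_mul_of_nonneg_right (hlf z') (hA0 z)) _
    _ = (α - l) * (A z * A z') := by ring
    _ ≤ _ := mul_le_mul_of_nonneg_right hgap (mul_nonneg (hA0 _) (hA0 _))

/-- A randomized prediction `g` of the coordinate `i` that only uses the other coordinates is
correct with probability at most `(1 + C) max_s P(x_i = s)`, where `C = (1 - 1 / J)² (r⁻⁴ - 1)`. -/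
theorem prediction_le {r : ℝ} (hr0 : 0 < r) (hr1 : r ≤ 1) {P : (Fin n → S) → ℝ}
    (hP0 : ∀ x, 0 ≤ P x) (hP1 : ∑ x, P x = 1)
    (hflip : ∀ (i : Fin n) (x x' : Fin n → S) (s s' : S),
      r ^ 4 * (P (Function.update x i s) * P (Function.update x' i s')) ≤
        P (Function.update x i s') * P (Function.update x' i s))
    (hS : 2 ≤ Fintype.card S) (i : Fin n) {g : (Fin n → S) → S → ℝ}
    (hg0 : ∀ x y, 0 ≤ g x y) (hg1 : ∀ x, ∑ y, g x y = 1)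
    (hgi : ∀ x y, g (Function.update x i y) = g x) :
    ∑ x, P x * g x (x i) ≤
      marginalMax P i * (1 + (1 - 1 / Fintype.card S) ^ 2 * (1 / r ^ 4 - 1)) := by
  set A : (Fin n → S) → ℝ := fun z => ∑ s, P (Function.update z i s) with hA
  set m := marginalMax P i with hm
  set κ : ℝ := (Fintype.card S : ℝ) with hκ
  have hκ2 : 2 ≤ κ := by rw [hκ]; exact_mod_cast hS
  have hκ0 : 0 < κ := by linarith
  set D := (1 / r ^ 4 - 1) * ((1 - 1 / κ) * m) with hD
  have hm1 : 1 ≤ κ * m := one_le_card_mul_marginalMax hP1 i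
  have hm0 : 0 < m := by
    by_contra hneg
    push Not at hneg
    nlinarith
  have hD0 : 0 ≤ D := by
    refine mul_nonneg ?_ (mul_nonneg ?_ hm0.le)
    · rw [sub_nonneg]; exact one_le_one_div (by positivity) (pow_le_one₀ hr0.le hr1)
    · rw [sub_nonneg, div_le_one (by linarith)]; linarith
  have hA0 : ∀ z, 0 ≤ A z := fun z => Finset.sum_nonneg fun s _ => hP0 _
  have hg1' : ∀ z y, g z y ≤ 1 := fun z y => by
    rw [← hg1 z]
    exact Finset.single_le_sum (f := g z) (fun s _ => hg0 z s) (Finset.mem_univ y)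
  have hsumA : ∑ z, A z = κ := by
    simp only [hA]
    rw [sum_update, hP1, mul_one]
  set q : S → ℝ := fun y => (∑ z, g z y * A z) / κ with hq
  have hq0 : ∀ y, 0 ≤ q y := fun y =>
    div_nonneg (Finset.sum_nonneg fun z _ => mul_nonneg (hg0 _ _) (hA0 _)) hκ0.le
  have hq1 : ∑ y, q y = 1 := by
    simp only [hq]
    rw [← Finset.sum_div, Finset.sum_comm]
    simp only [← Finset.sum_mul, hg1, one_mul]
    rw [hsumA, div_self hκ0.ne']
  have hl : κ * ∑ x, P x * g x (x i) = ∑ y, ∑ z, g z y * P (Function.update z i y) := by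
    rw [hκ, ← sum_update i (fun x => P x * g x (x i)), Finset.sum_comm]
    refine Finset.sum_congr rfl fun y _ => Finset.sum_congr rfl fun z _ => ?_
    rw [hgi, Function.update_self, mul_comm]
  have hy : ∀ y, (∑ z, g z y * P (Function.update z i y)) ≤ κ * (m * q y + D * (q y * (1 - q y))) := by
    intro y
    set f : (Fin n → S) → ℝ := fun z => P (Function.update z i y) with hf
    have hsumf : ∑ z, f z ≤ κ * m := by
      simp only [hf]
      rw [← card_mul_marginal]
      exact mul_le_mul_of_nonneg_left (marginal_le_max P i y) (by linarith)
    have hgA : ∑ z, g z y * A z = κ * q y := by simp only [hq]; field_simp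
    have hgA' : ∑ z, (1 - g z y) * A z = κ * (1 - q y) := by
      simp only [sub_mul, one_mul, Finset.sum_sub_distrib, hgA, hsumA]; ring
    -- the bracket is antisymmetric in `(z, z')`, so that `g z` can be replaced by
    -- `g z * (1 - g z')`
    have hanti : ∑ z, ∑ z', g z y * g z' y * (f z * A z' - f z' * A z) = 0 := by
      have : ∑ z, ∑ z', g z y * g z' y * (f z * A z' - f z' * A z) =
          -∑ z, ∑ z', g z y * g z' y * (f z * A z' - f z' * A z) := by
        conv_lhs => rw [Finset.sum_comm]
        rw [← Finset.sum_neg_distrib]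
        refine Finset.sum_congr rfl fun z _ => ?_
        rw [← Finset.sum_neg_distrib]
        exact Finset.sum_congr rfl fun z' _ => by ring
      linarith
    have h1 : ∑ z, ∑ z', g z y * (1 - g z' y) * (f z * A z' - f z' * A z) =
        κ * ∑ z, g z y * f z - (κ * q y) * ∑ z, f z := by
      have : ∀ z z', g z y * (1 - g z' y) * (f z * A z' - f z' * A z) =
          (g z y * f z) * A z' - (g z y * A z) * f z' -
            g z y * g z' y * (f z * A z' - f z' * A z) := fun z z' => by ring
      simp only [this, Finset.sum_sub_distrib, hanti, ← Finset.mul_sum, ← Finset.sum_mul, hsumA,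
        hgA]
      ring
    have h2 : ∑ z, ∑ z', g z y * (1 - g z' y) * (f z * A z' - f z' * A z) ≤
        D * ((κ * q y) * (κ * (1 - q y))) := by
      rw [← hgA, ← hgA', Finset.sum_mul_sum, Finset.mul_sum]
      refine Finset.sum_le_sum fun z _ => ?_
      rw [Finset.mul_sum]
      refine Finset.sum_le_sum fun z' _ => ?_
      refine (mul_le_mul_of_nonneg_left
        (conditional_variation hr0 hr1 hP0 hP1 hflip hS i y z z')
        (mul_nonneg (hg0 z y) (sub_nonneg.2 (hg1' z' y)))).trans (le_of_eq ?_)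
      simp only [hD, hA]
      ring
    have h3 : κ * ∑ z, g z y * f z ≤ κ * (κ * (m * q y + D * (q y * (1 - q y)))) := by
      have := mul_le_mul_of_nonneg_left hsumf (mul_nonneg hκ0.le (hq0 y))
      nlinarith
    exact le_of_mul_le_mul_left h3 hκ0
  have hgini : ∑ y, q y * (1 - q y) ≤ 1 - 1 / κ := by
    have : (∑ y, q y) ^ 2 ≤ κ * ∑ y, q y ^ 2 := by
      rw [hκ, ← Finset.card_univ]
      exact sq_sum_le_card_mul_sum_sq
    rw [hq1, one_pow] at this
    have h2 : ∑ y, q y * (1 - q y) = 1 - ∑ y, q y ^ 2 := by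
      simp only [mul_sub, mul_one, Finset.sum_sub_distrib, hq1, sq]
    rw [h2, sub_le_sub_iff_left, div_le_iff₀ hκ0]
    linarith
  refine le_of_mul_le_mul_left ?_ hκ0
  rw [hl]
  refine (Finset.sum_le_sum fun y _ => hy y).trans ?_
  rw [← Finset.mul_sum, Finset.sum_add_distrib, ← Finset.mul_sum, ← Finset.mul_sum, hq1]
  refine mul_le_mul_of_nonneg_left ?_ hκ0.le
  have := mul_le_mul_of_nonneg_left hgini hD0
  refine (add_le_add_right this _).trans (le_of_eq ?_)
  rw [hD]
  ring

end Prediction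

/-! ### A numerical inequality for the combination of the two bounds -/

theorem log_factorial_succ (J : ℕ) :
    Real.log ((J + 1)! : ℝ) = Real.log (J + 1) + Real.log (J ! : ℝ) := by
  rw [Nat.factorial_succ]
  push_cast
  rw [Real.log_mul (by positivity) (by positivity)]

theorem log_factorial_lower :
    (0.69 : ℝ) ≤ Real.log (2 ! : ℝ) ∧ (1.77 : ℝ) ≤ Real.log (3 ! : ℝ) ∧
      (3.14 : ℝ) ≤ Real.log (4 ! : ℝ) ∧ (4.7 : ℝ) ≤ Real.log (5 ! : ℝ) ∧
      (6.45 : ℝ) ≤ Real.log (6 ! : ℝ) ∧ (8.3 : ℝ) ≤ Real.log (7 ! : ℝ) := by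
  have h2 := Real.log_two_gt_d9
  have h98 := Real.one_sub_inv_le_log_of_pos (show (0 : ℝ) < 9 / 8 by norm_num)
  have h54 := Real.one_sub_inv_le_log_of_pos (show (0 : ℝ) < 5 / 4 by norm_num)
  have h78 := Real.one_sub_inv_le_log_of_pos (show (0 : ℝ) < 7 / 8 by norm_num)
  have e9 : Real.log (9 / 8) = 2 * Real.log 3 - 3 * Real.log 2 := by
    rw [Real.log_div (by norm_num) (by norm_num), show (9 : ℝ) = 3 ^ 2 by norm_num,
      show (8 : ℝ) = 2 ^ 3 by norm_num, Real.log_pow, Real.log_pow]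
    norm_num
  have e5 : Real.log (5 / 4) = Real.log 5 - 2 * Real.log 2 := by
    rw [Real.log_div (by norm_num) (by norm_num), show (4 : ℝ) = 2 ^ 2 by norm_num, Real.log_pow]
    norm_num
  have e7 : Real.log (7 / 8) = Real.log 7 - 3 * Real.log 2 := by
    rw [Real.log_div (by norm_num) (by norm_num), show (8 : ℝ) = 2 ^ 3 by norm_num, Real.log_pow]
    norm_num
  have e4 : Real.log 4 = 2 * Real.log 2 := by
    rw [show (4 : ℝ) = 2 ^ 2 by norm_num, Real.log_pow]; norm_num
  have e6 : Real.log 6 = Real.log 2 + Real.log 3 := by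
    rw [show (6 : ℝ) = 2 * 3 by norm_num, Real.log_mul (by norm_num) (by norm_num)]
  have f2 : Real.log (2 ! : ℝ) = Real.log 2 := by norm_num [Nat.factorial]
  have f3 : Real.log (3 ! : ℝ) = Real.log 3 + Real.log (2 ! : ℝ) := by
    rw [log_factorial_succ]; norm_num
  have f4 : Real.log (4 ! : ℝ) = Real.log 4 + Real.log (3 ! : ℝ) := by
    rw [log_factorial_succ]; norm_num
  have f5 : Real.log (5 ! : ℝ) = Real.log 5 + Real.log (4 ! : ℝ) := by
    rw [log_factorial_succ]; norm_num
  have f6 : Real.log (6 ! : ℝ) = Real.log 6 + Real.log (5 ! : ℝ) := by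
    rw [log_factorial_succ]; norm_num
  have f7 : Real.log (7 ! : ℝ) = Real.log 7 + Real.log (6 ! : ℝ) := by
    rw [log_factorial_succ]; norm_num
  rw [f7, f6, f5, f4, f3, f2]
  norm_num at h98 h54 h78
  refine ⟨?_, ?_, ?_, ?_, ?_, ?_⟩ <;> linarith

/-- A linear lower bound, with the constant `1.6` that `exists_ratio_bound` can afford. -/
theorem log_factorial_lower_of_seven_le {J : ℕ} (hJ : 7 ≤ J) :
    (1.6 : ℝ) * ((J : ℝ) - 1) ^ 2 / J ≤ Real.log (J ! : ℝ) := by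
  induction J, hJ using Nat.le_induction with
  | base =>
    have := log_factorial_lower.2.2.2.2.2
    norm_num at this ⊢
    linarith
  | succ J hJ ih =>
    have hJ' : (7 : ℝ) ≤ J := by exact_mod_cast hJ
    rw [log_factorial_succ]
    have h8 : (2 : ℝ) ≤ Real.log (J + 1) := by
      have h1 : Real.log 8 ≤ Real.log (J + 1) := Real.log_le_log (by norm_num) (by linarith)
      have h2 := Real.log_two_gt_d9
      rw [show (8 : ℝ) = 2 ^ 3 by norm_num, Real.log_pow] at h1
      norm_num at h1
      linarith
    have : (1.6 : ℝ) * (((J + 1 : ℕ) : ℝ) - 1) ^ 2 / ((J + 1 : ℕ) : ℝ) ≤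
        1.6 * ((J : ℝ) - 1) ^ 2 / J + 2 := by
      push_cast
      rw [div_le_iff₀ (by positivity), add_mul, div_mul_eq_mul_div, ← sub_le_iff_le_add,
        le_div_iff₀ (by positivity)]
      nlinarith
    linarith

/-- Bounding `(1 + r) (1 + r²)` by `4` and the convex function `r⁴` from below by its tangent at `c`
leaves an inequality that is linear in `r`, with `hc0` and `hc1` its cases `r = 0` and `r = 1`. -/
theorem quartic_of_tangent {A B c r : ℝ} (hB : 0 ≤ B) (hr0 : 0 ≤ r) (hr1 : r ≤ 1)
    (hc0 : 4 * B * (A - 2) ≤ -3 * c ^ 4) (hc1 : 4 * B * (2 * A - 2) ≤ 4 * c ^ 3 - 3 * c ^ 4) :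
    B * (1 + r) * (1 + r ^ 2) * (A * (1 + r) - 2) ≤ r ^ 4 := by
  have htan : 4 * c ^ 3 * r - 3 * c ^ 4 ≤ r ^ 4 := by
    have : r ^ 4 - (4 * c ^ 3 * r - 3 * c ^ 4) = (r - c) ^ 2 * ((r + c) ^ 2 + 2 * c ^ 2) := by ring
    have h2 : 0 ≤ (r - c) ^ 2 * ((r + c) ^ 2 + 2 * c ^ 2) := by positivity
    linarith
  have hlin : 4 * B * (A * (1 + r) - 2) ≤ 4 * c ^ 3 * r - 3 * c ^ 4 := by
    have h1 := mul_le_mul_of_nonneg_left hc0 (sub_nonneg.2 hr1)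
    have h2 := mul_le_mul_of_nonneg_left hc1 hr0
    nlinarith
  rcases le_total (A * (1 + r) - 2) 0 with h | h
  · have : B * (1 + r) * (1 + r ^ 2) * (A * (1 + r) - 2) ≤ 0 :=
      mul_nonpos_of_nonneg_of_nonpos (by positivity) h
    exact this.trans (by positivity)
  · have h4 : (1 + r) * (1 + r ^ 2) ≤ 4 := by nlinarith
    calc B * (1 + r) * (1 + r ^ 2) * (A * (1 + r) - 2)
        = ((1 + r) * (1 + r ^ 2)) * (B * (A * (1 + r) - 2)) := by ring
      _ ≤ 4 * (B * (A * (1 + r) - 2)) := mul_le_mul_of_nonneg_right h4 (mul_nonneg hB h)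
      _ ≤ _ := by linarith

theorem sqrt_ratio_le {J : ℕ} (hJ : 1 ≤ J) {A : ℝ} (hA : 0 ≤ A)
    (h : 2 * ((J : ℝ) - 1) ^ 2 ≤ A ^ 2 * J * Real.log (J ! : ℝ)) :
    ((J : ℝ) - 1) / √J ≤ A * √(Real.log (J ! : ℝ) / 2) := by
  have hJ0 : (0 : ℝ) < J := by exact_mod_cast hJ
  rw [div_le_iff₀ (Real.sqrt_pos.2 hJ0), mul_assoc, ← Real.sqrt_mul' _ hJ0.le]
  refine abs_le_of_sq_le_sq' ?_ (by positivity) |>.2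
  rw [mul_pow, Real.sq_sqrt]
  · linarith
  · have : 0 ≤ Real.log (J ! : ℝ) := Real.log_nonneg (by exact_mod_cast J.factorial_pos)
    positivity

/-- A bound `A` on the ratio of `(J - 1) / √J` and `√(log J! / 2)` that is small enough. -/
theorem exists_ratio_bound {J : ℕ} (hJ : 2 ≤ J) :
    ∃ A : ℝ, ((J : ℝ) - 1) / √J ≤ A * √(Real.log (J ! : ℝ) / 2) ∧
      ∀ r : ℝ, 0 ≤ r → r ≤ 1 →
        (1 - 1 / (J : ℝ)) ^ 2 * (1 + r) * (1 + r ^ 2) * (A * (1 + r) - 2) ≤ r ^ 4 := by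
  obtain ⟨h2, h3, h4, h5, h6, -⟩ := log_factorial_lower
  rcases lt_or_ge J 7 with h | h
  · interval_cases J
    · exact ⟨1.21, sqrt_ratio_le (by norm_num) (by norm_num) (by push_cast; linarith),
        fun r hr0 hr1 => quartic_of_tangent (c := 0.67) (by norm_num) hr0 hr1
          (by norm_num) (by norm_num)⟩
    · exact ⟨1.23, sqrt_ratio_le (by norm_num) (by norm_num) (by push_cast; linarith),
        fun r hr0 hr1 => quartic_of_tangent (c := 0.815) (by norm_num) hr0 hr1
          (by norm_num) (by norm_num)⟩
    · exact ⟨1.2, sqrt_ratio_le (by norm_num) (by norm_num) (by push_cast; linarith),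
        fun r hr0 hr1 => quartic_of_tangent (c := 0.875) (by norm_num) hr0 hr1
          (by norm_num) (by norm_num)⟩
    · exact ⟨1.17, sqrt_ratio_le (by norm_num) (by norm_num) (by push_cast; linarith),
        fun r hr0 hr1 => quartic_of_tangent (c := 0.9) (by norm_num) hr0 hr1
          (by norm_num) (by norm_num)⟩
    · exact ⟨1.14, sqrt_ratio_le (by norm_num) (by norm_num) (by push_cast; linarith),
        fun r hr0 hr1 => quartic_of_tangent (c := 0.92) (by norm_num) hr0 hr1
          (by norm_num) (by norm_num)⟩
  · have hJ' : (7 : ℝ) ≤ J := by exact_mod_cast h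
    refine ⟨1.12, sqrt_ratio_le (by omega) (by norm_num) ?_, fun r hr0 hr1 => ?_⟩
    · have := log_factorial_lower_of_seven_le h
      rw [div_le_iff₀ (by linarith)] at this
      nlinarith [sq_nonneg ((J : ℝ) - 1)]
    · have hB1 : (1 - 1 / (J : ℝ)) ^ 2 ≤ 1 := by
        refine pow_le_one₀ ?_ ?_
        · rw [sub_nonneg, div_le_one (by linarith)]; linarith
        · have : 0 ≤ 1 / (J : ℝ) := by positivity
          linarith
      have h1 := quartic_of_tangent (A := 1.12) (B := 1) (c := 1) (by norm_num)
        hr0 hr1 (by norm_num) (by norm_num)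
      rcases le_total (1.12 * (1 + r) - 2) 0 with h | h
      · exact (mul_nonpos_of_nonneg_of_nonpos (by positivity) h).trans (by positivity)
      · refine le_trans ?_ h1
        gcongr

/-! ### Expected overlap of a labelling with a fixed partition -/

section Hits

variable {S B : Type*} [Fintype S] [DecidableEq S] [DecidableEq B] {n : ℕ}

/-- The number of times at which the label `xᵢ` is assigned to the block `bᵢ` that contains `i`. -/
def hits (b : Fin n → B) (σ : S → B) (x : Fin n → S) : ℝ :=
  ∑ i, if b i = σ (x i) then 1 else 0

/-- The number of times spent in the block `k` with the label `y`. -/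
def blockCount (b : Fin n → B) (x : Fin n → S) (k : B) (y : S) : ℝ :=
  ∑ i, if b i = k ∧ x i = y then 1 else 0

theorem blockCount_nonneg (b : Fin n → B) (x : Fin n → S) (k : B) (y : S) :
    0 ≤ blockCount b x k y :=
  Finset.sum_nonneg fun i _ => by split_ifs <;> norm_num

theorem hits_eq_sum_blockCount (b : Fin n → B) (σ : S → B) (x : Fin n → S) :
    hits b σ x = ∑ y, blockCount b x (σ y) y := by
  simp only [hits, blockCount]
  rw [Finset.sum_comm]
  refine Finset.sum_congr rfl fun i _ => ?_
  rw [Finset.sum_eq_single (x i) (fun y _ hy => if_neg fun h => hy h.2.symm) (by simp)]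
  simp

theorem sum_blockCount (b : Fin n → B) (x : Fin n → S) (k : B) :
    ∑ y, blockCount b x k y = ∑ i, if b i = k then 1 else 0 := by
  simp only [blockCount]
  rw [Finset.sum_comm]
  refine Finset.sum_congr rfl fun i _ => ?_
  rw [Finset.sum_eq_single (x i) (fun y _ hy => if_neg fun h => hy h.2.symm) (by simp)]
  simp

theorem blockCount_update {b : Fin n → B} (x : Fin n → S) {i : Fin n} {k : B} (h : k ≠ b i)
    (s : S) : blockCount b (Function.update x i s) k = blockCount b x k := by
  funext y
  refine Finset.sum_congr rfl fun j _ => ?_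
  by_cases hj : j = i
  · subst hj
    simp [h.symm]
  · rw [Function.update_of_ne hj]

/-- For a matrix with vanishing row sums, a sum along an injection is controlled by the
Euclidean norm. -/
theorem sq_sum_injection_le [Fintype B] {δ : B → S → ℝ} (hδ : ∀ k, ∑ y, δ k y = 0) {σ : S → B}
    (hσ : Function.Injective σ) :
    (∑ y, δ (σ y) y) ^ 2 ≤ ((Fintype.card S : ℝ) - 1) * ∑ k, ∑ y, δ k y ^ 2 := by
  rcases isEmpty_or_nonempty S with hS | hS
  · simp
  have hJ : (1 : ℝ) ≤ Fintype.card S := by exact_mod_cast Fintype.card_pos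
  have h1 : (∑ y, δ (σ y) y) ^ 2 ≤ Fintype.card S * ∑ y, δ (σ y) y ^ 2 := by
    rw [← Finset.card_univ]
    exact sq_sum_le_card_mul_sum_sq
  have h2 : ∀ k y, Fintype.card S * δ k y ^ 2 ≤ ((Fintype.card S : ℝ) - 1) * ∑ s, δ k s ^ 2 := by
    intro k y
    have e1 : δ k y = -∑ s ∈ Finset.univ.erase y, δ k s := by
      have := Finset.add_sum_erase Finset.univ (δ k) (Finset.mem_univ y)
      rw [hδ] at this
      linarith
    have e2 : ∑ s, δ k s ^ 2 = δ k y ^ 2 + ∑ s ∈ Finset.univ.erase y, δ k s ^ 2 :=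
      (Finset.add_sum_erase _ _ (Finset.mem_univ y)).symm
    have h3 : (∑ s ∈ Finset.univ.erase y, δ k s) ^ 2 ≤
        ((Fintype.card S : ℝ) - 1) * ∑ s ∈ Finset.univ.erase y, δ k s ^ 2 := by
      have := sq_sum_le_card_mul_sum_sq (s := Finset.univ.erase y) (f := δ k)
      rwa [Finset.card_erase_of_mem (Finset.mem_univ y), Finset.card_univ,
        Nat.cast_sub Fintype.card_pos, Nat.cast_one] at this
    have h4 : δ k y ^ 2 ≤ ((Fintype.card S : ℝ) - 1) * ∑ s ∈ Finset.univ.erase y, δ k s ^ 2 := by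
      rw [e1, neg_sq]; exact h3
    rw [e2]
    linarith
  calc (∑ y, δ (σ y) y) ^ 2 ≤ ∑ y, Fintype.card S * δ (σ y) y ^ 2 := by
        rw [← Finset.mul_sum]; exact h1
    _ ≤ ∑ y, ((Fintype.card S : ℝ) - 1) * ∑ s, δ (σ y) s ^ 2 :=
        Finset.sum_le_sum fun y _ => h2 _ _
    _ = ((Fintype.card S : ℝ) - 1) * ∑ y, ∑ s, δ (σ y) s ^ 2 := by rw [Finset.mul_sum]
    _ ≤ _ := by
        refine mul_le_mul_of_nonneg_left ?_ (by linarith)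
        rw [← Finset.sum_image (f := fun k => ∑ s, δ k s ^ 2) (s := Finset.univ) (g := σ)
          (fun _ _ _ _ h => hσ h)]
        exact Finset.sum_le_sum_of_subset_of_nonneg (Finset.subset_univ _)
          fun k _ _ => Finset.sum_nonneg fun s _ => sq_nonneg _

/-- Maximizing the overlap over all assignments costs at most a standard deviation. -/
theorem IsChain.sum_hits_le_variance [Fintype B] {r : ℝ} (hr0 : 0 < r) (hr1 : r ≤ 1)
    {p : S → (Fin n → S) → ℝ} (h : IsChain r n p) (a : S) (b : Fin n → B)
    {σ : (Fin n → S) → S → B} (hσ : ∀ x, Function.Injective (σ x)) :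
    ∑ x, p a x * hits b (σ x) x ≤ ∑ x, p a x * ∑ z, p a z * hits b (σ x) z +
      (1 + r) / (2 * r) *
        √(((Fintype.card S : ℝ) - 1) * ∑ i, (1 - ∑ s, marginal (p a) i s ^ 2)) := by
  set v : Fin n → S → EuclideanSpace ℝ (B × S) := fun i s => EuclideanSpace.single (b i, s) 1
    with hv
  have hdist : ∀ i s s', ‖v i s - v i s'‖ ≤ √2 := by
    intro i s s'
    by_cases hs : s = s'
    · simp [hs]
    · have : ‖v i s - v i s'‖ ^ 2 = 2 := by
        have hne : ((b i, s') : B × S) ≠ (b i, s) := fun h => hs (congrArg Prod.snd h).symm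
        rw [norm_sub_sq_real]
        simp only [hv, PiLp.norm_single, EuclideanSpace.inner_single_left]
        simp [hs]
        norm_num
      rw [← this, Real.sqrt_sq (norm_nonneg _)]
  have hvar := (h.variance_le hr0 hr1 (Real.sqrt_nonneg 2) v hdist).2 a
  set Z : (Fin n → S) → EuclideanSpace ℝ (B × S) := fun x => ∑ i, v i (x i) with hZ
  set M := ∑ x, p a x • Z x with hM
  have hp0 := h.nonneg a
  have hp1 := h.sum_eq_one a
  have hZc : ∀ x k y, Z x (k, y) = blockCount b x k y := by
    intro x k y
    simp only [hZ, hv, blockCount, WithLp.ofLp_sum, Finset.sum_apply]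
    refine Finset.sum_congr rfl fun i _ => ?_
    simp [eq_comm]
  have hMc : ∀ k y, M (k, y) = ∑ z, p a z * blockCount b z k y := by
    intro k y
    simp only [hM, WithLp.ofLp_sum, Finset.sum_apply, WithLp.ofLp_smul, Pi.smul_apply, smul_eq_mul, hZc]
  have hvar' : ∑ x, p a x * ‖Z x - M‖ ^ 2 ≤
      ((1 + r) / (2 * r)) ^ 2 * ∑ i, (1 - ∑ s, marginal (p a) i s ^ 2) := by
    have e : ∑ x, p a x * ‖Z x - M‖ ^ 2 = ∑ x, p a x * ‖Z x‖ ^ 2 - ‖M‖ ^ 2 := by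
      have : ∑ x, p a x * inner ℝ (Z x) M = ‖M‖ ^ 2 := by
        rw [← real_inner_self_eq_norm_sq]
        nth_rewrite 2 [hM]
        rw [sum_inner]
        simp [real_inner_smul_left]
      have e2 : ∀ x, p a x * ‖Z x - M‖ ^ 2 =
          p a x * ‖Z x‖ ^ 2 - 2 * (p a x * inner ℝ (Z x) M) + p a x * ‖M‖ ^ 2 := fun x => by
        rw [norm_sub_sq_real]; ring
      simp only [e2, Finset.sum_add_distrib, Finset.sum_sub_distrib, ← Finset.mul_sum,
        ← Finset.sum_mul, this, hp1]
      ring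
    rw [e]
    refine hvar.trans (le_of_eq ?_)
    rw [mul_pow, Real.sq_sqrt (by norm_num)]
    ring
  have hpt : ∀ x, hits b (σ x) x - ∑ z, p a z * hits b (σ x) z ≤
      √((Fintype.card S : ℝ) - 1) * ‖Z x - M‖ := by
    intro x
    set δ : B → S → ℝ := fun k y => (Z x - M) (k, y) with hδ
    have hδc : ∀ k y, δ k y = blockCount b x k y - ∑ z, p a z * blockCount b z k y := by
      intro k y
      rw [hδ, ← hZc, ← hMc]
      rfl
    have hδ0 : ∀ k, ∑ y, δ k y = 0 := by
      intro k
      simp only [hδc, Finset.sum_sub_distrib, sum_blockCount]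
      rw [Finset.sum_comm]
      simp only [← Finset.mul_sum, sum_blockCount, ← Finset.sum_mul, hp1, one_mul, sub_self]
    have e1 : hits b (σ x) x - ∑ z, p a z * hits b (σ x) z = ∑ y, δ (σ x y) y := by
      simp only [hδc, Finset.sum_sub_distrib, hits_eq_sum_blockCount, Finset.mul_sum]
      rw [Finset.sum_comm (s := (Finset.univ : Finset (Fin n → S)))]
    have e2 : ∑ k, ∑ y, δ k y ^ 2 = ‖Z x - M‖ ^ 2 := by
      rw [EuclideanSpace.real_norm_sq_eq, Fintype.sum_prod_type]
    have h3 := sq_sum_injection_le hδ0 (hσ x)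
    rw [e1]
    rw [e2] at h3
    rw [← Real.sqrt_sq (norm_nonneg (Z x - M)), ← Real.sqrt_mul' _ (sq_nonneg _)]
    exact Real.le_sqrt_of_sq_le h3
  have hjen : ∑ x, p a x * ‖Z x - M‖ ≤ √(∑ x, p a x * ‖Z x - M‖ ^ 2) := by
    apply Real.le_sqrt_of_sq_le
    have := (even_two.convexOn_pow (𝕜 := ℝ)).map_sum_le (t := Finset.univ) (w := p a)
      (p := fun x => ‖Z x - M‖) (fun x _ => hp0 x) hp1 (by simp)
    simpa using this
  have hq : 0 ≤ (1 + r) / (2 * r) := by positivity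
  calc ∑ x, p a x * hits b (σ x) x
      ≤ ∑ x, (p a x * ∑ z, p a z * hits b (σ x) z +
          √((Fintype.card S : ℝ) - 1) * (p a x * ‖Z x - M‖)) :=
        Finset.sum_le_sum fun x _ => by
          have := mul_le_mul_of_nonneg_left (hpt x) (hp0 x)
          linarith
    _ = ∑ x, p a x * ∑ z, p a z * hits b (σ x) z +
          √((Fintype.card S : ℝ) - 1) * ∑ x, p a x * ‖Z x - M‖ := by
        rw [Finset.sum_add_distrib, Finset.mul_sum]
    _ ≤ _ := by
        refine add_le_add_right ?_ _
        refine (mul_le_mul_of_nonneg_left (hjen.trans (Real.sqrt_le_sqrt hvar'))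
          (Real.sqrt_nonneg _)).trans (le_of_eq ?_)
        rw [Real.sqrt_mul (sq_nonneg _), Real.sqrt_sq hq, mul_left_comm]
        congr 1
        have : Nonempty S := ⟨a⟩
        have hJ : (1 : ℝ) ≤ Fintype.card S := by exact_mod_cast Fintype.card_pos
        rw [← Real.sqrt_mul (by linarith)]

/-- The expected indicator of a hit at time `i` of an injective assignment. -/
theorem sum_marginal_hit_le {P : (Fin n → S) → ℝ} {τ : S → B}
    (hτ : Function.Injective τ) (i : Fin n) (k : B) :
    ∑ s, marginal P i s * (if k = τ s then 1 else 0) ≤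
      if ∃ c, τ c = k then marginalMax P i else 0 := by
  split_ifs with h
  · obtain ⟨c, rfl⟩ := h
    rw [Finset.sum_eq_single c (fun s _ hs => by simp [hτ.eq_iff, hs.symm]) (by simp)]
    simpa using marginal_le_max P i c
  · push Not at h
    rw [Finset.sum_eq_zero]
    intro s _
    simp [(h s).symm]

theorem sum_mul_hits (P : (Fin n → S) → ℝ) (b : Fin n → B) (τ : S → B) :
    ∑ x, P x * hits b τ x = ∑ i, ∑ s, marginal P i s * (if b i = τ s then 1 else 0) := by
  simp only [hits, Finset.mul_sum]
  rw [Finset.sum_comm]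
  exact Finset.sum_congr rfl fun i _ =>
    (sum_marginal_mul P i fun s => if b i = τ s then 1 else 0).symm

theorem sum_mul_hits_le {P : (Fin n → S) → ℝ} (b : Fin n → B) {τ : S → B}
    (hτ : Function.Injective τ) :
    ∑ x, P x * hits b τ x ≤ ∑ i, if ∃ c, τ c = b i then marginalMax P i else 0 := by
  rw [sum_mul_hits]
  exact Finset.sum_le_sum fun i _ => sum_marginal_hit_le hτ i (b i)

end Hits

/-! ### Prediction with exponential weights -/

section Hedge

variable {S : Type*} [Fintype S] [DecidableEq S] {n N : ℕ}

theorem mixture_exp_le {g t : ℝ} (hg0 : 0 ≤ g) (hg1 : g ≤ 1) (ht : 0 ≤ t) :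
    1 + (Real.exp t - 1) * g ≤ Real.exp (t * g + t ^ 2 / 8) := by
  have := sum_exp_le_hoeffding (S := Bool) (w := fun s => if s then g else 1 - g)
    (g := fun s => if s then t else 0) (R := t) (by intro s; cases s <;> simp [hg0, hg1])
    (by simp) (by intro s s'; cases s <;> cases s' <;> simp [ht])
  simp only [Fintype.sum_bool, if_true, Bool.false_eq_true, if_false, Real.exp_zero, mul_one,
    mul_zero, add_zero] at this
  rw [mul_comm t g]
  linarith

/-- The number of times before `k` spent in the block `s` with the label `y`. -/
def pastCount (b : Fin n → Fin N) (x : Fin n → S) (s : Fin N) (k : ℕ) (y : S) : ℝ :=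
  ∑ j : Fin n, if (j : ℕ) < k ∧ b j = s ∧ x j = y then 1 else 0

theorem pastCount_succ (b : Fin n → Fin N) (x : Fin n → S) (s : Fin N) (i : Fin n) (y : S) :
    pastCount b x s (i + 1) y =
      pastCount b x s i y + if b i = s ∧ x i = y then 1 else 0 := by
  have : (if b i = s ∧ x i = y then (1 : ℝ) else 0) =
      ∑ j : Fin n, if j = i then (if b j = s ∧ x j = y then 1 else 0) else 0 := by simp
  rw [this, pastCount, pastCount, ← Finset.sum_add_distrib]
  refine Finset.sum_congr rfl fun j _ => ?_
  rcases lt_trichotomy (j : ℕ) i with h | h | h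
  · have h1 : j ≠ i := fun h' => by simp [h'] at h
    simp [h1, h, h.trans (Nat.lt_succ_self _)]
  · have h1 : j = i := Fin.ext h
    subst h1
    simp
  · have h1 : j ≠ i := fun h' => by simp [h'] at h
    have h2 : ¬ (j : ℕ) < i + 1 := by omega
    simp [h1, h.not_gt, h2]

/-- Exponential weights: the prior `π` reweighted by the labels seen in the block `s` before
time `k`. -/
def expWeight (t : ℝ) (π : S → ℝ) (b : Fin n → Fin N) (x : Fin n → S) (s : Fin N) (k : ℕ)
    (y : S) : ℝ :=
  π y * Real.exp (t * pastCount b x s k y)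

/-- The normalized exponential weights, viewed as a prediction of the label at time `k`. -/
def hedge (t : ℝ) (π : S → ℝ) (b : Fin n → Fin N) (x : Fin n → S) (s : Fin N) (k : ℕ)
    (y : S) : ℝ :=
  expWeight t π b x s k y / ∑ z, expWeight t π b x s k z

theorem sum_expWeight_pos {t : ℝ} {π : S → ℝ} (hπ0 : ∀ y, 0 ≤ π y) (hπ1 : ∑ y, π y = 1)
    (b : Fin n → Fin N) (x : Fin n → S) (s : Fin N) (k : ℕ) :
    0 < ∑ z, expWeight t π b x s k z := by
  have : ∃ y ∈ Finset.univ, 0 < π y := by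
    by_contra hcon
    push Not at hcon
    linarith [Finset.sum_nonpos hcon]
  obtain ⟨y, hy, hpos⟩ := this
  exact Finset.sum_pos' (fun z _ => mul_nonneg (hπ0 z) (Real.exp_nonneg _))
    ⟨y, hy, mul_pos hpos (Real.exp_pos _)⟩

theorem hedge_nonneg {t : ℝ} {π : S → ℝ} (hπ0 : ∀ y, 0 ≤ π y) (b : Fin n → Fin N)
    (x : Fin n → S) (s : Fin N) (k : ℕ) (y : S) : 0 ≤ hedge t π b x s k y :=
  div_nonneg (mul_nonneg (hπ0 y) (Real.exp_nonneg _))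
    (Finset.sum_nonneg fun z _ => mul_nonneg (hπ0 z) (Real.exp_nonneg _))

theorem sum_hedge {t : ℝ} {π : S → ℝ} (hπ0 : ∀ y, 0 ≤ π y) (hπ1 : ∑ y, π y = 1)
    (b : Fin n → Fin N) (x : Fin n → S) (s : Fin N) (k : ℕ) :
    ∑ y, hedge t π b x s k y = 1 := by
  simp only [hedge, ← Finset.sum_div]
  exact div_self (sum_expWeight_pos hπ0 hπ1 b x s k).ne'

/-- A mixture of exponentials of label counts is at most the exponential of the number of correct
predictions of the exponential weights forecaster, up to the Hoeffding correction. -/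
theorem sum_expWeight_le {t : ℝ} (ht : 0 ≤ t) {π : S → ℝ} (hπ0 : ∀ y, 0 ≤ π y)
    (hπ1 : ∑ y, π y = 1) (b : Fin n → Fin N) (x : Fin n → S) (s : Fin N) :
    ∀ k ≤ n, ∑ y, expWeight t π b x s k y ≤
      Real.exp (∑ j : Fin n, if (j : ℕ) < k ∧ b j = s then
        t * hedge t π b x s j (x j) + t ^ 2 / 8 else 0)
  | 0, _ => by simp [expWeight, pastCount, hπ1]
  | k + 1, hk => by
    have ih := sum_expWeight_le ht hπ0 hπ1 b x s k (by omega)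
    set i : Fin n := ⟨k, hk⟩ with hi
    have hsum : (∑ j : Fin n, if (j : ℕ) < k + 1 ∧ b j = s then
        t * hedge t π b x s j (x j) + t ^ 2 / 8 else 0) =
        (∑ j : Fin n, if (j : ℕ) < k ∧ b j = s then
        t * hedge t π b x s j (x j) + t ^ 2 / 8 else 0) +
        if b i = s then t * hedge t π b x s i (x i) + t ^ 2 / 8 else 0 := by
      have : (if b i = s then t * hedge t π b x s i (x i) + t ^ 2 / 8 else 0) =
          ∑ j : Fin n, if j = i then (if b j = s then
            t * hedge t π b x s j (x j) + t ^ 2 / 8 else 0) else 0 := by simp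
      rw [this, ← Finset.sum_add_distrib]
      refine Finset.sum_congr rfl fun j _ => ?_
      rcases lt_trichotomy (j : ℕ) k with h | h | h
      · have h1 : j ≠ i := fun h' => by simp [h', hi] at h
        simp [h1, h, h.trans (Nat.lt_succ_self _)]
      · have h1 : j = i := Fin.ext h
        subst h1
        simp [hi]
      · have h1 : j ≠ i := fun h' => by simp [h', hi] at h
        have h2 : ¬ (j : ℕ) < k + 1 := by omega
        simp [h1, h.not_gt, h2]
    rw [hsum, Real.exp_add]
    have hpc : ∀ y, pastCount b x s (k + 1) y =
      pastCount b x s k y + if b i = s ∧ x i = y then 1 else 0 := pastCount_succ b x s i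
    by_cases hb : b i = s
    · have hG := sum_expWeight_pos (t := t) hπ0 hπ1 b x s k
      have e : ∑ y, expWeight t π b x s (k + 1) y = (∑ y, expWeight t π b x s k y) *
          (1 + (Real.exp t - 1) * hedge t π b x s k (x i)) := by
        have e1 : ∀ y, expWeight t π b x s (k + 1) y = expWeight t π b x s k y +
            if x i = y then (Real.exp t - 1) * expWeight t π b x s k y else 0 := by
          intro y
          simp only [expWeight, hpc, hb, true_and]
          split_ifs
          · rw [mul_add, Real.exp_add, mul_one]; ring
          · simp
        simp only [e1, Finset.sum_add_distrib, Finset.sum_ite_eq, Finset.mem_univ, if_true, hedge]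
        field_simp
      rw [e, if_pos hb]
      have hle : hedge t π b x s k (x i) ≤ 1 := by
        rw [← sum_hedge (t := t) hπ0 hπ1 b x s k]
        exact Finset.single_le_sum (f := fun y => hedge t π b x s k y)
          (fun y _ => hedge_nonneg hπ0 b x s k y) (Finset.mem_univ _)
      exact mul_le_mul ih (mixture_exp_le (hedge_nonneg hπ0 b x s k _) hle ht)
        (add_nonneg zero_le_one (mul_nonneg (sub_nonneg.2 (Real.one_le_exp ht))
          (hedge_nonneg hπ0 b x s k _))) (Real.exp_nonneg _)
    · rw [if_neg hb, Real.exp_zero, mul_one]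
      refine le_trans (le_of_eq ?_) ih
      refine Finset.sum_congr rfl fun y _ => ?_
      simp [expWeight, hpc, hb]

theorem sum_mul_exp_blockCount_le {t : ℝ} (ht : 0 ≤ t) {π : S → ℝ} (hπ0 : ∀ y, 0 ≤ π y)
    (hπ1 : ∑ y, π y = 1) (b : Fin n → Fin N) (x : Fin n → S) (s : Fin N) :
    ∑ y, π y * Real.exp (t * blockCount b x s y) ≤
      Real.exp (∑ j : Fin n, if b j = s then t * hedge t π b x s j (x j) + t ^ 2 / 8 else 0) := by
  have := sum_expWeight_le ht hπ0 hπ1 b x s n le_rfl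
  simpa [expWeight, pastCount, blockCount] using this

end Hedge

/-! ### Expected overlap: the permanent bound and the combination of the two bounds -/

section Potential

variable {S : Type*} [Fintype S] [DecidableEq S] {n N : ℕ}

/-- The exponential moment of the permanent over the fixed rows `ρ₀`. -/
theorem IsChain.sum_permanent_le {r : ℝ} (hr0 : 0 < r) (hr1 : r ≤ 1)
    {p : S → (Fin n → S) → ℝ} (h : IsChain r n p) (a : S) (b : Fin n → Fin N)
    {ρ₀ : S → Fin N} (hρ₀ : Function.Injective ρ₀) {t : ℝ} (ht : 0 ≤ t) :
    ∑ x, p a x * permanent t (blockCount b x) ρ₀ ≤ ((Fintype.card S)! : ℝ) *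
      Real.exp (∑ i, if ∃ c, ρ₀ c = b i then
        t * marginalMax (p a) i + ((1 + r) / (2 * r)) ^ 2 * t ^ 2 / 8 else 0) := by
  simp only [permanent, Finset.mul_sum]
  rw [Finset.sum_comm, ← Fintype.card_perm, ← Finset.card_univ, ← nsmul_eq_mul,
    ← Finset.sum_const]
  refine Finset.sum_le_sum fun π _ => ?_
  set τ : S → Fin N := fun y => ρ₀ (π.symm y) with hτdef
  have hτ : Function.Injective τ := hρ₀.comp π.symm.injective
  have hτr : ∀ k, (∃ c, τ c = k) ↔ ∃ c, ρ₀ c = k := fun k =>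
    ⟨fun ⟨c, hc⟩ => ⟨_, hc⟩, fun ⟨c, hc⟩ => ⟨π c, by simp [hτdef, hc]⟩⟩
  have e : ∀ x, ∏ c, Real.exp (t * blockCount b x (ρ₀ c) (π c)) =
      Real.exp (∑ i, t * (if b i = τ (x i) then 1 else 0)) := by
    intro x
    rw [← Real.exp_sum, ← Finset.mul_sum, ← Finset.mul_sum]
    congr 2
    change _ = hits b τ x
    rw [hits_eq_sum_blockCount, ← Equiv.sum_comp π fun y => blockCount b x (τ y) y]
    simp [hτdef]
  simp only [e]
  have hmc := h.exp_le hr0 hr1 (fun i y => t * (if b i = τ y then 1 else 0))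
    (fun i => if ∃ c, ρ₀ c = b i then t else 0) (fun i s s' => by
      have h1 : ∀ s, (b i = τ s) → ∃ c, ρ₀ c = b i := fun s hs => (hτr _).1 ⟨s, hs.symm⟩
      by_cases hb : ∃ c, ρ₀ c = b i
      · simp only [hb, if_true]
        split_ifs <;> simp [ht]
      · have h2 : ∀ s, ¬ (b i = τ s) := fun s hs => hb (h1 s hs)
        simp [hb, h2])
    (fun i => by split_ifs <;> simp [ht]) a
  refine hmc.trans (Real.exp_le_exp.2 ?_)
  have hmean : ∑ x, p a x * ∑ i, t * (if b i = τ (x i) then (1 : ℝ) else 0) ≤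
      ∑ i, if ∃ c, ρ₀ c = b i then t * marginalMax (p a) i else 0 := by
    have h1 := mul_le_mul_of_nonneg_left (sum_mul_hits_le (P := p a) b hτ) ht
    refine (le_of_eq ?_).trans (h1.trans (le_of_eq ?_))
    · rw [Finset.mul_sum]
      refine Finset.sum_congr rfl fun x _ => ?_
      rw [← Finset.mul_sum, hits]; ring
    · rw [Finset.mul_sum]
      refine Finset.sum_congr rfl fun i _ => ?_
      simp only [hτr, mul_ite, mul_zero]
  have e2 : ∑ i, (if ∃ c, ρ₀ c = b i then
        t * marginalMax (p a) i + ((1 + r) / (2 * r)) ^ 2 * t ^ 2 / 8 else 0) =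
      ∑ i, (if ∃ c, ρ₀ c = b i then t * marginalMax (p a) i else 0) +
        ((1 + r) / (2 * r)) ^ 2 * (∑ i, (if ∃ c, ρ₀ c = b i then t else 0) ^ 2) / 8 := by
    rw [Finset.mul_sum, Finset.sum_div, ← Finset.sum_add_distrib]
    refine Finset.sum_congr rfl fun i _ => ?_
    split_ifs <;> simp
  rw [e2]
  exact add_le_add_left hmean _

/-- The prediction of the label at time `i` by the exponential weights forecaster of the block
of `i`, with the column probabilities of the matching process as prior. -/
def blockHedge (t : ℝ) (b : Fin n → Fin N) (ρ₀ : S → Fin N) (i : Fin n) (x : Fin n → S) : S → ℝ :=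
  hedge t (columnProb t (blockCount b x) (matchState (blockCount b x) ρ₀ (b i))) b x (b i) i

/-- The forecaster for a time in a block outside `ρ₀` does not use the label at that time: the prior
only involves `ρ₀` and earlier blocks, the weights only earlier times. -/
theorem blockHedge_update {t : ℝ} {b : Fin n → Fin N} {ρ₀ : S → Fin N} {i : Fin n}
    (hi : ¬ ∃ c, ρ₀ c = b i) (x : Fin n → S) (s : S) :
    blockHedge t b ρ₀ i (Function.update x i s) = blockHedge t b ρ₀ i x := by
  have hne : ∀ k ∈ matchSeen ρ₀ (b i), k ≠ b i := by
    rintro k (h | h) rfl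
    exacts [hi h, lt_irrefl _ h]
  have h1 : matchState (blockCount b (Function.update x i s)) ρ₀ (b i) =
      matchState (blockCount b x) ρ₀ (b i) :=
    matchState_congr _ fun k hk => blockCount_update x (hne k hk) s
  have h2 : columnProb t (blockCount b (Function.update x i s))
      (matchState (blockCount b x) ρ₀ (b i)) =
      columnProb t (blockCount b x) (matchState (blockCount b x) ρ₀ (b i)) :=
    columnProb_congr fun c => blockCount_update x (hne _ (matchState_mem _ _ _ _)) s
  have h3 : ∀ y, pastCount b (Function.update x i s) (b i) i y = pastCount b x (b i) i y := by
    intro y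
    refine Finset.sum_congr rfl fun j _ => ?_
    by_cases hj : j = i
    · subst hj; simp
    · rw [Function.update_of_ne hj]
  funext y
  simp only [blockHedge, hedge, expWeight, h1, h2, h3]

/-- The bound on the expected overlap obtained from the permanent: the blocks outside the range of
`ρ₀` only contribute through the predictability of their labels. -/
theorem IsChain.sum_hits_le_potential {r : ℝ} (hr0 : 0 < r) (hr1 : r ≤ 1)
    {p : S → (Fin n → S) → ℝ} (h : IsChain r n p) (a : S) (b : Fin n → Fin N)
    {ρ₀ : S → Fin N} (hρ₀ : Function.Injective ρ₀) (hS : 2 ≤ Fintype.card S) {t : ℝ} (ht : 0 < t)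
    {σ : (Fin n → S) → S → Fin N} (hσ : ∀ x, Function.Injective (σ x)) :
    t * ∑ x, p a x * hits b (σ x) x ≤ Real.log ((Fintype.card S)! : ℝ) +
      t * (∑ i, marginalMax (p a) i + (1 - 1 / (Fintype.card S : ℝ)) ^ 2 * (1 / r ^ 4 - 1) *
        ∑ i, if ∃ c, ρ₀ c = b i then 0 else marginalMax (p a) i) +
      ((1 + r) / (2 * r)) ^ 2 * t ^ 2 / 8 * n := by
  have hne : Nonempty S := ⟨a⟩
  have hp0 := h.nonneg a
  have hp1 := h.sum_eq_one a
  set q := (1 + r) / (2 * r) with hq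
  have hq1 : 1 ≤ q := by rw [hq, one_le_div (by linarith)]; linarith
  set C := (1 - 1 / (Fintype.card S : ℝ)) ^ 2 * (1 / r ^ 4 - 1) with hC
  set A := Real.log ((Fintype.card S)! : ℝ) + ∑ i, (if ∃ c, ρ₀ c = b i then
        t * marginalMax (p a) i + q ^ 2 * t ^ 2 / 8 else 0) with hA
  have hperm := h.sum_permanent_le hr0 hr1 a b hρ₀ ht.le
  have hfac : (0 : ℝ) < ((Fintype.card S)! : ℝ) := by exact_mod_cast Nat.factorial_pos _
  have hA' : ((Fintype.card S)! : ℝ) * Real.exp (∑ i, if ∃ c, ρ₀ c = b i then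
        t * marginalMax (p a) i + q ^ 2 * t ^ 2 / 8 else 0) = Real.exp A := by
    rw [hA, Real.exp_add, Real.exp_log hfac]
  rw [hA'] at hperm
  set g := fun i x => blockHedge t b ρ₀ i x with hg
  -- the logarithm is linearized at `exp A`, a bound for the mean of the permanent
  have hpt : ∀ x, t * hits b (σ x) x ≤ permanent t (blockCount b x) ρ₀ * Real.exp (-A) - 1 + A +
      ∑ i, if ∃ c, ρ₀ c = b i then 0 else t * g i x (x i) + t ^ 2 / 8 := by
    intro x
    have h1 := exp_assignment_le ht.le (w := blockCount b x) (blockCount_nonneg b x) hρ₀ (hσ x)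
    rw [← hits_eq_sum_blockCount] at h1
    have h2 : (∏ s : Fin N, if (∃ c, ρ₀ c = s) then 1 else
        ∑ y, columnProb t (blockCount b x) (matchState (blockCount b x) ρ₀ s) y *
          Real.exp (t * blockCount b x s y)) ≤
        Real.exp (∑ i, if ∃ c, ρ₀ c = b i then 0 else t * g i x (x i) + t ^ 2 / 8) := by
      have e : (∑ i, if ∃ c, ρ₀ c = b i then 0 else t * g i x (x i) + t ^ 2 / 8) =
          ∑ s : Fin N, if ∃ c, ρ₀ c = s then 0 else
            ∑ i, if b i = s then t * g i x (x i) + t ^ 2 / 8 else 0 := by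
        have : ∀ s : Fin N, (if ∃ c, ρ₀ c = s then 0 else
            ∑ i, if b i = s then t * g i x (x i) + t ^ 2 / 8 else 0) =
            ∑ i, if b i = s then (if ∃ c, ρ₀ c = b i then 0 else t * g i x (x i) + t ^ 2 / 8)
              else 0 := by
          intro s
          split_ifs with hs
          · rw [Finset.sum_eq_zero]
            intro i _
            split_ifs with h1 h2
            · rfl
            · exact absurd (h1 ▸ hs) h2
            · rfl
          · refine Finset.sum_congr rfl fun i _ => ?_
            split_ifs with h1 h2
            · exact absurd (h1 ▸ h2) hs
            · rfl
            · rfl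
        simp only [this]
        rw [Finset.sum_comm]
        simp
      rw [e, Real.exp_sum]
      refine Finset.prod_le_prod (fun s _ => ?_) fun s _ => ?_
      · split_ifs
        · exact zero_le_one
        · exact Finset.sum_nonneg fun y _ =>
            mul_nonneg (columnProb_nonneg _ _ _ _) (Real.exp_nonneg _)
      · split_ifs with hs
        · simp
        · refine (sum_mul_exp_blockCount_le ht.le (columnProb_nonneg _ _ _)
            (sum_columnProb _ _ _) b x s).trans (Real.exp_le_exp.2 (le_of_eq ?_))
          refine Finset.sum_congr rfl fun i _ => ?_
          split_ifs with hi
          · subst hi; rfl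
          · rfl
    have hper0 := permanent_nonneg t (blockCount b x) ρ₀
    have h3 := h1.trans (mul_le_mul_of_nonneg_left h2 hper0)
    set X := ∑ i, if ∃ c, ρ₀ c = b i then 0 else t * g i x (x i) + t ^ 2 / 8
    have h4 : Real.exp (t * hits b (σ x) x - X - A) ≤
        permanent t (blockCount b x) ρ₀ * Real.exp (-A) := by
      have : t * hits b (σ x) x - X - A = t * hits b (σ x) x + (-X) + (-A) := by ring
      rw [this, Real.exp_add, Real.exp_add]
      refine mul_le_mul_of_nonneg_right ?_ (Real.exp_nonneg _)
      rw [Real.exp_neg, ← div_eq_mul_inv, div_le_iff₀ (Real.exp_pos _)]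
      exact h3
    have h5 := Real.add_one_le_exp (t * hits b (σ x) x - X - A)
    linarith
  -- predictability of the labels outside the fixed rows
  have hpred : ∀ i, (¬ ∃ c, ρ₀ c = b i) →
      ∑ x, p a x * g i x (x i) ≤ marginalMax (p a) i * (1 + C) := fun i hi =>
    prediction_le hr0 hr1 hp0 hp1 (fun i x x' s s' => h.flip hr0 hr1 a a i x x' s s') hS i
      (fun x y => hedge_nonneg (columnProb_nonneg _ _ _) _ _ _ _ _)
      (fun x => sum_hedge (columnProb_nonneg _ _ _) (sum_columnProb _ _ _) _ _ _ _)
      (fun x y => blockHedge_update hi x y)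
  have hsum : t * ∑ x, p a x * hits b (σ x) x ≤
      (∑ x, p a x * permanent t (blockCount b x) ρ₀) * Real.exp (-A) - 1 + A +
      ∑ i, if ∃ c, ρ₀ c = b i then 0 else t * (∑ x, p a x * g i x (x i)) + t ^ 2 / 8 := by
    calc t * ∑ x, p a x * hits b (σ x) x = ∑ x, p a x * (t * hits b (σ x) x) := by
          rw [Finset.mul_sum]; exact Finset.sum_congr rfl fun x _ => by ring
      _ ≤ ∑ x, p a x * (permanent t (blockCount b x) ρ₀ * Real.exp (-A) - 1 + A +
          ∑ i, if ∃ c, ρ₀ c = b i then 0 else t * g i x (x i) + t ^ 2 / 8) :=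
          Finset.sum_le_sum fun x _ => mul_le_mul_of_nonneg_left (hpt x) (hp0 x)
      _ = _ := by
          have e : ∀ i, (if ∃ c, ρ₀ c = b i then 0 else
              t * (∑ x, p a x * g i x (x i)) + t ^ 2 / 8) =
              ∑ x, p a x * (if ∃ c, ρ₀ c = b i then 0 else t * g i x (x i) + t ^ 2 / 8) := by
            intro i
            split_ifs
            · simp
            · simp only [mul_add, Finset.sum_add_distrib, ← Finset.sum_mul, hp1, one_mul,
                Finset.mul_sum]
              congr 1
              exact Finset.sum_congr rfl fun x _ => by ring
          simp only [e]
          rw [Finset.sum_comm]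
          simp only [← Finset.mul_sum, mul_add, mul_sub, Finset.sum_add_distrib,
            Finset.sum_sub_distrib, ← Finset.sum_mul, hp1, ← mul_assoc]
          ring
  have hexp : (∑ x, p a x * permanent t (blockCount b x) ρ₀) * Real.exp (-A) ≤ 1 := by
    rw [Real.exp_neg, ← div_eq_mul_inv, div_le_one (Real.exp_pos _)]
    exact hperm
  refine hsum.trans ?_
  have hfin : (∑ i, (if ∃ c, ρ₀ c = b i then
        t * marginalMax (p a) i + q ^ 2 * t ^ 2 / 8 else 0)) +
      (∑ i, if ∃ c, ρ₀ c = b i then 0 else t * (∑ x, p a x * g i x (x i)) + t ^ 2 / 8) ≤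
      ∑ i, (t * (marginalMax (p a) i + C * if ∃ c, ρ₀ c = b i then 0 else marginalMax (p a) i)
        + q ^ 2 * t ^ 2 / 8) := by
    rw [← Finset.sum_add_distrib]
    refine Finset.sum_le_sum fun i _ => ?_
    split_ifs with hi
    · simp
    · have h1 := mul_le_mul_of_nonneg_left (hpred i hi) ht.le
      have h2 : t ^ 2 ≤ q ^ 2 * t ^ 2 :=
        le_mul_of_one_le_left (sq_nonneg t) (one_le_pow₀ hq1)
      linarith
  have hfin' : ∑ i, (t * (marginalMax (p a) i + C * if ∃ c, ρ₀ c = b i then 0 else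
      marginalMax (p a) i) + q ^ 2 * t ^ 2 / 8) =
      t * (∑ i, marginalMax (p a) i + C * ∑ i, if ∃ c, ρ₀ c = b i then 0 else
        marginalMax (p a) i) + q ^ 2 * t ^ 2 / 8 * n := by
    simp only [Finset.sum_add_distrib, ← Finset.mul_sum, Finset.sum_const, Finset.card_univ,
      Fintype.card_fin, nsmul_eq_mul]
    ring
  linarith

theorem sum_sq_marginal_ge {P : (Fin n → S) → ℝ} (hP1 : ∑ x, P x = 1) (i : Fin n) :
    1 ≤ Fintype.card S * ∑ s, marginal P i s ^ 2 := by
  have : (∑ s, marginal P i s) ^ 2 ≤ (Fintype.card S : ℝ) * ∑ s, marginal P i s ^ 2 := by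
    rw [← Finset.card_univ]
    exact sq_sum_le_card_mul_sum_sq
  rwa [sum_marginal, hP1, one_pow] at this

theorem marginalMax_nonneg {P : (Fin n → S) → ℝ} (hP0 : ∀ x, 0 ≤ P x) (i : Fin n) :
    0 ≤ marginalMax P i :=
  Real.iSup_nonneg fun s => marginal_nonneg hP0 i s

/-- The expected value of the best overlap between the labels and a fixed partition exceeds the
expected number of correct labels of the best classifier by at most
`r⁻¹ √(n log J! / 2)`. -/
theorem IsChain.sum_hits_le {r : ℝ} (hr0 : 0 < r) (hr1 : r ≤ 1)
    {p : S → (Fin n → S) → ℝ} (h : IsChain r n p) (a : S) (b : Fin n → Fin N)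
    (hN : Fintype.card S ≤ N) (hS : 2 ≤ Fintype.card S) (hn : 1 ≤ n)
    {σ : (Fin n → S) → S → Fin N} (hσ : ∀ x, Function.Injective (σ x)) :
    ∑ x, p a x * hits b (σ x) x ≤ ∑ i, marginalMax (p a) i +
      1 / r * √(n * (Real.log ((Fintype.card S)! : ℝ) / 2)) := by
  have hp0 := h.nonneg a
  have hp1 := h.sum_eq_one a
  set J : ℝ := (Fintype.card S : ℝ) with hJdef
  have hJ2 : (2 : ℝ) ≤ J := by rw [hJdef]; exact_mod_cast hS
  set m := marginalMax (p a) with hm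
  have hm0 : ∀ i, 0 ≤ m i := marginalMax_nonneg hp0
  set L := Real.log ((Fintype.card S)! : ℝ) with hL
  have hLpos : 0 < L := by
    refine Real.log_pos ?_
    have : 1 < (Fintype.card S)! := by
      calc 1 < 2 ! := by norm_num [Nat.factorial]
        _ ≤ _ := Nat.factorial_le hS
    exact_mod_cast this
  have hn0 : (0 : ℝ) < n := by exact_mod_cast hn
  set q := (1 + r) / (2 * r) with hq
  have hqpos : 0 < q := by positivity
  -- the rows that carry the largest weight of maximal marginals
  have hemb : Nonempty (S ↪ Fin N) := by
    refine Function.Embedding.nonempty_of_card_le ?_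
    rwa [Fintype.card_fin]
  obtain ⟨ρ₀, hρ₀⟩ := Finite.exists_max fun ρ : S ↪ Fin N =>
    ∑ i, if ∃ c, ρ c = b i then m i else 0
  set Mt := ∑ i, if ∃ c, ρ₀ c = b i then 0 else m i with hMt
  have hMt0 : 0 ≤ Mt := Finset.sum_nonneg fun i _ => by split_ifs; exacts [le_rfl, hm0 i]
  have hsplit : (∑ i, if ∃ c, ρ₀ c = b i then m i else 0) = ∑ i, m i - Mt := by
    rw [eq_sub_iff_add_eq, hMt, ← Finset.sum_add_distrib]
    exact Finset.sum_congr rfl fun i _ => by split_ifs <;> simp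
  have hvar := h.sum_hits_le_variance hr0 hr1 a b hσ
  have hmean : ∑ x, p a x * ∑ z, p a z * hits b (σ x) z ≤ ∑ i, m i - Mt := by
    rw [← hsplit]
    calc ∑ x, p a x * ∑ z, p a z * hits b (σ x) z
        ≤ ∑ x, p a x * (∑ i, if ∃ c, ρ₀ c = b i then m i else 0) :=
          Finset.sum_le_sum fun x _ => mul_le_mul_of_nonneg_left
            ((sum_mul_hits_le b (hσ x)).trans (hρ₀ ⟨σ x, hσ x⟩)) (hp0 x)
      _ = _ := by rw [← Finset.sum_mul, hp1, one_mul]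
  obtain ⟨A, hA, hAr⟩ := exists_ratio_bound hS
  set τ := √(L / 2) with hτ
  have hτ0 : 0 < τ := Real.sqrt_pos.2 (by linarith)
  have hgini : √((J - 1) * ∑ i, (1 - ∑ s, marginal (p a) i s ^ 2)) ≤ A * τ * √n := by
    have h1 : ∑ i, (1 - ∑ s, marginal (p a) i s ^ 2) ≤ n * (1 - 1 / J) := by
      calc ∑ i, (1 - ∑ s, marginal (p a) i s ^ 2) ≤ ∑ i : Fin n, (1 - 1 / J) := by
            refine Finset.sum_le_sum fun i _ => sub_le_sub_left ?_ _
            rw [div_le_iff₀ (by linarith)]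
            linarith [sum_sq_marginal_ge hp1 i]
        _ = _ := by simp [mul_sub]
    calc √((J - 1) * ∑ i, (1 - ∑ s, marginal (p a) i s ^ 2))
        ≤ √(((J - 1) / √J) ^ 2 * n) := by
          refine Real.sqrt_le_sqrt ((mul_le_mul_of_nonneg_left h1 (by linarith)).trans
            (le_of_eq ?_))
          rw [div_pow, Real.sq_sqrt (by linarith)]
          field_simp
      _ = (J - 1) / √J * √n := by
          rw [Real.sqrt_mul (sq_nonneg _), Real.sqrt_sq]
          exact div_nonneg (by linarith) (Real.sqrt_nonneg _)
      _ ≤ _ := mul_le_mul_of_nonneg_right hA (Real.sqrt_nonneg _)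
  have hT : √(n * (L / 2)) = τ * √n := by rw [Real.sqrt_mul hn0.le, mul_comm]
  rw [hT]
  rcases le_total (q * (A * τ * √n) - 1 / r * (τ * √n)) Mt with hcase | hcase
  · have := mul_le_mul_of_nonneg_left hgini hqpos.le
    linarith
  · -- `t` balances `log J!` against the variance proxy
    set t := √(8 * L / n) / q with ht
    have ht0 : 0 < t := div_pos (Real.sqrt_pos.2 (by positivity)) hqpos
    have hpot := h.sum_hits_le_potential hr0 hr1 a b ρ₀.injective hS ht0 hσ
    set C := (1 - 1 / J) ^ 2 * (1 / r ^ 4 - 1) with hC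
    have hsq : √(8 * L / n) * √n = 4 * τ := by
      rw [← Real.sqrt_mul (by positivity), div_mul_cancel₀ _ hn0.ne', hτ,
        show 8 * L = 4 ^ 2 * (L / 2) by ring, Real.sqrt_mul (by norm_num),
        Real.sqrt_sq (by norm_num)]
    have hsn : √(n : ℝ) ^ 2 = n := Real.sq_sqrt hn0.le
    have hsn0 : 0 < √(n : ℝ) := Real.sqrt_pos.2 hn0
    have hτ2 : τ ^ 2 = L / 2 := Real.sq_sqrt (by linarith)
    have htn : t * √n = 4 * τ / q := by rw [ht, div_mul_eq_mul_div, hsq]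
    have hopt : L + q ^ 2 * t ^ 2 / 8 * n = t * (q * (τ * √n)) := by
      have e1 : q ^ 2 * t ^ 2 / 8 * n = q ^ 2 * (t * √n) ^ 2 / 8 := by
        rw [mul_pow, hsn]; ring
      have e2 : t * (q * (τ * √n)) = q * τ * (t * √n) := by ring
      rw [e1, e2, htn]
      field_simp
      linarith
    have hbound : ∑ x, p a x * hits b (σ x) x ≤ ∑ i, m i + C * Mt + q * (τ * √n) := by
      refine le_of_mul_le_mul_left ?_ ht0
      calc t * ∑ x, p a x * hits b (σ x) x
          ≤ L + t * (∑ i, m i + C * Mt) + q ^ 2 * t ^ 2 / 8 * n := hpot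
        _ = t * (∑ i, m i + C * Mt) + (L + q ^ 2 * t ^ 2 / 8 * n) := by ring
        _ = _ := by rw [hopt]; ring
    have hC0 : 0 ≤ C := mul_nonneg (sq_nonneg _)
      (sub_nonneg.2 (one_le_one_div (by positivity) (pow_le_one₀ hr0.le hr1)))
    have hnum : C * (q * A - 1 / r) + q ≤ 1 / r := by
      have h1 := mul_le_mul_of_nonneg_left (hAr r hr0.le hr1) (sub_nonneg.2 hr1)
      rw [hC, hq]
      have e : 1 / r - ((1 - 1 / J) ^ 2 * (1 / r ^ 4 - 1) * ((1 + r) / (2 * r) * A - 1 / r) +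
          (1 + r) / (2 * r)) = ((1 - r) * r ^ 4 - (1 - r) *
            ((1 - 1 / J) ^ 2 * (1 + r) * (1 + r ^ 2) * (A * (1 + r) - 2))) / (2 * r ^ 5) := by
        field_simp
        ring
      rw [← sub_nonneg, e]
      exact div_nonneg (by linarith) (by positivity)
    have h2 := mul_le_mul_of_nonneg_left hcase hC0
    have h3 := mul_le_mul_of_nonneg_right hnum (mul_nonneg hτ0.le hsn0.le)
    nlinarith

end Potential

/-! ### The bound when the labels are predictable -/

section Predictable

variable {S : Type*} [Fintype S] [DecidableEq S] {n N : ℕ}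

/-- Lower deviations of an additive functional of a chain from its mean, in exponential form. -/
theorem IsChain.sum_exp_neg_le {r : ℝ} (hr0 : 0 < r) (hr1 : r ≤ 1)
    {p : S → (Fin n → S) → ℝ} (h : IsChain r n p) (a : S) (hn : 1 ≤ n) {θ : Fin n → S → ℝ} {c : ℝ}
    (hc : 0 < c) (hθ : ∀ i s s', θ i s - θ i s' ≤ c) {m t : ℝ} (ht : 0 ≤ t)
    (hm : m ≤ ∑ x, p a x * ∑ i, θ i (x i)) :
    ∑ x, p a x * Real.exp (-(4 * r ^ 2 * t / (n * c ^ 2)) * (∑ i, θ i (x i) - m + t)) ≤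
      Real.exp (-(2 * r ^ 2 * t ^ 2 / (n * c ^ 2))) := by
  have hn0 : (0 : ℝ) < n := by exact_mod_cast hn
  set s := 4 * r ^ 2 * t / (n * c ^ 2) with hs
  have hs0 : 0 ≤ s := by positivity
  have h1 := h.exp_le hr0 hr1 (fun i y => -s * θ i y) (fun _ => s * c)
    (fun i y y' => by nlinarith [hθ i y' y]) (fun _ => by positivity) a
  have e : ∀ x : Fin n → S, ∑ i, -s * θ i (x i) = -s * ∑ i, θ i (x i) :=
    fun x => (Finset.mul_sum _ _ _).symm
  simp only [e] at h1
  have e2 : ∑ x, p a x * (-s * ∑ i, θ i (x i)) = -s * ∑ x, p a x * ∑ i, θ i (x i) := by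
    rw [Finset.mul_sum]; exact Finset.sum_congr rfl fun x _ => by ring
  rw [e2] at h1
  have e3 : ∀ x : Fin n → S, Real.exp (-s * (∑ i, θ i (x i) - m + t)) =
      Real.exp (-s * ∑ i, θ i (x i)) * Real.exp (s * m - s * t) := fun x => by
    rw [← Real.exp_add]; congr 1; ring
  simp only [e3, ← mul_assoc, ← Finset.sum_mul]
  refine (mul_le_mul_of_nonneg_right h1 (Real.exp_nonneg _)).trans ?_
  rw [← Real.exp_add]
  refine Real.exp_le_exp.2 ?_
  simp only [Finset.sum_const, Finset.card_univ, Fintype.card_fin, nsmul_eq_mul]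
  have hq : ((1 + r) / (2 * r)) ^ 2 ≤ (1 / r) ^ 2 := by
    refine pow_le_pow_left₀ (by positivity) ?_ 2
    rw [div_le_div_iff₀ (by positivity) hr0]
    nlinarith
  have h2 : ((1 + r) / (2 * r)) ^ 2 * (n * (s * c) ^ 2) / 8 ≤
      (1 / r) ^ 2 * (n * (s * c) ^ 2) / 8 := by gcongr
  have h3 : (1 / r) ^ 2 * (n * (s * c) ^ 2) / 8 = 2 * r ^ 2 * t ^ 2 / (n * c ^ 2) := by
    rw [hs]; field_simp; ring
  have h4 : s * t = 2 * (2 * r ^ 2 * t ^ 2 / (n * c ^ 2)) := by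
    rw [hs]; field_simp; ring
  have h5 := mul_le_mul_of_nonneg_left hm hs0
  linarith

/-- The probability that an additive functional with mean at least `t` is negative. -/
theorem IsChain.prob_neg_le {r : ℝ} (hr0 : 0 < r) (hr1 : r ≤ 1)
    {p : S → (Fin n → S) → ℝ} (h : IsChain r n p) (a : S) (hn : 1 ≤ n) {θ : Fin n → S → ℝ} {c : ℝ}
    (hc : 0 < c) (hθ : ∀ i s s', θ i s - θ i s' ≤ c) {t : ℝ} (ht : 0 ≤ t)
    (hm : t ≤ ∑ x, p a x * ∑ i, θ i (x i)) :
    ∑ x, p a x * (if ∑ i, θ i (x i) < 0 then 1 else 0) ≤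
      Real.exp (-(2 * r ^ 2 * t ^ 2 / (n * c ^ 2))) := by
  refine le_trans (Finset.sum_le_sum fun x _ => mul_le_mul_of_nonneg_left ?_ (h.nonneg a x))
    (h.sum_exp_neg_le hr0 hr1 a hn hc hθ ht hm)
  split_ifs with hx
  · refine Real.one_le_exp ?_
    have : 0 ≤ 4 * r ^ 2 * t / (n * c ^ 2) := by positivity
    nlinarith
  · exact Real.exp_nonneg _

/-- The number of visits to the label `y`. -/
def visits (x : Fin n → S) (y : S) : ℝ := ∑ i, if x i = y then 1 else 0

theorem sum_visits (x : Fin n → S) : ∑ y, visits x y = n := by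
  simp only [visits]
  rw [Finset.sum_comm]
  simp

variable {B : Type*} [DecidableEq B]

theorem blockCount_add_le (b : Fin n → B) (x : Fin n → S) {k k' : B} (hk : k ≠ k') (y : S) :
    blockCount b x k y + blockCount b x k' y ≤ visits x y := by
  simp only [blockCount, visits]
  rw [← Finset.sum_add_distrib]
  refine Finset.sum_le_sum fun i _ => ?_
  by_cases h1 : b i = k
  · simp [h1, hk]
  · simp only [h1, false_and, if_false, zero_add]
    split_ifs with h2 h3 h3
    · exact le_rfl
    · exact absurd h2.2 h3
    · norm_num
    · exact le_rfl

theorem blockCount_le_visits (b : Fin n → B) (x : Fin n → S) (k : B) (y : S) :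
    blockCount b x k y ≤ visits x y := by
  refine Finset.sum_le_sum fun i _ => ?_
  by_cases h : x i = y <;> simp [h]
  split_ifs <;> norm_num

/-- A lower bound for the advantage of assigning the label `y` to the block `σ₀ y` over assigning it
to any other block: the hits of `σ₀ y` minus all other visits to `y`. -/
def margin (b : Fin n → B) (σ₀ : S → B) (x : Fin n → S) (y : S) : ℝ :=
  2 * blockCount b x (σ₀ y) y - visits x y

/-- The classifier with label `y` on the block `σ₀ y` for `y ≠ j`, and `j` on all other blocks. -/
def absorb (σ₀ : S → B) (j : S) (k : B) : S :=
  open Classical in if h : ∃ y, y ≠ j ∧ σ₀ y = k then h.choose else j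

theorem absorb_apply {σ₀ : S → B} (hσ₀ : Function.Injective σ₀) {j y : S} (hy : y ≠ j) :
    absorb σ₀ j (σ₀ y) = y := by
  have h : ∃ z, z ≠ j ∧ σ₀ z = σ₀ y := ⟨y, hy, rfl⟩
  rw [absorb, dif_pos h]
  exact hσ₀ h.choose_spec.2

theorem absorb_of_forall_ne {σ₀ : S → B} {j : S} {k : B} (h : ∀ y, y ≠ j → σ₀ y ≠ k) :
    absorb σ₀ j k = j := by
  rw [absorb, dif_neg]
  push Not
  exact h

/-- The classifier `absorb σ₀ j` is correct on a single time for at most one of the pairs of a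
block and a label counted on the left. -/
theorem sum_blockCount_le_absorb (b : Fin n → B) (x : Fin n → S) {σ₀ : S → B}
    (hσ₀ : Function.Injective σ₀) {j : S} {k : B} (hk : ∀ y, y ≠ j → σ₀ y ≠ k) :
    ∑ y ∈ Finset.univ.erase j, blockCount b x (σ₀ y) y + blockCount b x k j ≤
      ∑ i, if x i = absorb σ₀ j (b i) then 1 else 0 := by
  simp only [blockCount]
  rw [Finset.sum_comm, ← Finset.sum_add_distrib]
  refine Finset.sum_le_sum fun i _ => ?_
  by_cases hx : x i = j
  · rw [Finset.sum_eq_zero, zero_add]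
    · by_cases hb : b i = k
      · simp [hb, absorb_of_forall_ne hk]
      · simp only [hb, false_and, if_false]
        split_ifs <;> norm_num
    · intro y hy
      rw [if_neg]
      rintro ⟨-, h⟩
      exact Finset.ne_of_mem_erase hy (h ▸ hx)
  · simp only [hx, and_false, if_false, add_zero]
    rw [Finset.sum_eq_single_of_mem (x i) (Finset.mem_erase.2 ⟨hx, Finset.mem_univ _⟩)
      (fun y _ hy => if_neg fun h => hy h.2.symm)]
    by_cases hb : b i = σ₀ (x i)
    · rw [hb, absorb_apply hσ₀ hx]
      simp
    · simp only [hb, false_and, if_false]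
      split_ifs <;> norm_num

/-- If the margins `V_y` and `V_y + V_j` are nonnegative for `y ≠ j`, then no assignment has a
larger overlap than the classifier `absorb σ₀ j`. -/
theorem hits_le_absorb (b : Fin n → B) (x : Fin n → S) {σ₀ σ : S → B}
    (hσ₀ : Function.Injective σ₀) (hσ : Function.Injective σ) {j : S}
    (h1 : ∀ y, y ≠ j → 0 ≤ margin b σ₀ x y)
    (h2 : ∀ y, y ≠ j → 0 ≤ margin b σ₀ x y + margin b σ₀ x j) :
    hits b σ x ≤ ∑ i, if x i = absorb σ₀ j (b i) then 1 else 0 := by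
  have hD : ∀ y, σ y ≠ σ₀ y →
      blockCount b x (σ y) y ≤ blockCount b x (σ₀ y) y - margin b σ₀ x y := by
    intro y hy
    have := blockCount_add_le b x hy y
    rw [margin]; linarith
  have hall : ∀ y, y ≠ j → blockCount b x (σ y) y ≤ blockCount b x (σ₀ y) y := by
    intro y hy
    by_cases h : σ y = σ₀ y
    · rw [h]
    · linarith [hD y h, h1 y hy]
  rw [hits_eq_sum_blockCount, ← Finset.sum_erase_add _ _ (Finset.mem_univ j)]
  by_cases hcase : ∃ y₁, y₁ ≠ j ∧ σ₀ y₁ = σ j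
  · -- the block of `j` is one of the other blocks `σ₀ y₁`, which `σ` then does not assign to `y₁`
    obtain ⟨y₁, hy₁, hj⟩ := hcase
    have hne1 : σ y₁ ≠ σ₀ y₁ := fun h => hy₁ (hσ (h.trans hj))
    have hne2 : σ j ≠ σ₀ j := fun h => hy₁ (hσ₀ (hj.trans h))
    have hmem : y₁ ∈ Finset.univ.erase j := Finset.mem_erase.2 ⟨hy₁, Finset.mem_univ _⟩
    refine le_trans ?_ (sum_blockCount_le_absorb b x hσ₀ (k := σ₀ j)
      (fun y hy h => hy (hσ₀ h)))
    rw [← Finset.sum_erase_add _ _ hmem, ← Finset.sum_erase_add _ _ hmem]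
    have := Finset.sum_le_sum (s := (Finset.univ.erase j).erase y₁) fun y hy =>
      hall y (Finset.ne_of_mem_erase (Finset.mem_of_mem_erase hy))
    linarith [hD y₁ hne1, hD j hne2, h2 y₁ hy₁]
  · push Not at hcase
    refine le_trans ?_ (sum_blockCount_le_absorb b x hσ₀ hcase)
    exact add_le_add_left (Finset.sum_le_sum fun y hy => hall y (Finset.ne_of_mem_erase hy)) _

theorem margin_eq_sum (b : Fin n → B) (σ₀ : S → B) (x : Fin n → S) (y : S) :
    margin b σ₀ x y = ∑ i, if x i = y then (if b i = σ₀ y then 1 else -1) else 0 := by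
  simp only [margin, blockCount, visits]
  rw [Finset.mul_sum, ← Finset.sum_sub_distrib]
  refine Finset.sum_congr rfl fun i _ => ?_
  by_cases h1 : b i = σ₀ y <;> by_cases h2 : x i = y <;> simp [h1, h2]
  norm_num

/-- If the most probable labels have average probability `1 - c`, the Gini indices are small. -/
theorem gini_le {P : (Fin n → S) → ℝ} (hP1 : ∑ x, P x = 1)
    (hS : 2 ≤ Fintype.card S) (i : Fin n) :
    ((Fintype.card S : ℝ) - 1) * (1 - ∑ s, marginal P i s ^ 2) ≤
      2 * ((Fintype.card S : ℝ) - 1) * (1 - marginalMax P i) -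
        Fintype.card S * (1 - marginalMax P i) ^ 2 := by
  have hne : Nonempty S := Fintype.card_pos_iff.1 (by omega)
  obtain ⟨s₀, hs₀⟩ : ∃ s, marginal P i s = marginalMax P i :=
    exists_eq_ciSup_of_finite (f := fun s => marginal P i s)
  have e1 : ∑ s ∈ Finset.univ.erase s₀, marginal P i s = 1 - marginalMax P i := by
    rw [eq_sub_iff_add_eq, ← hs₀, Finset.sum_erase_add _ _ (Finset.mem_univ s₀), sum_marginal, hP1]
  have h3 : (∑ s ∈ Finset.univ.erase s₀, marginal P i s) ^ 2 ≤
      ((Fintype.card S : ℝ) - 1) * ∑ s ∈ Finset.univ.erase s₀, marginal P i s ^ 2 := by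
    have := sq_sum_le_card_mul_sum_sq (s := Finset.univ.erase s₀) (f := marginal P i)
    rwa [Finset.card_erase_of_mem (Finset.mem_univ s₀), Finset.card_univ,
      Nat.cast_sub Fintype.card_pos, Nat.cast_one] at this
  rw [e1] at h3
  rw [← Finset.sum_erase_add _ _ (Finset.mem_univ s₀), hs₀]
  linarith

theorem margin_numeric {J : ℕ} (hJ : 2 ≤ J) {c : ℝ} (hc : J * c ≤ 2 / 5) :
    2 * ((J : ℝ) - 1) * c - J * c ^ 2 ≤ Real.log (J ! : ℝ) / 2 := by
  have hJ0 : (2 : ℝ) ≤ J := by exact_mod_cast hJ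
  obtain ⟨h2, h3, -⟩ := log_factorial_lower
  have key : J * (2 * ((J : ℝ) - 1) * c - J * c ^ 2) ≤ (20 * J - 24) / 25 := by
    nlinarith [mul_nonneg (sub_nonneg.2 hc) (by linarith : (0 : ℝ) ≤ 2 * (J - 1) - (J * c + 2 / 5))]
  rcases hJ.eq_or_lt with rfl | hJ3
  · norm_num at key h2 ⊢
    linarith
  · have hle : Real.log (3 ! : ℝ) ≤ Real.log (J ! : ℝ) :=
      Real.log_le_log (by positivity) (by exact_mod_cast Nat.factorial_le hJ3)
    refine le_of_mul_le_mul_left ?_ (show (0 : ℝ) < J by linarith)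
    have := mul_le_mul_of_nonneg_left (h3.trans hle) (show (0 : ℝ) ≤ J by linarith)
    linarith

/-- The bound on the expected overlap with a multiplicative error: it improves on
`IsChain.sum_hits_le` when the labels are easy to predict, provided that no two labels are rare. -/
theorem IsChain.sum_hits_le_of_visits {r : ℝ} (hr0 : 0 < r) (hr1 : r ≤ 1)
    {p : S → (Fin n → S) → ℝ} (h : IsChain r n p) (a : S) (b : Fin n → Fin N)
    (hN : Fintype.card S ≤ N) (hS : 2 ≤ Fintype.card S) (hn : 1 ≤ n)
    {σ : (Fin n → S) → S → Fin N} (hσ : ∀ x, Function.Injective (σ x)) {β T : ℝ} (hβ : 0 < β)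
    (hβJ : Fintype.card S * β ≤ 2)
    (hT : T = 1 / r * √(n * (Real.log ((Fintype.card S)! : ℝ) / 2))) (hTβ : 5 * T ≤ β * n)
    (hvis : ∀ j k, j ≠ k → 4 / 5 * β * n ≤ ∑ x, p a x * (visits x j + visits x k)) :
    ∑ x, p a x * hits b (σ x) x ≤
      n - (1 - 5 * T / (β * n)) * (n - ∑ i, marginalMax (p a) i) +
        n * (2 * ((Fintype.card S : ℝ) - 1) * Real.exp (-(2 * n * r ^ 2 * β ^ 2 / 25))) := by
  have hp0 := h.nonneg a
  have hp1 := h.sum_eq_one a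
  set J : ℝ := (Fintype.card S : ℝ) with hJdef
  have hJ2 : (2 : ℝ) ≤ J := by rw [hJdef]; exact_mod_cast hS
  set m := marginalMax (p a) with hm
  set M := ∑ i, m i with hM
  set L := Real.log ((Fintype.card S)! : ℝ) with hL
  have hL0 : 0 ≤ L := Real.log_nonneg (by exact_mod_cast Nat.factorial_pos _)
  have hn0 : (0 : ℝ) < n := by exact_mod_cast hn
  have hT0 : 0 ≤ T := by rw [hT]; positivity
  set η := Real.exp (-(2 * n * r ^ 2 * β ^ 2 / 25)) with hη
  have hη0 : 0 ≤ η := Real.exp_nonneg _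
  have hηnn : 0 ≤ n * (2 * (J - 1) * η) :=
    mul_nonneg hn0.le (mul_nonneg (by linarith) hη0)
  have hm1 : ∀ i, m i ≤ 1 := fun i => by
    refine Real.iSup_le (fun s => ?_) zero_le_one
    rw [← hp1, ← sum_marginal (p a) i]
    exact Finset.single_le_sum (f := fun s => marginal (p a) i s)
      (fun s _ => marginal_nonneg hp0 i s) (Finset.mem_univ s)
  have hMn : M ≤ n := by
    calc M ≤ ∑ i : Fin n, (1 : ℝ) := Finset.sum_le_sum fun i _ => hm1 i
      _ = n := by simp
  have hβn : 0 < β * n := mul_pos hβ hn0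
  have hξ : 5 * T / (β * n) ≤ 1 := (div_le_one hβn).2 hTβ
  have hξ0 : 0 ≤ 5 * T / (β * n) := by positivity
  rcases le_total (β * n) (5 * (n - M)) with hc | hc
  · have h1 := h.sum_hits_le hr0 hr1 a b hN hS hn hσ
    rw [← hT] at h1
    have h2 : T ≤ 5 * T / (β * n) * (n - M) := by
      rw [div_mul_eq_mul_div, le_div_iff₀ hβn]
      nlinarith
    linarith
  have h5 : 5 * T / (β * n) * (n - M) ≤ T := by
    rw [div_mul_eq_mul_div, div_le_iff₀ hβn]
    nlinarith
  -- an optimal deterministic assignment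
  have hemb : Nonempty (S ↪ Fin N) := by
    refine Function.Embedding.nonempty_of_card_le ?_
    rwa [Fintype.card_fin]
  obtain ⟨σ₀, hσ₀⟩ := Finite.exists_max fun ρ : S ↪ Fin N => ∑ z, p a z * hits b ρ z
  set μ := ∑ z, p a z * hits b σ₀ z with hμ
  have hvar : ∑ x, p a x * hits b (σ x) x ≤ μ + T := by
    refine (h.sum_hits_le_variance hr0 hr1 a b hσ).trans (add_le_add ?_ ?_)
    · calc ∑ x, p a x * ∑ z, p a z * hits b (σ x) z ≤ ∑ x, p a x * μ :=
            Finset.sum_le_sum fun x _ => mul_le_mul_of_nonneg_left (hσ₀ ⟨σ x, hσ x⟩) (hp0 x)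
        _ = μ := by rw [← Finset.sum_mul, hp1, one_mul]
    · rw [hT]
      refine mul_le_mul ?_ (Real.sqrt_le_sqrt ?_) (Real.sqrt_nonneg _) (by positivity)
      · rw [div_le_div_iff₀ (by positivity) hr0]
        nlinarith
      · have h1 : (∑ i, (1 - m i)) ^ 2 ≤ n * ∑ i, (1 - m i) ^ 2 := by
          have := sq_sum_le_card_mul_sum_sq (s := (Finset.univ : Finset (Fin n)))
            (f := fun i => 1 - m i)
          simpa using this
        have h2 : ∑ i, (1 - m i) = n - M := by simp [hM]
        rw [h2] at h1
        have h3 : (J - 1) * ∑ i, (1 - ∑ s, marginal (p a) i s ^ 2) ≤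
            2 * (J - 1) * (n - M) - J * ∑ i, (1 - m i) ^ 2 := by
          rw [← h2, Finset.mul_sum, Finset.mul_sum, Finset.mul_sum, ← Finset.sum_sub_distrib]
          exact Finset.sum_le_sum fun i _ => gini_le hp1 hS i
        have h4 := margin_numeric hS (c := (n - M) / n) (by
          rw [← mul_div_assoc, div_le_iff₀ hn0]
          nlinarith)
        have h6 : (n : ℝ) * (2 * (J - 1) * ((n - M) / n) - J * ((n - M) / n) ^ 2) ≤ n * (L / 2) :=
          mul_le_mul_of_nonneg_left h4 hn0.le
        have h7 : (n : ℝ) * (2 * (J - 1) * ((n - M) / n) - J * ((n - M) / n) ^ 2) =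
            2 * (J - 1) * (n - M) - J * ((n - M) ^ 2 / n) := by
          field_simp
        have h8 : (n - M) ^ 2 / n ≤ ∑ i, (1 - m i) ^ 2 := by
          rw [div_le_iff₀ hn0]; linarith
        have h9 := mul_le_mul_of_nonneg_left h8 (show 0 ≤ J by linarith)
        linarith
  rcases le_total μ (n - β * n / 5) with he | he
  · have h6 : 0 ≤ (1 - 5 * T / (β * n)) * (β * n / 5 - (n - M)) :=
      mul_nonneg (by linarith) (by linarith)
    have h7 : (1 - 5 * T / (β * n)) * (β * n / 5) = β * n / 5 - T := by
      field_simp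
    linarith
  -- the margins have a positive mean, except possibly for one label `j`
  have : Nonempty S := ⟨a⟩
  obtain ⟨j, hj⟩ := Finite.exists_min fun y => ∑ x, p a x * margin b σ₀ x y
  have hmean2 : ∀ y z, y ≠ z → 2 * (β * n / 5) ≤
      ∑ x, p a x * margin b σ₀ x y + ∑ x, p a x * margin b σ₀ x z := by
    intro y z hyz
    have h1 : ∀ x, visits x y + visits x z - 2 * (n - hits b σ₀ x) ≤
        margin b σ₀ x y + margin b σ₀ x z := by
      intro x
      have h2 : (n : ℝ) - hits b σ₀ x = ∑ s, (visits x s - blockCount b x (σ₀ s) s) := by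
        rw [Finset.sum_sub_distrib, sum_visits, hits_eq_sum_blockCount]
      have h3 : (visits x y - blockCount b x (σ₀ y) y) + (visits x z - blockCount b x (σ₀ z) z) ≤
          ∑ s, (visits x s - blockCount b x (σ₀ s) s) := by
        rw [← Finset.sum_pair (f := fun s => visits x s - blockCount b x (σ₀ s) s) hyz]
        exact Finset.sum_le_sum_of_subset_of_nonneg (Finset.subset_univ _)
          fun s _ _ => sub_nonneg.2 (blockCount_le_visits b x _ s)
      rw [margin, margin]
      linarith
    have h2 := Finset.sum_le_sum fun x (_ : x ∈ Finset.univ) =>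
      mul_le_mul_of_nonneg_left (h1 x) (hp0 x)
    have h3 := hvis y z hyz
    have e : ∀ x, p a x * (visits x y + visits x z - 2 * (n - hits b σ₀ x)) =
        p a x * (visits x y + visits x z) - p a x * (2 * n) + 2 * (p a x * hits b σ₀ x) :=
      fun x => by ring
    simp only [e, Finset.sum_add_distrib, Finset.sum_sub_distrib, ← Finset.sum_mul, hp1,
      ← Finset.mul_sum, mul_add] at h2 h3
    linarith
  have hmean1 : ∀ y, y ≠ j → β * n / 5 ≤ ∑ x, p a x * margin b σ₀ x y := by
    intro y hy
    have := hmean2 y j hy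
    have := hj y
    linarith
  have hηeq1 : Real.exp (-(2 * r ^ 2 * (β * n / 5) ^ 2 / (n * 1 ^ 2))) = η := by
    rw [hη]; congr 2; field_simp; ring
  have hηeq2 : Real.exp (-(2 * r ^ 2 * (2 * (β * n / 5)) ^ 2 / (n * 2 ^ 2))) = η := by
    rw [hη]; congr 2; field_simp; ring
  have hprob1 : ∀ y, y ≠ j →
      ∑ x, p a x * (if margin b σ₀ x y < 0 then 1 else 0) ≤ η := by
    intro y hy
    rw [← hηeq1]
    simp only [margin_eq_sum]
    have := h.prob_neg_le hr0 hr1 a hn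
      (θ := fun i s => if s = y then (if b i = σ₀ y then 1 else -1) else 0) one_pos
      (fun i s s' => by
        by_cases hb : b i = σ₀ y
        · simp only [hb, if_true]; split_ifs <;> norm_num
        · simp only [hb, if_false]; split_ifs <;> norm_num)
      (t := β * n / 5) (by positivity) (by
        have := hmean1 y hy
        simpa only [margin_eq_sum] using this)
    exact this
  have hprob2 : ∀ y, y ≠ j →
      ∑ x, p a x * (if margin b σ₀ x y + margin b σ₀ x j < 0 then 1 else 0) ≤ η := by
    intro y hy
    rw [← hηeq2]
    have e : ∀ x, margin b σ₀ x y + margin b σ₀ x j =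
        ∑ i, ((if x i = y then (if b i = σ₀ y then (1 : ℝ) else -1) else 0) +
          (if x i = j then (if b i = σ₀ j then 1 else -1) else 0)) := fun x => by
      rw [margin_eq_sum, margin_eq_sum, Finset.sum_add_distrib]
    have hm2 : 2 * (β * n / 5) ≤ ∑ x, p a x * (margin b σ₀ x y + margin b σ₀ x j) := by
      simp only [mul_add, Finset.sum_add_distrib]
      have := hmean2 y j hy
      linarith
    simp only [e] at hm2 ⊢
    refine h.prob_neg_le hr0 hr1 a hn
      (θ := fun i s => (if s = y then (if b i = σ₀ y then (1 : ℝ) else -1) else 0) +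
          (if s = j then (if b i = σ₀ j then 1 else -1) else 0)) two_pos
      (fun i s s' => ?_) (t := 2 * (β * n / 5)) (by positivity) hm2
    have hb : ∀ s, |(if s = y then (if b i = σ₀ y then (1 : ℝ) else -1) else 0) +
          (if s = j then (if b i = σ₀ j then 1 else -1) else 0)| ≤ 1 := by
      intro s
      by_cases h1 : s = y
      · have h2 : s ≠ j := fun h2 => hy (h1 ▸ h2)
        simp only [h1, if_true, hy, if_false, add_zero]
        split_ifs <;> norm_num
      · simp only [h1, if_false, zero_add]
        split_ifs <;> norm_num
    have h1 := abs_le.1 (hb s)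
    have h2 := abs_le.1 (hb s')
    linarith
  -- outside the exceptional events the classifier `absorb σ₀ j` is at least as good
  have hpt : ∀ x, hits b (σ x) x ≤ (∑ i, if x i = absorb σ₀ j (b i) then (1 : ℝ) else 0) +
      n * ∑ y ∈ Finset.univ.erase j, ((if margin b σ₀ x y < 0 then 1 else 0) +
        (if margin b σ₀ x y + margin b σ₀ x j < 0 then 1 else 0)) := by
    intro x
    have hle : hits b (σ x) x ≤ n := by
      calc hits b (σ x) x ≤ ∑ i : Fin n, (1 : ℝ) :=
            Finset.sum_le_sum fun i _ => by split_ifs <;> norm_num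
        _ = n := by simp
    have hI0 : ∀ y, (0 : ℝ) ≤ (if margin b σ₀ x y < 0 then 1 else 0) +
        (if margin b σ₀ x y + margin b σ₀ x j < 0 then 1 else 0) := fun y => by
      split_ifs <;> norm_num
    have hc0 : (0 : ℝ) ≤ ∑ i, if x i = absorb σ₀ j (b i) then (1 : ℝ) else 0 :=
      Finset.sum_nonneg fun i _ => by split_ifs <;> norm_num
    by_cases hbad : ∃ y, y ≠ j ∧ (margin b σ₀ x y < 0 ∨ margin b σ₀ x y + margin b σ₀ x j < 0)
    · obtain ⟨y, hy, hor⟩ := hbad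
      have h1 : (1 : ℝ) ≤ ∑ y ∈ Finset.univ.erase j, ((if margin b σ₀ x y < 0 then (1 : ℝ) else 0) +
          (if margin b σ₀ x y + margin b σ₀ x j < 0 then 1 else 0)) := by
        refine le_trans ?_ (Finset.single_le_sum (f := fun y =>
          ((if margin b σ₀ x y < 0 then (1 : ℝ) else 0) +
          (if margin b σ₀ x y + margin b σ₀ x j < 0 then 1 else 0)))
          (fun y _ => hI0 y) (Finset.mem_erase.2 ⟨hy, Finset.mem_univ y⟩))
        rcases hor with h1 | h1
        · simp only [h1, if_true]; split_ifs <;> norm_num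
        · simp only [h1, if_true]; split_ifs <;> norm_num
      have := mul_le_mul_of_nonneg_left h1 hn0.le
      linarith
    · push Not at hbad
      have h1 := hits_le_absorb b x σ₀.injective (hσ x) (j := j) (fun y hy => (hbad y hy).1)
        (fun y hy => (hbad y hy).2)
      have h2 : (0 : ℝ) ≤ n * ∑ y ∈ Finset.univ.erase j,
          ((if margin b σ₀ x y < 0 then (1 : ℝ) else 0) +
          (if margin b σ₀ x y + margin b σ₀ x j < 0 then 1 else 0)) :=
        mul_nonneg hn0.le (Finset.sum_nonneg fun y _ => hI0 y)
      linarith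
  have hclass : ∑ x, p a x * (∑ i, if x i = absorb σ₀ j (b i) then (1 : ℝ) else 0) ≤ M := by
    simp only [Finset.mul_sum]
    rw [Finset.sum_comm]
    refine Finset.sum_le_sum fun i _ => ?_
    refine le_trans (le_of_eq ?_) (marginal_le_max (p a) i (absorb σ₀ j (b i)))
    rw [marginal]
    exact Finset.sum_congr rfl fun x _ => by simp
  have hsum := Finset.sum_le_sum fun x (_ : x ∈ Finset.univ) =>
    mul_le_mul_of_nonneg_left (hpt x) (hp0 x)
  have hbadsum : ∑ x, p a x * (n * ∑ y ∈ Finset.univ.erase j,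
      ((if margin b σ₀ x y < 0 then (1 : ℝ) else 0) +
        (if margin b σ₀ x y + margin b σ₀ x j < 0 then 1 else 0))) ≤ n * (2 * (J - 1) * η) := by
    calc ∑ x, p a x * (n * ∑ y ∈ Finset.univ.erase j,
      ((if margin b σ₀ x y < 0 then (1 : ℝ) else 0) +
        (if margin b σ₀ x y + margin b σ₀ x j < 0 then 1 else 0)))
        = n * ∑ y ∈ Finset.univ.erase j, (∑ x, p a x * (if margin b σ₀ x y < 0 then 1 else 0) +
            ∑ x, p a x * (if margin b σ₀ x y + margin b σ₀ x j < 0 then 1 else 0)) := by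
          simp only [← Finset.sum_add_distrib, ← mul_add]
          rw [Finset.sum_comm, Finset.mul_sum]
          refine Finset.sum_congr rfl fun x _ => ?_
          rw [← Finset.mul_sum]
          ring
      _ ≤ n * ∑ y ∈ Finset.univ.erase j, (η + η) :=
          mul_le_mul_of_nonneg_left (Finset.sum_le_sum fun y hy =>
            add_le_add (hprob1 y (Finset.ne_of_mem_erase hy))
              (hprob2 y (Finset.ne_of_mem_erase hy))) hn0.le
      _ = _ := by
          rw [Finset.sum_const, Finset.card_erase_of_mem (Finset.mem_univ j), Finset.card_univ,
            nsmul_eq_mul, Nat.cast_sub Fintype.card_pos, Nat.cast_one]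
          ring
  simp only [mul_add (p a _), Finset.sum_add_distrib] at hsum hbadsum
  have hfin : 0 ≤ 5 * T / (β * n) * (n - M) := mul_nonneg hξ0 (by linarith)
  linarith

end Predictable

/-! ### Densities of the hidden Markov model -/

/-- A product of measures with densities has the product density. -/
theorem pi_withDensity {Y : Type*} [MeasurableSpace Y] (μ : Measure Y) [IsFiniteMeasure μ]
    {n : ℕ} {k : Fin n → Y → ℝ≥0} (hk : ∀ i, Measurable (k i)) (hk1 : ∀ i y, k i y ≤ 1) :
    Measure.pi (fun i => μ.withDensity fun y => (k i y : ℝ≥0∞)) =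
      (Measure.pi fun _ => μ).withDensity fun y => ((∏ i, k i (y i) : ℝ≥0) : ℝ≥0∞) := by
  have hint : ∀ i (s : Set Y), Integrable (fun y => (k i y : ℝ)) (μ.restrict s) := fun i s =>
    Integrable.of_bound (hk i).coe_nnreal_real.aestronglyMeasurable 1
      (Filter.Eventually.of_forall fun y => by
        rw [Real.norm_of_nonneg (k i y).coe_nonneg]; exact_mod_cast hk1 i y)
  have hfin : ∀ i, IsFiniteMeasure (μ.withDensity fun y => (k i y : ℝ≥0∞)) := fun i => by
    refine isFiniteMeasure_withDensity (ne_top_of_le_ne_top (measure_ne_top μ Set.univ) ?_)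
    calc ∫⁻ y, (k i y : ℝ≥0∞) ∂μ ≤ ∫⁻ _, 1 ∂μ :=
          lintegral_mono fun y => ENNReal.coe_le_one_iff.2 (hk1 i y)
      _ = μ Set.univ := lintegral_one
  have hlin : ∀ i (s : Set Y), ENNReal.ofReal (∫ y in s, (k i y : ℝ) ∂μ) =
      ∫⁻ y in s, (k i y : ℝ≥0∞) ∂μ := fun i s => by
    rw [ofReal_integral_eq_lintegral_ofReal (hint i s)
      (Filter.Eventually.of_forall fun y => (k i y).coe_nonneg)]
    simp only [ENNReal.ofReal_coe_nnreal]
  refine Measure.pi_eq fun s hs => ?_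
  rw [withDensity_apply _ (MeasurableSet.univ_pi hs), Measure.restrict_pi_pi]
  have hprod : Integrable (fun y : Fin n → Y => ∏ i, (k i (y i) : ℝ))
      (Measure.pi fun i => μ.restrict (s i)) :=
    Integrable.fintype_prod (f := fun i y => (k i y : ℝ)) fun i => hint i (s i)
  calc ∫⁻ y, ((∏ i, k i (y i) : ℝ≥0) : ℝ≥0∞) ∂(Measure.pi fun i => μ.restrict (s i))
      = ENNReal.ofReal (∫ y, ∏ i, (k i (y i) : ℝ) ∂(Measure.pi fun i => μ.restrict (s i))) := by
        rw [ofReal_integral_eq_lintegral_ofReal hprod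
          (Filter.Eventually.of_forall fun y => Finset.prod_nonneg fun i _ => (k i _).coe_nonneg)]
        simp only [← NNReal.coe_prod, ENNReal.ofReal_coe_nnreal]
    _ = ENNReal.ofReal (∏ i, ∫ y in s i, (k i y : ℝ) ∂μ) := by
        rw [integral_fintype_prod_eq_prod (fun i y => (k i y : ℝ))]
    _ = ∏ i, (μ.withDensity fun y => (k i y : ℝ≥0∞)) (s i) := by
        rw [ENNReal.ofReal_prod_of_nonneg fun i _ =>
          integral_nonneg fun y => (k i y).coe_nonneg]
        exact Finset.prod_congr rfl fun i _ => by
          rw [hlin, withDensity_apply _ (hs i)]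

section Model

variable {J : ℕ} {𝕐 : Type*} [MeasurableSpace 𝕐] {L : Measure 𝕐} (θ : Param J L)

instance emission_isProbabilityMeasure (x : Fin J) : IsProbabilityMeasure (θ.emission x) :=
  ⟨by rw [Param.emission, withDensity_apply _ MeasurableSet.univ, Measure.restrict_univ,
    θ.f_lintegral]⟩

/-- The sum of the emission distributions, a finite measure dominating all of them. -/
def totalEmission : Measure 𝕐 := ∑ x, θ.emission x

instance totalEmission_isFiniteMeasure : IsFiniteMeasure (totalEmission θ) := by
  rw [totalEmission]; infer_instance

/-- The density of the emission distribution of `x` with respect to the sum of all emission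
distributions. Where all densities vanish it is `0 / 0 = 0`. -/
def relDensity (x : Fin J) (y : 𝕐) : ℝ≥0 := θ.f x y / ∑ z, θ.f z y

theorem relDensity_le_one (x : Fin J) (y : 𝕐) : relDensity θ x y ≤ 1 := by
  refine div_le_one_of_le₀ ?_ (zero_le)
  exact Finset.single_le_sum (f := fun z => θ.f z y) (fun z _ => zero_le) (Finset.mem_univ x)

theorem measurable_relDensity (x : Fin J) : Measurable (relDensity θ x) :=
  (θ.f_measurable x).div (Finset.measurable_fun_sum _ fun z _ => θ.f_measurable z)

theorem emission_eq_withDensity (x : Fin J) :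
    θ.emission x = (totalEmission θ).withDensity fun y => (relDensity θ x y : ℝ≥0∞) := by
  have h1 : totalEmission θ = L.withDensity fun y => ((∑ z, θ.f z y : ℝ≥0) : ℝ≥0∞) := by
    ext s hs
    simp only [totalEmission, Measure.coe_finsetSum, Finset.sum_apply, Param.emission]
    rw [withDensity_apply _ hs]
    simp only [withDensity_apply _ hs, ENNReal.ofNNReal_finsetSum]
    rw [lintegral_finsetSum _ fun z _ => (θ.f_measurable z).coe_nnreal_ennreal]
  rw [h1, ← withDensity_mul L (Finset.measurable_fun_sum _ fun z _ =>
    θ.f_measurable z).coe_nnreal_ennreal (measurable_relDensity θ x).coe_nnreal_ennreal,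
    Param.emission]
  congr 1
  funext y
  rw [Pi.mul_apply, ← ENNReal.coe_mul]
  congr 1
  rw [relDensity]
  by_cases h : ∑ z, θ.f z y = 0
  · have := (Finset.sum_eq_zero_iff_of_nonneg fun z _ => zero_le).1 h x
      (Finset.mem_univ x)
    simp [this]
  · rw [mul_div_cancel₀ _ h]

variable {n : ℕ}

/-- The density of the law of the observations at `y` on the event that the path is `x`. -/
def pathDensity (y : Fin n → 𝕐) (x : Fin n → Fin J) : ℝ :=
  θ.pathProb x * ∏ i, (relDensity θ (x i) (y i) : ℝ)

theorem pathProb_nonneg (x : Fin n → Fin J) : 0 ≤ θ.pathProb x :=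
  Finset.prod_nonneg fun i _ => by
    split_ifs
    exacts [(θ.ν_nonneg _), θ.Q_nonneg _ _]

theorem pathDensity_nonneg (y : Fin n → 𝕐) (x : Fin n → Fin J) : 0 ≤ pathDensity θ y x :=
  mul_nonneg (pathProb_nonneg θ x) (Finset.prod_nonneg fun _ _ => NNReal.coe_nonneg _)

theorem measurable_pathDensity (x : Fin n → Fin J) :
    Measurable fun y : Fin n → 𝕐 => pathDensity θ y x :=
  (Finset.measurable_fun_prod _ fun i _ => ((measurable_relDensity θ (x i)).comp
    (measurable_pi_apply i)).coe_nnreal_real).const_mul _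

/-- The one-step weights of the chain before time `i`: the initial distribution at time `0`, the
transition matrix afterwards. -/
def stepProb (i : Fin n) (a b : Fin J) : ℝ := if (i : ℕ) = 0 then θ.ν b else θ.Q a b

theorem pathProb_eq_pathWeight (a : Fin J) (x : Fin n → Fin J) :
    θ.pathProb x = pathWeight (stepProb θ) a x := by
  refine Finset.prod_congr rfl fun i _ => ?_
  cases n with
  | zero => exact i.elim0
  | succ n =>
    cases i using Fin.cases with
    | zero => simp [stepProb]
    | succ i =>
      simp only [stepProb, Fin.val_succ, Nat.succ_ne_zero, if_false, ← Fin.succ_castSucc,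
        Fin.cons_succ]
      rfl

theorem pathDensity_eq_pathWeight (a : Fin J) (y : Fin n → 𝕐) (x : Fin n → Fin J) :
    pathDensity θ y x = pathWeight (fun i a b => stepProb θ i a b * relDensity θ b (y i)) a x := by
  rw [pathDensity, pathProb_eq_pathWeight θ a, pathWeight, pathWeight, Finset.prod_mul_distrib]

theorem stepProb_nonneg (i : Fin n) (a b : Fin J) : 0 ≤ stepProb θ i a b := by
  rw [stepProb]
  split_ifs
  exacts [θ.ν_nonneg _, θ.Q_nonneg _ _]

theorem sum_stepProb (i : Fin n) (a : Fin J) : ∑ b, stepProb θ i a b = 1 := by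
  simp only [stepProb]
  split_ifs
  exacts [θ.ν_sum, θ.Q_sum a]

theorem sum_pathWeight_eq_one {S : Type*} [Fintype S] : ∀ {n : ℕ} {q : Fin n → S → S → ℝ},
    (∀ i a, ∑ b, q i a b = 1) → ∀ a, ∑ x, pathWeight q a x = 1
  | 0, q, _, a => by simp [pathWeight]
  | n + 1, q, hq, a => by
    rw [sum_fin_succ_fun]
    simp only [pathWeight_cons, ← Finset.mul_sum]
    rw [← hq 0 a]
    refine Finset.sum_congr rfl fun b _ => ?_
    rw [sum_pathWeight_eq_one (fun i => hq i.succ), mul_one]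

theorem sum_pathProb (hJ : 0 < J) : ∑ x : Fin n → Fin J, θ.pathProb x = 1 := by
  simp only [pathProb_eq_pathWeight θ ⟨0, hJ⟩]
  exact sum_pathWeight_eq_one (sum_stepProb θ) _

theorem law_isProbabilityMeasure (hJ : 0 < J) : IsProbabilityMeasure (θ.law n) := by
  constructor
  simp only [Param.law, Measure.coe_finsetSum, Finset.sum_apply, Measure.smul_apply,
    measure_univ, smul_eq_mul, mul_one]
  rw [← ENNReal.ofReal_sum_of_nonneg fun x _ => pathProb_nonneg θ x, sum_pathProb θ hJ,
    ENNReal.ofReal_one]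

theorem pi_emission_eq (x : Fin n → Fin J) :
    Measure.pi (fun i => θ.emission (x i)) = (Measure.pi fun _ => totalEmission θ).withDensity
      fun y => ((∏ i, relDensity θ (x i) (y i) : ℝ≥0) : ℝ≥0∞) := by
  rw [← pi_withDensity _ (fun i => measurable_relDensity θ (x i))
    (fun i => relDensity_le_one θ (x i))]
  simp only [emission_eq_withDensity]

/-- Integrals with respect to the joint law, in terms of the densities. -/
theorem integral_law {F : (Fin n → Fin J) × (Fin n → 𝕐) → ℝ}
    (hF : ∀ x, Measurable fun y => F (x, y)) {C : ℝ} (hC : ∀ ω, |F ω| ≤ C) :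
    Integrable (fun y => ∑ x, pathDensity θ y x * F (x, y)) (Measure.pi fun _ => totalEmission θ) ∧
      ∫ ω, F ω ∂(θ.law n) =
        ∫ y, ∑ x, pathDensity θ y x * F (x, y) ∂(Measure.pi fun _ => totalEmission θ) := by
  have hFm : Measurable F := measurable_from_prod_countable_right hF
  have hkm : ∀ x : Fin n → Fin J, Measurable fun y : Fin n → 𝕐 => ∏ i, relDensity θ (x i) (y i) :=
    fun x => Finset.measurable_fun_prod _ fun i _ =>
      (measurable_relDensity θ (x i)).comp (measurable_pi_apply i)
  have hint : ∀ x, Integrable (fun y => F (x, y)) (Measure.pi fun i => θ.emission (x i)) :=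
    fun x => Integrable.of_bound (hF x).aestronglyMeasurable C
      (Filter.Eventually.of_forall fun y => hC (x, y))
  have hint' : ∀ x, Integrable (fun y => pathDensity θ y x * F (x, y))
      (Measure.pi fun _ => totalEmission θ) := by
    intro x
    have h1 := hint x
    rw [pi_emission_eq, integrable_withDensity_iff_integrable_smul (hkm x)] at h1
    refine (h1.const_mul (θ.pathProb x)).congr (Filter.Eventually.of_forall fun y => ?_)
    simp [pathDensity, NNReal.smul_def, mul_assoc]
  refine ⟨integrable_finsetSum _ fun x _ => hint' x, ?_⟩
  rw [integral_finsetSum _ fun x _ => hint' x, Param.law, integral_finsetSum_measure]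
  · refine Finset.sum_congr rfl fun x _ => ?_
    rw [integral_smul_measure, Measure.dirac_prod,
      integral_map measurable_prodMk_left.aemeasurable hFm.aestronglyMeasurable,
      pi_emission_eq, integral_withDensity_eq_integral_smul (hkm x),
      ENNReal.toReal_ofReal (pathProb_nonneg θ x), smul_eq_mul, ← integral_const_mul]
    refine integral_congr_ae (Filter.Eventually.of_forall fun y => ?_)
    simp [pathDensity, NNReal.smul_def, mul_assoc]
  · intro x _
    refine Integrable.smul_measure ?_ ENNReal.ofReal_ne_top
    exact Integrable.of_bound hFm.aestronglyMeasurable C (Filter.Eventually.of_forall hC)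

theorem integral_law_mono {F G : (Fin n → Fin J) × (Fin n → 𝕐) → ℝ}
    (hF : ∀ x, Measurable fun y => F (x, y)) {C : ℝ} (hC : ∀ ω, |F ω| ≤ C)
    (hG : ∀ x, Measurable fun y => G (x, y)) {D : ℝ} (hD : ∀ ω, |G ω| ≤ D)
    (h : ∀ y, ∑ x, pathDensity θ y x * F (x, y) ≤ ∑ x, pathDensity θ y x * G (x, y)) :
    ∫ ω, F ω ∂(θ.law n) ≤ ∫ ω, G ω ∂(θ.law n) := by
  obtain ⟨hF1, hF2⟩ := integral_law θ hF hC
  obtain ⟨hG1, hG2⟩ := integral_law θ hG hD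
  rw [hF2, hG2]
  exact integral_mono hF1 hG1 h

theorem integral_law_path (G : (Fin n → Fin J) → ℝ) :
    ∫ ω, G ω.1 ∂(θ.law n) = ∑ x, θ.pathProb x * G x := by
  have hG : Measurable fun ω : (Fin n → Fin J) × (Fin n → 𝕐) => G ω.1 :=
    Measurable.of_discrete.comp measurable_fst
  rw [Param.law, integral_finsetSum_measure]
  · refine Finset.sum_congr rfl fun x _ => ?_
    rw [integral_smul_measure, Measure.dirac_prod,
      integral_map measurable_prodMk_left.aemeasurable hG.aestronglyMeasurable,
      ENNReal.toReal_ofReal (pathProb_nonneg θ x), smul_eq_mul]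
    simp
  · intro x _
    refine Integrable.smul_measure ?_ ENNReal.ofReal_ne_top
    exact Integrable.of_bound hG.aestronglyMeasurable (∑ x, |G x|)
      (Filter.Eventually.of_forall fun ω =>
        Finset.single_le_sum (f := fun x => |G x|) (fun x _ => abs_nonneg _)
          (Finset.mem_univ ω.1))

/-! ### Consequences of the mixing assumption -/

/-- The mixing rate `δ / (1 - (J - 1) δ) = 1 - ρ₀`. -/
theorem rate_bounds (hJ : 2 ≤ J) (hmix : θ.IsMixing) :
    0 < 1 - θ.rho0 ∧ 1 - θ.rho0 ≤ 1 ∧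
      (1 - θ.rho0) * (1 - ((J : ℝ) - 1) * θ.delta) = θ.delta := by
  have hQ : ∀ x x', θ.delta ≤ θ.Q x x' := fun x x' =>
    ciInf_le (f := fun p : Fin J × Fin J => θ.Q p.1 p.2) (Set.finite_range _).bddBelow (x, x')
  have hδ := hmix.1
  have hJδ : J * θ.delta ≤ 1 := by
    have := Finset.sum_le_sum fun x (_ : x ∈ Finset.univ) => hQ ⟨0, by omega⟩ x
    rw [θ.Q_sum] at this
    simpa using this
  have hD : 0 < 1 - ((J : ℝ) - 1) * θ.delta := by linarith
  have e : 1 - θ.rho0 = θ.delta / (1 - ((J : ℝ) - 1) * θ.delta) := by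
    rw [Param.rho0, one_sub_div hD.ne']
    congr 1
    ring
  rw [e]
  exact ⟨div_pos hδ hD, (div_le_one hD).2 (by linarith), div_mul_cancel₀ _ hD.ne'⟩

theorem delta_le_stepProb (hmix : θ.IsMixing) (i : Fin n) (a b : Fin J) :
    θ.delta ≤ stepProb θ i a b := by
  rw [stepProb]
  split_ifs
  · exact hmix.2 b
  · exact ciInf_le (f := fun p : Fin J × Fin J => θ.Q p.1 p.2) (Set.finite_range _).bddBelow (a, b)

/-- The entries of a kernel lie between `δ` and `1 - (J - 1) δ = δ / r`. -/
theorem stepProb_cross (hJ : 2 ≤ J) (hmix : θ.IsMixing) (i : Fin n) (a a' b b' : Fin J) :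
    (1 - θ.rho0) ^ 2 * (stepProb θ i a b * stepProb θ i a' b') ≤
      stepProb θ i a' b * stepProb θ i a b' := by
  obtain ⟨hr0, hr1, hr⟩ := rate_bounds θ hJ hmix
  set r := 1 - θ.rho0
  have hδ := hmix.1
  have hlow : ∀ a b, θ.delta ≤ stepProb θ i a b := delta_le_stepProb θ hmix i
  have hup : ∀ a b, r * stepProb θ i a b ≤ θ.delta := by
    intro a b
    have h1 := sum_stepProb θ i a
    rw [← Finset.add_sum_erase _ _ (Finset.mem_univ b)] at h1
    have h2 := Finset.sum_le_sum fun x (_ : x ∈ Finset.univ.erase b) => hlow a x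
    rw [Finset.sum_const, Finset.card_erase_of_mem (Finset.mem_univ b), Finset.card_univ,
      Fintype.card_fin, nsmul_eq_mul, Nat.cast_sub (by omega), Nat.cast_one] at h2
    calc r * stepProb θ i a b ≤ r * (1 - ((J : ℝ) - 1) * θ.delta) :=
          mul_le_mul_of_nonneg_left (by linarith) hr0.le
      _ = θ.delta := hr
  calc r ^ 2 * (stepProb θ i a b * stepProb θ i a' b')
      = (r * stepProb θ i a b) * (r * stepProb θ i a' b') := by ring
    _ ≤ θ.delta * θ.delta := mul_le_mul (hup _ _) (hup _ _)
        (mul_nonneg hr0.le (stepProb_nonneg θ _ _ _)) hδ.le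
    _ ≤ _ := mul_le_mul (hlow _ _) (hlow _ _) hδ.le (stepProb_nonneg θ _ _ _)

theorem stepProb_pos (hmix : θ.IsMixing) (i : Fin n) (a b : Fin J) : 0 < stepProb θ i a b :=
  hmix.1.trans_le (delta_le_stepProb θ hmix i a b)

/-- The law of the path of the hidden states is a chain. -/
theorem isChain_prior (hJ : 2 ≤ J) (hmix : θ.IsMixing) :
    ∃ p : Fin J → (Fin n → Fin J) → ℝ, IsChain (1 - θ.rho0) n p ∧ ∀ a x, p a x = θ.pathProb x := by
  refine ⟨_, isChain_pathWeight (rate_bounds θ hJ hmix).2.1 (q := stepProb θ) (stepProb_nonneg θ)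
    (fun i a => ⟨a, stepProb_pos θ hmix i a a⟩) (stepProb_cross θ hJ hmix), fun a x => ?_⟩
  rw [sum_pathWeight_eq_one (sum_stepProb θ), div_one, pathProb_eq_pathWeight θ a]

/-- The posterior law of the path given the observations is a chain. -/
theorem isChain_posterior (hJ : 2 ≤ J) (hmix : θ.IsMixing) {y : Fin n → 𝕐}
    (hy : 0 < ∑ x, pathDensity θ y x) :
    ∃ p : Fin J → (Fin n → Fin J) → ℝ, IsChain (1 - θ.rho0) n p ∧
      ∀ a x, p a x = pathDensity θ y x / ∑ z, pathDensity θ y z := by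
  have hpos : ∀ i, ∃ b, 0 < relDensity θ b (y i) := by
    obtain ⟨x, -, hx⟩ : ∃ x ∈ Finset.univ, 0 < pathDensity θ y x := by
      by_contra hcon
      push Not at hcon
      linarith [Finset.sum_nonpos hcon]
    intro i
    refine ⟨x i, ?_⟩
    by_contra hcon
    have h0 : relDensity θ (x i) (y i) = 0 := by simpa using hcon
    have : pathDensity θ y x = 0 := by
      rw [pathDensity, Finset.prod_eq_zero (Finset.mem_univ i) (by simp [h0]), mul_zero]
    exact hx.ne' this
  refine ⟨_, isChain_pathWeight (rate_bounds θ hJ hmix).2.1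
    (q := fun i a b => stepProb θ i a b * relDensity θ b (y i))
    (fun i a b => mul_nonneg (stepProb_nonneg θ i a b) (NNReal.coe_nonneg _))
    (fun i a => ?_) (fun i a a' b b' => ?_), fun a x => ?_⟩
  · obtain ⟨b, hb⟩ := hpos i
    exact ⟨b, mul_pos (stepProb_pos θ hmix i a b) (by exact_mod_cast hb)⟩
  · have := mul_le_mul_of_nonneg_right (stepProb_cross θ hJ hmix i a a' b b')
      (mul_nonneg (NNReal.coe_nonneg (relDensity θ b (y i)))
        (NNReal.coe_nonneg (relDensity θ b' (y i))))
    linarith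
  · simp only [pathDensity_eq_pathWeight θ a]

end Model

/-! ### Matchings between partitions as injective assignments -/

section Overlap

variable {n J : ℕ}

theorem mem_parts_partitionOf {x : Fin n → Fin J} {C : Finset (Fin n)}
    (hC : C ∈ (partitionOf x).parts) {i j : Fin n} (hi : i ∈ C) : j ∈ C ↔ x i = x j := by
  classical
  rw [← (partitionOf x).part_eq_of_mem hC hi, partitionOf, Finpartition.mem_part_ofSetoid_iff_rel]
  exact Iff.rfl

/-- The blocks of a partition of `Fin n` can be numbered by `Fin (n + J)`, leaving `J` numbers
unused for labels without a partner, so that every matching with the classes of a labelling is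
given by an injective assignment of numbers to labels. -/
theorem exists_hits_ge_overlap (hn : 1 ≤ n) (A : Partitions n) :
    ∃ b : Fin n → Fin (n + J), ∀ x : Fin n → Fin J, ∃ σ : Fin J → Fin (n + J),
      Function.Injective σ ∧ (overlap A (partitionOf x) : ℝ) ≤ hits b σ x := by
  classical
  have hrep : ∀ C : Finset (Fin n), ∃ i : Fin n, C.Nonempty → i ∈ C := by
    intro C
    by_cases hC : C.Nonempty
    · obtain ⟨i, hi⟩ := hC
      exact ⟨i, fun _ => hi⟩
    · exact ⟨⟨0, hn⟩, fun h => absurd h hC⟩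
  choose rep hrep using hrep
  refine ⟨fun i => Fin.castAdd J (rep (A.part i)), fun x => ?_⟩
  obtain ⟨M, hM, hMeq⟩ := Finset.exists_mem_eq_sup
    ((A.parts ×ˢ (partitionOf x).parts).powerset.filter fun M => IsMatching M)
    ⟨∅, by simp [IsMatching]⟩ (fun M => ∑ e ∈ M, (e.1 ∩ e.2).card)
  rw [Finset.mem_filter, Finset.mem_powerset] at hM
  obtain ⟨hsub, hmatch⟩ := hM
  have h1 : ∀ e ∈ M, e.1 ∈ A.parts := fun e he => (Finset.mem_product.1 (hsub he)).1
  have h2 : ∀ e ∈ M, e.2 ∈ (partitionOf x).parts := fun e he =>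
    (Finset.mem_product.1 (hsub he)).2
  have huniq : ∀ e ∈ M, ∀ e' ∈ M, ∀ i ∈ e.2, ∀ i' ∈ e'.2, x i = x i' → e = e' := by
    intro e he e' he' i hi i' hi' hx
    have : i' ∈ e.2 := (mem_parts_partitionOf (h2 e he) hi).2 hx
    exact hmatch e he e' he' (Or.inr ((partitionOf x).eq_of_mem_parts (h2 e he) (h2 e' he') this hi'))
  let σ : Fin J → Fin (n + J) := fun s =>
    if h : ∃ e ∈ M, ∃ i ∈ e.2, x i = s then Fin.castAdd J (rep h.choose.1) else Fin.natAdd n s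
  have hσM : ∀ e ∈ M, ∀ i ∈ e.2, σ (x i) = Fin.castAdd J (rep e.1) := by
    intro e he i hi
    have h : ∃ e ∈ M, ∃ j ∈ e.2, x j = x i := ⟨e, he, i, hi, rfl⟩
    obtain ⟨hc, i', hi', hx⟩ := h.choose_spec
    simp only [σ, dif_pos h]
    rw [huniq _ hc e he i' hi' i hi hx]
  have hrepA : ∀ e ∈ M, rep e.1 ∈ e.1 := fun e he => hrep _ (A.nonempty_of_mem_parts (h1 e he))
  refine ⟨σ, fun s s' hss => ?_, ?_⟩
  · by_cases h : ∃ e ∈ M, ∃ i ∈ e.2, x i = s <;> by_cases h' : ∃ e ∈ M, ∃ i ∈ e.2, x i = s'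
    · obtain ⟨e, he, i, hi, rfl⟩ := h
      obtain ⟨e', he', i', hi', rfl⟩ := h'
      rw [hσM e he i hi, hσM e' he' i' hi'] at hss
      have h3 : rep e.1 = rep e'.1 := Fin.castAdd_injective _ _ hss
      have h4 : e = e' := hmatch e he e' he' (Or.inl (A.eq_of_mem_parts (h1 e he) (h1 e' he')
        (hrepA e he) (h3 ▸ hrepA e' he')))
      subst h4
      exact (mem_parts_partitionOf (h2 e he) hi).1 hi'
    · simp only [σ, dif_pos h, dif_neg h'] at hss
      replace hss := congrArg Fin.val hss
      simp only [Fin.val_castAdd, Fin.val_natAdd] at hss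
      have := (rep h.choose.1).isLt
      omega
    · simp only [σ, dif_neg h, dif_pos h'] at hss
      replace hss := congrArg Fin.val hss
      simp only [Fin.val_castAdd, Fin.val_natAdd] at hss
      have := (rep h'.choose.1).isLt
      omega
    · simp only [σ, dif_neg h, dif_neg h'] at hss
      exact Fin.natAdd_injective _ _ hss
  · have hov : overlap A (partitionOf x) = ∑ e ∈ M, (e.1 ∩ e.2).card := by
      rw [overlap, ← hMeq]
    have hcard : ∀ e : Finset (Fin n) × Finset (Fin n),
        (((e.1 ∩ e.2).card : ℕ) : ℝ) = ∑ i, if i ∈ e.1 ∩ e.2 then 1 else 0 := fun e => by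
      rw [Finset.sum_boole, Finset.filter_univ_mem]
    rw [hov, Nat.cast_sum]
    simp only [hcard]
    rw [Finset.sum_comm]
    refine Finset.sum_le_sum fun i _ => ?_
    by_cases hex : ∃ e ∈ M, i ∈ e.1 ∩ e.2
    · obtain ⟨e, he, hi⟩ := hex
      have hi' := Finset.mem_inter.1 hi
      rw [Finset.sum_eq_single_of_mem e he, if_pos hi, if_pos]
      · beta_reduce
        rw [hσM e he i hi'.2, A.part_eq_of_mem (h1 e he) hi'.1]
      · intro e' he' hne
        rw [if_neg]
        intro hi''
        exact hne (huniq e' he' e he i (Finset.mem_inter.1 hi'').2 i hi'.2 rfl)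
    · push Not at hex
      rw [Finset.sum_eq_zero fun e he => if_neg (hex e he)]
      split_ifs <;> norm_num

theorem hits_le {S B : Type*} [DecidableEq B] (b : Fin n → B) (σ : S → B)
    (x : Fin n → S) : hits b σ x ≤ n := by
  calc hits b σ x ≤ ∑ i : Fin n, (1 : ℝ) :=
        Finset.sum_le_sum fun i _ => by split_ifs <;> norm_num
    _ = n := by simp

theorem loss_mem (hn : 1 ≤ n) (A : Partitions n) (x : Fin n → Fin J) :
    0 ≤ loss A (partitionOf x) ∧ loss A (partitionOf x) ≤ 1 := by
  obtain ⟨b, hb⟩ := exists_hits_ge_overlap (J := J) hn A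
  obtain ⟨σ, -, hσ⟩ := hb x
  have hn0 : (0 : ℝ) < n := by exact_mod_cast hn
  have h1 := hσ.trans (hits_le b σ x)
  rw [loss, one_div, inv_mul_eq_div]
  constructor
  · rw [sub_nonneg, div_le_one hn0]; exact h1
  · rw [sub_le_self_iff]; positivity

end Overlap

/-! ### Comparison of the risks -/

section Risk

variable {J : ℕ} {𝕐 : Type*} [MeasurableSpace 𝕐] {L : Measure 𝕐} (θ : Param J L) {n : ℕ}

/-- The proportion of misclassified times. -/
def errorRate (h : Classifier J 𝕐 n) (ω : (Fin n → Fin J) × (Fin n → 𝕐)) : ℝ :=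
  (1 / (n : ℝ)) * ∑ i : Fin n, (if h.1 ω.2 i ≠ ω.1 i then (1 : ℝ) else 0)

theorem errorRate_mem (hn : 1 ≤ n) (h : Classifier J 𝕐 n) (ω : (Fin n → Fin J) × (Fin n → 𝕐)) :
    0 ≤ errorRate h ω ∧ errorRate h ω ≤ 1 := by
  have hn0 : (0 : ℝ) < n := by exact_mod_cast hn
  rw [errorRate, one_div, inv_mul_eq_div]
  constructor
  · exact div_nonneg (Finset.sum_nonneg fun i _ => by split_ifs <;> norm_num) hn0.le
  · rw [div_le_one hn0]
    calc ∑ i : Fin n, (if h.1 ω.2 i ≠ ω.1 i then (1 : ℝ) else 0) ≤ ∑ i : Fin n, (1 : ℝ) :=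
          Finset.sum_le_sum fun i _ => by split_ifs <;> norm_num
      _ = n := by simp

theorem measurable_errorRate (h : Classifier J 𝕐 n) (x : Fin n → Fin J) :
    Measurable fun y => errorRate h (x, y) :=
  (Measurable.of_discrete (f := fun z : Fin n → Fin J =>
    (1 / (n : ℝ)) * ∑ i : Fin n, (if z i ≠ x i then (1 : ℝ) else 0))).comp h.2

theorem classRisk_nonneg (hn : 1 ≤ n) (h : Classifier J 𝕐 n) : 0 ≤ θ.classRisk h :=
  integral_nonneg fun ω => (errorRate_mem hn h ω).1

theorem bayesClassRisk_le (hn : 1 ≤ n) (h : Classifier J 𝕐 n) :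
    θ.bayesClassRisk n ≤ θ.classRisk h :=
  ciInf_le ⟨0, by rintro _ ⟨h, rfl⟩; exact classRisk_nonneg θ hn h⟩ h

theorem bayesClassRisk_nonneg (hn : 1 ≤ n) : 0 ≤ θ.bayesClassRisk n :=
  Real.iInf_nonneg fun h => classRisk_nonneg θ hn h

theorem clustRisk_nonneg (hn : 1 ≤ n) (g : Clusterer 𝕐 n) : 0 ≤ θ.clustRisk g :=
  integral_nonneg fun ω => (loss_mem hn (g.1 ω.2) ω.1).1

/-- A pointwise comparison, given the observations, integrates to a comparison of the risks. -/
theorem risk_comparison (hJ : 0 < J) (hn : 1 ≤ n) (g : Clusterer 𝕐 n) (h : Classifier J 𝕐 n)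
    (a : ℝ) (G : (Fin n → Fin J) → ℝ)
    (hle : ∀ y, ∑ x, pathDensity θ y x * (a * errorRate h (x, y) - G x) ≤
      ∑ x, pathDensity θ y x * loss (g.1 y) (partitionOf x)) :
    a * θ.classRisk h - ∑ x, θ.pathProb x * G x ≤ θ.clustRisk g := by
  have := law_isProbabilityMeasure θ (n := n) hJ
  have hGb : ∀ x, |G x| ≤ ∑ x, |G x| := fun x =>
    Finset.single_le_sum (f := fun x => |G x|) (fun x _ => abs_nonneg _) (Finset.mem_univ x)
  have herr : ∀ ω, |errorRate h ω| ≤ 1 := fun ω =>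
    abs_le.2 ⟨by linarith [(errorRate_mem hn h ω).1], (errorRate_mem hn h ω).2⟩
  have hmono := integral_law_mono θ (F := fun ω => a * errorRate h ω - G ω.1)
    (G := fun ω => loss (g.1 ω.2) (partitionOf ω.1)) (C := |a| + ∑ x, |G x|) (D := 1)
    (fun x => ((measurable_errorRate h x).const_mul a).sub_const (G x))
    (fun ω => by
      refine (abs_sub _ _).trans (add_le_add ?_ (hGb _))
      rw [abs_mul]
      exact mul_le_of_le_one_right (abs_nonneg a) (herr ω))
    (fun x => (measurable_from_top (f := fun A : Partitions n => loss A (partitionOf x))).comp g.2)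
    (fun ω => abs_le.2 ⟨by linarith [(loss_mem hn (g.1 ω.2) ω.1).1],
      (loss_mem hn (g.1 ω.2) ω.1).2⟩) hle
  rw [integral_sub, integral_const_mul, integral_law_path] at hmono
  · exact hmono
  · refine (Integrable.of_bound (C := 1) ?_ (Filter.Eventually.of_forall herr)).const_mul a
    exact (measurable_from_prod_countable_right (measurable_errorRate h)).aestronglyMeasurable
  · refine Integrable.of_bound (C := ∑ x, |G x|) ?_
      (Filter.Eventually.of_forall fun ω => hGb ω.1)
    exact (Measurable.of_discrete.comp measurable_fst).aestronglyMeasurable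

/-- A measurable choice of the index of the largest of finitely many measurable functions. -/
theorem exists_measurable_argmax {Y S : Type*} [MeasurableSpace Y] [Fintype S] [Nonempty S]
    [MeasurableSpace S] {F : S → Y → ℝ} (hF : ∀ s, Measurable (F s)) :
    ∃ h : Y → S, Measurable h ∧ ∀ y s, F s y ≤ F (h y) y := by
  classical
  let c : (S → S → Prop) → S := fun R =>
    if h : ∃ s, ∀ s', R s' s then h.choose else Classical.arbitrary S
  have hm : Measurable fun (y : Y) (s s' : S) => F s y ≤ F s' y :=
    measurable_pi_iff.2 fun s => measurable_pi_iff.2 fun s' =>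
      measurableSet_setOfPred.1 (measurableSet_le (hF s) (hF s'))
  refine ⟨fun y => c fun s s' => F s y ≤ F s' y, (Measurable.of_discrete (f := c)).comp hm, fun y s => ?_⟩
  have h : ∃ s, ∀ s', F s' y ≤ F s y := Finite.exists_max fun s => F s y
  simp only [c, dif_pos h]
  exact h.choose_spec s

/-- The classifier that picks the posterior modes of the individual hidden states. -/
theorem exists_modal_classifier (hJ : 0 < J) :
    ∃ h : Classifier J 𝕐 n, ∀ y i s,
      marginal (pathDensity θ y) i s ≤ marginal (pathDensity θ y) i (h.1 y i) := by
  have : Nonempty (Fin J) := ⟨⟨0, hJ⟩⟩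
  have hm : ∀ i s, Measurable fun y : Fin n → 𝕐 => marginal (pathDensity θ y) i s := fun i s =>
    Finset.measurable_fun_sum _ fun x _ => by
      split_ifs
      exacts [measurable_pathDensity θ x, measurable_const]
  choose h hmeas hmax using fun i => exists_measurable_argmax (hm i)
  exact ⟨⟨fun y i => h i y, measurable_pi_iff.2 hmeas⟩, fun y i s => hmax i y s⟩

theorem sum_mul_errorRate (hn : 1 ≤ n) (h : Classifier J 𝕐 n) (y : Fin n → 𝕐)
    (W : (Fin n → Fin J) → ℝ) :
    ∑ x, W x * errorRate h (x, y) = ∑ x, W x - 1 / (n : ℝ) * ∑ i, marginal W i (h.1 y i) := by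
  have hn0 : (n : ℝ) ≠ 0 := by exact_mod_cast (by omega : n ≠ 0)
  have e : ∀ x, errorRate h (x, y) = 1 - 1 / (n : ℝ) * ∑ i, if x i = h.1 y i then 1 else 0 := by
    intro x
    have : ∀ i, (if h.1 y i ≠ x i then (1 : ℝ) else 0) = 1 - if x i = h.1 y i then 1 else 0 := by
      intro i
      by_cases hi : x i = h.1 y i
      · simp [hi]
      · simp [hi, Ne.symm hi]
    simp only [errorRate, this, Finset.sum_sub_distrib, Finset.sum_const, Finset.card_univ,
      Fintype.card_fin, nsmul_eq_mul, mul_one, mul_sub]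
    rw [one_div, inv_mul_cancel₀ hn0]
  simp only [e, mul_sub, mul_one, Finset.sum_sub_distrib, marginal]
  congr 1
  rw [Finset.sum_comm, Finset.mul_sum]
  refine Finset.sum_congr rfl fun x _ => ?_
  rw [mul_left_comm, Finset.mul_sum]
  congr 1
  exact Finset.sum_congr rfl fun i _ => by simp

/-- Passing from posterior probabilities to densities. -/
theorem sum_pathDensity_mul {y : Fin n → 𝕐} (hZ : 0 < ∑ x, pathDensity θ y x)
    {p : (Fin n → Fin J) → ℝ} (hp : ∀ x, p x = pathDensity θ y x / ∑ z, pathDensity θ y z)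
    (F : (Fin n → Fin J) → ℝ) :
    ∑ x, pathDensity θ y x * F x = (∑ x, pathDensity θ y x) * ∑ x, p x * F x := by
  rw [Finset.mul_sum]
  refine Finset.sum_congr rfl fun x _ => ?_
  rw [hp]
  field_simp

theorem sum_marginalMax_le {y : Fin n → 𝕐} (hJ : 0 < J) (hZ : 0 < ∑ x, pathDensity θ y x)
    {p : (Fin n → Fin J) → ℝ} (hp : ∀ x, p x = pathDensity θ y x / ∑ z, pathDensity θ y z)
    {h : Fin n → Fin J}
    (hmax : ∀ i s, marginal (pathDensity θ y) i s ≤ marginal (pathDensity θ y) i (h i)) :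
    (∑ x, pathDensity θ y x) * ∑ i, marginalMax p i ≤ ∑ i, marginal (pathDensity θ y) i (h i) := by
  have : Nonempty (Fin J) := ⟨⟨0, hJ⟩⟩
  rw [Finset.mul_sum]
  refine Finset.sum_le_sum fun i _ => ?_
  rw [← le_div_iff₀' hZ]
  refine ciSup_le fun s => ?_
  rw [le_div_iff₀' hZ]
  refine le_trans (le_of_eq ?_) (hmax i s)
  simp only [marginal, Finset.mul_sum, hp]
  refine Finset.sum_congr rfl fun x _ => ?_
  split_ifs
  · field_simp
  · simp

theorem eq_zero_of_sum_eq_zero {y : Fin n → 𝕐} (hZ : ¬ 0 < ∑ x, pathDensity θ y x)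
    (x : Fin n → Fin J) : pathDensity θ y x = 0 :=
  (Finset.sum_eq_zero_iff_of_nonneg fun x _ => pathDensity_nonneg θ y x).1
    (le_antisymm (not_lt.1 hZ) (Finset.sum_nonneg fun x _ => pathDensity_nonneg θ y x)) x
    (Finset.mem_univ x)

/-- Overlaps are bounded by hits of a well-chosen injective assignment. -/
theorem sum_mul_loss_ge (hn : 1 ≤ n) (A : Partitions n) {W : (Fin n → Fin J) → ℝ}
    (hW : ∀ x, 0 ≤ W x) :
    ∃ (b : Fin n → Fin (n + J)) (σ : (Fin n → Fin J) → Fin J → Fin (n + J)),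
      (∀ x, Function.Injective (σ x)) ∧
      ∑ x, W x - 1 / (n : ℝ) * ∑ x, W x * hits b (σ x) x ≤
        ∑ x, W x * loss A (partitionOf x) := by
  obtain ⟨b, hb⟩ := exists_hits_ge_overlap (J := J) hn A
  choose σ hσ hle using hb
  refine ⟨b, σ, hσ, ?_⟩
  rw [Finset.mul_sum, ← Finset.sum_sub_distrib]
  refine Finset.sum_le_sum fun x _ => ?_
  have h1 := mul_le_mul_of_nonneg_left (hle x) (mul_nonneg (hW x) (by positivity : 0 ≤ 1 / (n : ℝ)))
  rw [loss]
  linarith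

theorem two_le_of_isDependent (hdep : θ.IsDependent) : 2 ≤ J := by
  obtain ⟨x, x', h⟩ := hdep
  by_contra hJ
  have : x = x' := by
    apply Fin.ext
    have := x.isLt
    have := x'.isLt
    omega
  exact h (this ▸ rfl)

/-- The additive comparison for one clusterer. -/
theorem clustRisk_ge_additive (hJ : 2 ≤ J) (hmix : θ.IsMixing) (hn : 1 ≤ n) (g : Clusterer 𝕐 n) :
    θ.bayesClassRisk n - 1 / (n : ℝ) *
      (1 / (1 - θ.rho0) * √(n * (Real.log (J ! : ℝ) / 2))) ≤ θ.clustRisk g := by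
  obtain ⟨h, hmax⟩ := exists_modal_classifier θ (n := n) (by omega : 0 < J)
  obtain ⟨hr0, hr1, -⟩ := rate_bounds θ hJ hmix
  set T := 1 / (1 - θ.rho0) * √(n * (Real.log (J ! : ℝ) / 2)) with hT
  have hn0 : (0 : ℝ) < n := by exact_mod_cast hn
  have hcomp := risk_comparison θ (by omega) hn g h 1 (fun _ => 1 / (n : ℝ) * T) fun y => by
    obtain ⟨b, σ, hσ, hle⟩ := sum_mul_loss_ge hn (g.1 y) (pathDensity_nonneg θ y)
    refine le_trans ?_ hle
    simp only [one_mul, mul_sub, Finset.sum_sub_distrib, sum_mul_errorRate hn, ← Finset.sum_mul]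
    have hkey : ∑ x, pathDensity θ y x * hits b (σ x) x ≤
        ∑ i, marginal (pathDensity θ y) i (h.1 y i) + (∑ x, pathDensity θ y x) * T := by
      by_cases hZ : 0 < ∑ x, pathDensity θ y x
      · obtain ⟨p, hp, hpeq⟩ := isChain_posterior θ hJ hmix hZ
        have a : Fin J := ⟨0, by omega⟩
        have h1 := hp.sum_hits_le hr0 hr1 a b (by simp) (by simpa using hJ) hn hσ
        rw [Fintype.card_fin, ← hT] at h1
        rw [sum_pathDensity_mul θ hZ (hpeq a)]
        have h2 := mul_le_mul_of_nonneg_left h1 hZ.le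
        have h3 := sum_marginalMax_le θ (by omega) hZ (hpeq a) (hmax y)
        linarith
      · simp [eq_zero_of_sum_eq_zero θ hZ, marginal]
    have h2 := mul_le_mul_of_nonneg_left hkey (by positivity : 0 ≤ 1 / (n : ℝ))
    linarith
  rw [one_mul, ← Finset.sum_mul, sum_pathProb θ (by omega), one_mul] at hcomp
  linarith [bayesClassRisk_le θ hn h]

end Risk

/-! ### The multiplicative comparison -/

section Multiplicative

variable {J : ℕ} {𝕐 : Type*} [MeasurableSpace 𝕐] {L : Measure 𝕐} (θ : Param J L) {n : ℕ}

theorem beta_nonneg : 0 ≤ θ.beta n := Real.iInf_nonneg fun _ => measureReal_nonneg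

theorem beta_le (i : Fin n) {j k : Fin J} (hjk : j ≠ k) :
    θ.beta n ≤ ∑ x, θ.pathProb x * ((if x i = j then 1 else 0) + if x i = k then 1 else 0) := by
  refine (ciInf_le (Set.finite_range _).bddBelow
    (⟨(i, j, k), hjk⟩ : {t : Fin n × Fin J × Fin J // t.2.1 ≠ t.2.2})).trans (le_of_eq ?_)
  have hm : MeasurableSet {ω : (Fin n → Fin J) × (Fin n → 𝕐) | ω.1 i = j ∨ ω.1 i = k} :=
    (Set.toFinite {x : Fin n → Fin J | x i = j ∨ x i = k}).measurableSet.preimage measurable_fst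
  rw [← integral_law_path θ fun x => (if x i = j then (1 : ℝ) else 0) + if x i = k then 1 else 0]
  rw [← integral_indicator_one hm]
  congr 1
  funext ω
  by_cases h1 : ω.1 i = j
  · simp [h1, hjk]
  · by_cases h2 : ω.1 i = k <;> simp [h1, h2, hjk.symm]

theorem mul_beta_le_visits {j k : Fin J} (hjk : j ≠ k) :
    n * θ.beta n ≤
      ∑ x : Fin n → Fin J, θ.pathProb x * ∑ i, ((if x i = j then 1 else 0) + if x i = k then 1 else 0) := by
  simp only [Finset.mul_sum]
  rw [Finset.sum_comm]
  calc n * θ.beta n = ∑ _i : Fin n, θ.beta n := by simp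
    _ ≤ _ := Finset.sum_le_sum fun i _ => beta_le θ i hjk

/-- Averaging over all pairs of states. -/
theorem card_mul_beta_le (hJ : 2 ≤ J) (hn : 1 ≤ n) : J * θ.beta n ≤ 2 := by
  have hJ2 : (2 : ℝ) ≤ J := by exact_mod_cast hJ
  let i : Fin n := ⟨0, hn⟩
  have h1 : ∑ j, marginal (θ.pathProb (n := n)) i j = 1 := by
    rw [sum_marginal, sum_pathProb θ (by omega)]
  have h2 : ∀ j k, j ≠ k → θ.beta n ≤ marginal θ.pathProb i j + marginal θ.pathProb i k := by
    intro j k hjk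
    refine (beta_le θ i hjk).trans (le_of_eq ?_)
    simp only [marginal, mul_add, Finset.sum_add_distrib, mul_ite, mul_one, mul_zero]
  have h3 : ∀ j, ((J : ℝ) - 1) * θ.beta n ≤ ((J : ℝ) - 2) * marginal θ.pathProb i j + 1 := by
    intro j
    have h4 := Finset.sum_le_sum fun k (hk : k ∈ Finset.univ.erase j) =>
      h2 j k (Finset.ne_of_mem_erase hk).symm
    have h5 := Finset.sum_erase_add _ (marginal (θ.pathProb (n := n)) i) (Finset.mem_univ j)
    rw [Finset.sum_add_distrib, Finset.sum_const, Finset.sum_const,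
      Finset.card_erase_of_mem (Finset.mem_univ j), Finset.card_univ, Fintype.card_fin,
      nsmul_eq_mul, nsmul_eq_mul, Nat.cast_sub (by omega), Nat.cast_one] at h4
    linarith
  have h6 := Finset.sum_le_sum fun j (_ : j ∈ Finset.univ) => h3 j
  rw [Finset.sum_add_distrib, ← Finset.mul_sum, ← Finset.mul_sum, h1] at h6
  simp only [Finset.sum_const, Finset.card_univ, Fintype.card_fin, nsmul_eq_mul] at h6
  nlinarith

theorem sum_card_Iio (J : ℕ) : ∑ j : Fin J, ((Finset.Iio j).card : ℝ) = J * (J - 1) / 2 := by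
  simp only [Fin.card_Iio]
  rw [Fin.sum_univ_eq_sum_range (fun i => (i : ℝ)), eq_div_iff two_ne_zero]
  cases J with
  | zero => simp
  | succ J =>
    have := Finset.sum_range_id_mul_two (J + 1)
    rw [← Nat.cast_sum]
    have h := congrArg (Nat.cast (R := ℝ)) this
    push_cast at h ⊢
    simpa using h

/-- The exponential penalty of paths that visit the states `j` and `k` fewer than `n β - t` times,
with `t = β n / 5`. -/
def rarityPenalty (n : ℕ) (r β : ℝ) (j k : Fin J) (x : Fin n → Fin J) : ℝ :=
  Real.exp (-(4 * r ^ 2 * (β * n / 5) / (n * 1 ^ 2)) *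
    (∑ i, ((if x i = j then 1 else 0) + if x i = k then 1 else 0) - n * β + β * n / 5))

theorem rarityPenalty_nonneg (r β : ℝ) (j k : Fin J) (x : Fin n → Fin J) :
    0 ≤ rarityPenalty n r β j k x := Real.exp_nonneg _

/-- The penalties are small in expectation. -/
theorem sum_pathProb_mul_rarityPenalty (hJ : 2 ≤ J) (hmix : θ.IsMixing) (hn : 1 ≤ n)
    {j k : Fin J} (hjk : j ≠ k) :
    ∑ x, θ.pathProb x * rarityPenalty n (1 - θ.rho0) (θ.beta n) j k x ≤
      Real.exp (-(2 * n * (1 - θ.rho0) ^ 2 * θ.beta n ^ 2 / 25)) := by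
  obtain ⟨hr0, hr1, -⟩ := rate_bounds θ hJ hmix
  obtain ⟨p, hp, hpeq⟩ := isChain_prior θ (n := n) hJ hmix
  have hβ := beta_nonneg θ (n := n)
  have hn0 : (0 : ℝ) < n := by exact_mod_cast hn
  have a : Fin J := ⟨0, by omega⟩
  have h1 := hp.sum_exp_neg_le hr0 hr1 a hn
    (θ := fun _ s => (if s = j then 1 else 0) + if s = k then 1 else 0) one_pos
    (fun _ s s' => by
      have h0 : (0 : ℝ) ≤ (if s' = j then 1 else 0) + if s' = k then 1 else 0 := by positivity
      have h2 : (if s = j then (1 : ℝ) else 0) + (if s = k then 1 else 0) ≤ 1 := by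
        by_cases h1 : s = j
        · simp [h1, hjk]
        · simp only [h1, if_false, zero_add]
          split_ifs <;> norm_num
      linarith) (t := θ.beta n * n / 5) (m := n * θ.beta n) (by positivity)
    (by simp only [hpeq]; exact mul_beta_le_visits θ hjk)
  simp only [hpeq] at h1
  refine h1.trans (le_of_eq ?_)
  congr 2
  field_simp
  ring

/-- If the posterior mean number of visits to `j` and `k` is small, the penalty is at least one on
average. -/
theorem one_le_sum_mul_rarityPenalty {p : (Fin n → Fin J) → ℝ} (hp0 : ∀ x, 0 ≤ p x)
    (hp1 : ∑ x, p x = 1) (r : ℝ) {β : ℝ} (hβ : 0 ≤ β) (j k : Fin J)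
    (hle : ∑ x, p x * (visits x j + visits x k) ≤ 4 / 5 * β * n) :
    1 ≤ ∑ x, p x * rarityPenalty n r β j k x := by
  set s := 4 * r ^ 2 * (β * n / 5) / (n * 1 ^ 2) with hs
  have hs0 : 0 ≤ s := by positivity
  have h1 : ∀ x, p x * (1 + s * (4 / 5 * β * n)) - s * (p x * (visits x j + visits x k)) ≤
      p x * rarityPenalty n r β j k x := by
    intro x
    have h2 := Real.add_one_le_exp (-s * (visits x j + visits x k - n * β + β * n / 5))
    have h3 : rarityPenalty n r β j k x =
        Real.exp (-s * (visits x j + visits x k - n * β + β * n / 5)) := by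
      rw [rarityPenalty, Finset.sum_add_distrib]
      rfl
    have h4 := mul_le_mul_of_nonneg_left h2 (hp0 x)
    rw [h3]
    refine le_trans (le_of_eq ?_) h4
    ring
  have h5 := Finset.sum_le_sum fun x (_ : x ∈ Finset.univ) => h1 x
  rw [Finset.sum_sub_distrib, ← Finset.sum_mul, hp1, ← Finset.mul_sum] at h5
  nlinarith

theorem clustRisk_ge_of_xi_le_one (hJ : 2 ≤ J) (hmix : θ.IsMixing) (hn : 1 ≤ n)
    (g : Clusterer 𝕐 n) {T : ℝ}
    (hT : T = 1 / (1 - θ.rho0) * √(n * (Real.log (J ! : ℝ) / 2)))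
    (hβ : 0 < θ.beta n) (hTβ : 5 * T ≤ θ.beta n * n) :
    (1 - 5 * T / (θ.beta n * n)) * θ.bayesClassRisk n - ((J : ℝ) ^ 2 + 1) *
      Real.exp (-(2 * n * (1 - θ.rho0) ^ 2 * θ.beta n ^ 2 / 25)) ≤ θ.clustRisk g := by
  obtain ⟨h, hmax⟩ := exists_modal_classifier θ (n := n) (by omega : 0 < J)
  obtain ⟨hr0, hr1, -⟩ := rate_bounds θ hJ hmix
  have hn0 : (0 : ℝ) < n := by exact_mod_cast hn
  have hJ2 : (2 : ℝ) ≤ J := by exact_mod_cast hJ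
  have hβn : 0 < θ.beta n * n := mul_pos hβ hn0
  have ha : 0 ≤ 1 - 5 * T / (θ.beta n * n) := by
    rw [sub_nonneg, div_le_one hβn]; exact hTβ
  set a := 1 - 5 * T / (θ.beta n * n) with hadef
  have ha1 : a ≤ 1 := by
    have : 0 ≤ T := by rw [hT]; positivity
    rw [hadef, sub_le_self_iff]; positivity
  set η := Real.exp (-(2 * n * (1 - θ.rho0) ^ 2 * θ.beta n ^ 2 / 25)) with hη
  have hη0 : 0 ≤ η := Real.exp_nonneg _
  set R : (Fin n → Fin J) → ℝ := fun x => ∑ j : Fin J, ∑ k ∈ Finset.Iio j,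
    rarityPenalty n (1 - θ.rho0) (θ.beta n) k j x with hR
  have hR0 : ∀ x, 0 ≤ R x := fun x => Finset.sum_nonneg fun j _ => Finset.sum_nonneg fun k _ =>
    rarityPenalty_nonneg _ _ _ _ _
  have hcomp := risk_comparison θ (by omega) hn g h a (fun x => 2 * ((J : ℝ) - 1) * η + R x)
    fun y => by
      obtain ⟨b, σ, hσ, hle⟩ := sum_mul_loss_ge hn (g.1 y) (pathDensity_nonneg θ y)
      refine le_trans ?_ hle
      by_cases hZ : 0 < ∑ x, pathDensity θ y x
      swap
      · simp [eq_zero_of_sum_eq_zero θ hZ]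
      obtain ⟨p, hp, hpeq⟩ := isChain_posterior θ hJ hmix hZ
      have s₀ : Fin J := ⟨0, by omega⟩
      have hp0 := hp.nonneg s₀
      have hp1 := hp.sum_eq_one s₀
      have hM := sum_marginalMax_le θ (by omega) hZ (hpeq s₀) (hmax y)
      -- in both cases the bound holds for the posterior law
      suffices hpost : ∑ x, p s₀ x * hits b (σ x) x ≤ n - a * (n - ∑ i, marginalMax (p s₀) i) +
          n * (2 * ((J : ℝ) - 1) * η) + n * ∑ x, p s₀ x * R x by
        simp only [mul_sub, mul_add, mul_left_comm _ a, Finset.sum_sub_distrib,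
          Finset.sum_add_distrib, ← Finset.mul_sum, sum_mul_errorRate hn, ← Finset.sum_mul]
        rw [sum_pathDensity_mul θ hZ (hpeq s₀) R,
          sum_pathDensity_mul θ hZ (hpeq s₀) fun x => hits b (σ x) x]
        set Z := ∑ x, pathDensity θ y x
        set M := ∑ i, marginalMax (p s₀) i
        set M' := ∑ i, marginal (pathDensity θ y) i (h.1 y i)
        have h1 := mul_le_mul_of_nonneg_left hpost hZ.le
        have h2 := mul_le_mul_of_nonneg_left hM ha
        have h3 : 1 / (n : ℝ) * (Z * ∑ x, p s₀ x * hits b (σ x) x) ≤ 1 / (n : ℝ) *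
            (n * Z - a * (n * Z - M') + n * (Z * (2 * ((J : ℝ) - 1) * η)) +
              n * (Z * ∑ x, p s₀ x * R x)) :=
          mul_le_mul_of_nonneg_left (by linarith) (by positivity)
        have e : 1 / (n : ℝ) *
            (n * Z - a * (n * Z - M') + n * (Z * (2 * ((J : ℝ) - 1) * η)) +
              n * (Z * ∑ x, p s₀ x * R x)) =
            Z - a * (Z - 1 / (n : ℝ) * M') + Z * (2 * ((J : ℝ) - 1) * η) +
              Z * ∑ x, p s₀ x * R x := by
          field_simp
        linarith
      by_cases hvis : ∀ j k, j ≠ k →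
          4 / 5 * θ.beta n * n ≤ ∑ x, p s₀ x * (visits x j + visits x k)
      · have h1 := hp.sum_hits_le_of_visits hr0 hr1 s₀ b (by simp) (by simpa using hJ) hn hσ hβ
          (by simpa using card_mul_beta_le θ hJ hn) (T := T) (by simpa using hT) hTβ hvis
        rw [Fintype.card_fin] at h1
        have h2 : 0 ≤ n * ∑ x, p s₀ x * R x :=
          mul_nonneg hn0.le (Finset.sum_nonneg fun x _ => mul_nonneg (hp0 x) (hR0 x))
        linarith
      · push Not at hvis
        obtain ⟨j, k, hjk, hlt⟩ := hvis
        obtain ⟨j, k, hjk, hlt⟩ : ∃ j k, j < k ∧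
            ∑ x, p s₀ x * (visits x j + visits x k) < 4 / 5 * θ.beta n * n := by
          rcases lt_or_gt_of_ne hjk with h1 | h1
          · exact ⟨j, k, h1, hlt⟩
          · exact ⟨k, j, h1, by simpa only [add_comm] using hlt⟩
        have h1 := one_le_sum_mul_rarityPenalty hp0 hp1 (1 - θ.rho0) hβ.le j k hlt.le
        have h2 : ∑ x, p s₀ x * rarityPenalty n (1 - θ.rho0) (θ.beta n) j k x ≤
            ∑ x, p s₀ x * R x := by
          refine Finset.sum_le_sum fun x _ => mul_le_mul_of_nonneg_left ?_ (hp0 x)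
          refine le_trans ?_ (Finset.single_le_sum (f := fun j => ∑ k ∈ Finset.Iio j,
            rarityPenalty n (1 - θ.rho0) (θ.beta n) k j x)
            (fun j _ => Finset.sum_nonneg fun k _ => rarityPenalty_nonneg _ _ _ _ _)
            (Finset.mem_univ k))
          exact Finset.single_le_sum (f := fun j => rarityPenalty n (1 - θ.rho0) (θ.beta n) j k x)
            (fun j _ => rarityPenalty_nonneg _ _ _ _ _) (Finset.mem_Iio.2 hjk)
        have h3 : ∑ x, p s₀ x * hits b (σ x) x ≤ n := by
          calc ∑ x, p s₀ x * hits b (σ x) x ≤ ∑ x, p s₀ x * n :=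
                Finset.sum_le_sum fun x _ => mul_le_mul_of_nonneg_left (hits_le b _ x) (hp0 x)
            _ = n := by rw [← Finset.sum_mul, hp1, one_mul]
        have h4 : n * 1 ≤ n * ∑ x, p s₀ x * R x :=
          mul_le_mul_of_nonneg_left (h1.trans h2) hn0.le
        have h5 : 0 ≤ ∑ i, marginalMax (p s₀) i := Finset.sum_nonneg fun i _ =>
          (marginal_nonneg hp0 i s₀).trans (marginal_le_max (p s₀) i s₀)
        have h6 : a * (n - ∑ i, marginalMax (p s₀) i) ≤ n := by
          nlinarith
        have h7 : 0 ≤ n * (2 * ((J : ℝ) - 1) * η) :=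
          mul_nonneg hn0.le (mul_nonneg (by linarith) hη0)
        linarith
  have hsumR : ∑ x, θ.pathProb x * R x ≤ J * (J - 1) / 2 * η := by
    simp only [hR, Finset.mul_sum]
    rw [Finset.sum_comm, ← sum_card_Iio, Finset.sum_mul]
    refine Finset.sum_le_sum fun j _ => ?_
    rw [Finset.sum_comm, ← nsmul_eq_mul]
    exact Finset.sum_le_card_nsmul _ _ _ fun k hk =>
      sum_pathProb_mul_rarityPenalty θ hJ hmix hn (Finset.mem_Iio.1 hk).ne
  simp only [mul_add, Finset.sum_add_distrib, ← Finset.sum_mul, sum_pathProb θ (by omega : 0 < J),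
    one_mul] at hcomp
  have h1 := mul_le_mul_of_nonneg_left (bayesClassRisk_le θ hn h) ha
  have h2 : (2 * ((J : ℝ) - 1) + J * (J - 1) / 2) * η ≤ ((J : ℝ) ^ 2 + 1) * η :=
    mul_le_mul_of_nonneg_right (by nlinarith [sq_nonneg ((J : ℝ) - 3)]) hη0
  linarith

/-- The multiplicative comparison for one clusterer. -/
theorem clustRisk_ge_multiplicative (hJ : 2 ≤ J) (hmix : θ.IsMixing) (hn : 1 ≤ n)
    (g : Clusterer 𝕐 n) :
    (1 - θ.xi n) * θ.bayesClassRisk n - ((J : ℝ) ^ 2 + 1) *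
      Real.exp (-(2 * n * (1 - θ.rho0) ^ 2 * θ.beta n ^ 2 / 25)) ≤ θ.clustRisk g := by
  obtain ⟨hr0, -, -⟩ := rate_bounds θ hJ hmix
  have hn0 : (0 : ℝ) < n := by exact_mod_cast hn
  have hclust := clustRisk_nonneg θ hn g
  have hclass := bayesClassRisk_nonneg θ (n := n) hn
  rcases (beta_nonneg θ (n := n)).eq_or_lt with hβ | hβ
  · -- the exceptional probability is then bounded by one only
    have h1 : θ.bayesClassRisk n ≤ 1 := by
      have := law_isProbabilityMeasure θ (n := n) (by omega : 0 < J)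
      let h : Classifier J 𝕐 n := ⟨fun _ _ => ⟨0, by omega⟩, measurable_const⟩
      refine (bayesClassRisk_le θ hn h).trans ?_
      calc θ.classRisk h ≤ ∫ _, (1 : ℝ) ∂(θ.law n) :=
            integral_mono_of_nonneg (Filter.Eventually.of_forall fun ω => (errorRate_mem hn h ω).1)
              (integrable_const _) (Filter.Eventually.of_forall fun ω => (errorRate_mem hn h ω).2)
        _ = 1 := by simp
    have h2 : θ.xi n = 0 := by simp [Param.xi, ← hβ]
    rw [h2, ← hβ]
    simp
    nlinarith [sq_nonneg (J : ℝ)]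
  set T := 1 / (1 - θ.rho0) * √(n * (Real.log (J ! : ℝ) / 2)) with hT
  have hxi : θ.xi n = 5 * T / (θ.beta n * n) := by
    have e : √(n * (Real.log (J ! : ℝ) / 2)) = n * √(Real.log (J ! : ℝ) / (2 * n)) := by
      rw [show (n : ℝ) * (Real.log (J ! : ℝ) / 2) = n ^ 2 * (Real.log (J ! : ℝ) / (2 * n)) by
        field_simp, Real.sqrt_mul (sq_nonneg _), Real.sqrt_sq hn0.le]
    rw [Param.xi, hT, e]
    field_simp
  rcases le_total (5 * T) (θ.beta n * n) with hTβ | hTβ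
  · rw [hxi]
    exact clustRisk_ge_of_xi_le_one θ hJ hmix hn g hT hβ hTβ
  · have h1 : 1 ≤ θ.xi n := by
      rw [hxi, le_div_iff₀ (mul_pos hβ hn0)]; linarith
    have h2 : (1 - θ.xi n) * θ.bayesClassRisk n ≤ 0 :=
      mul_nonpos_of_nonpos_of_nonneg (by linarith) hclass
    have h3 : 0 ≤ ((J : ℝ) ^ 2 + 1) *
      Real.exp (-(2 * n * (1 - θ.rho0) ^ 2 * θ.beta n ^ 2 / 25)) := by positivity
    linarith

end Multiplicative

end HMMClust

end

theorem theorem11 {𝕐 : Type*} [TopologicalSpace 𝕐] [PolishSpace 𝕐] [MeasurableSpace 𝕐]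
    [BorelSpace 𝕐] (L : Measure 𝕐) (J : ℕ) (θ : HMMClust.Param J L)
    (hdep : θ.IsDependent) (hmix : θ.IsMixing) (n : ℕ) (hn : 1 ≤ n) :
    θ.bayesClustRisk n ≥
        θ.bayesClassRisk n
          - 1 / (1 - θ.rho0) * Real.sqrt (Real.log (J ! : ℝ) / (2 * (n : ℝ))) ∧
      θ.bayesClustRisk n ≥
        (1 - θ.xi n) * θ.bayesClassRisk n
          - ((J : ℝ) ^ 2 + 1)
            * Real.exp (-(2 * (n : ℝ) * (1 - θ.rho0) ^ 2 * θ.beta n ^ 2 / 25)) := by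
  have hJ := HMMClust.two_le_of_isDependent θ hdep
  have hn0 : (0 : ℝ) < n := by exact_mod_cast hn
  have : Nonempty (HMMClust.Clusterer 𝕐 n) :=
    ⟨⟨fun _ => HMMClust.partitionOf (fun i : Fin n => i), measurable_const⟩⟩
  refine ⟨le_ciInf fun g => ?_, le_ciInf fun g =>
    HMMClust.clustRisk_ge_multiplicative θ hJ hmix hn g⟩
  refine le_trans (le_of_eq ?_) (HMMClust.clustRisk_ge_additive θ hJ hmix hn g)
  rw [show (n : ℝ) * (Real.log (J ! : ℝ) / 2) = n ^ 2 * (Real.log (J ! : ℝ) / (2 * n)) by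
    field_simp, Real.sqrt_mul (sq_nonneg _), Real.sqrt_sq hn0.le]
  field_simp
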